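/- Work in the language of second-order arithmetic (numbers and sets of numbers). $\mathsf{RCA}_0$ consists of the axioms of a discretely ordered commutative semiring with identity, $\Sigma^0_1$ induction and $\Delta^0_1$ comprehension; $\mathsf{WKL}_0$ is $\mathsf{RCA}_0$ together with "every infinite subtree of $2^{<\mathbb N}$ has an infinite path"; $\mathsf{ACA}_0$ is $\mathsf{RCA}_0$ together with arithmetical comprehension. Two statements are equivalent over $\mathsf{RCA}_0$ if $\mathsf{RCA}_0\vdash\varphi\leftrightarrow\psi$; equivalently (by the completeness theorem for first-order logic), if in every two-sorted model of $\mathsf{RCA}_0$, with arbitrary first-order part $\mathbb N$, $\varphi$ holds exactly when $\psi$ holds. The following notions are read inside such a model. Let $(L,\prec)$ be a countable linear order, that is, a set $L\subseteq\mathbb N$ with a strict linear order $\prec$ on it, both given as sets. It is *complete* if whenever $L=A^-\cup A^+$ with sets $A^-,A^+$ (possibly empty) such that $x\prec y$ for all $x\in A^-$, $y\in A^+$, then $A^-$ has a greatest element or $A^+$ has a least element. The *order topology* of $L$ has the base of intervals $U_{\langle a,b\rangle}=\{x\in L: a\prec x\prec b\}$ indexed by $I=(L\cup\{-\infty,\infty\})^2$.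 For a set $A$ let $\mathcal P_{\mathrm f}(A)$ be the set of (codes of) finite subsets of $A$. A function $g\colon\mathbb N\to\mathcal P_{\mathrm f}(I)$ codes the open set $\bigcup_n\bigcup_{i\in g(n)}U_i$. An *open cover* of $L$ is given by a function $h\colon\mathbb N\times\mathbb N\to\mathcal P_{\mathrm f}(L)$ such that each $V_m=\bigcup_n h(m,n)$ is an open set coded by some such $g$ (which may depend on $m$ in a non-uniform way) and $L=\bigcup_m V_m$. The cover is *honest* if there is a single function $g\colon\mathbb N\times\mathbb N\to\mathcal P_{\mathrm f}(I)$ with $V_m=\bigcup_n\bigcup_{i\in g(m,n)}U_i$ for all $m$. The order topology is *compact* (respectively, *compact with respect to honest open covers*) if for every open cover (respectively, every honest open cover) there is an $M\in\mathbb N$ with $L=\bigcup_{m<M}V_m$. **Theorem.** (i) The statement "for every countable linear order $(L,\prec)$, if $(L,\prec)$ is complete, then the order topology of $(L,\prec)$ is compact with respect to honest open covers" is equivalent to $\mathsf{WKL}_0$ over $\mathsf{RCA}_0$. (ii) The statement "for every countable linear order $(L,\prec)$, if $(L,\prec)$ is complete, then the order topology of $(L,\prec)$ is compact" is equivalent to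 $\mathsf{ACA}_0$ over $\mathsf{RCA}_0$. -/

import Mathlib

universe u

namespace SecondOrderArithmetic

/-! ## The language of second-order arithmetic and its structures -/

/-- A structure for the language `0, 1, +, ×, <, ∈` of second-order arithmetic: the number
variables range over `Num`, the set variables range over the members of `Sets`. As in any
first-order semantics both sorts are non-empty. Equality of sets is extensional. -/
structure L2Structure where
  Num : Type u
  [zero : Zero Num]
  [one : One Num]
  [add : Add Num]
  [mul : Mul Num]
  [lt : LT Num]
  Sets : Set (Set Num)
  sets_nonempty : Sets.Nonempty

attribute [instance] L2Structure.zero L2Structure.one L2Structure.add L2Structure.mul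
  L2Structure.lt

/-- Number terms; number variables are de Bruijn indices. -/
inductive NumTerm : Type
  | var (i : ℕ)
  | zero
  | one
  | add (s t : NumTerm)
  | mul (s t : NumTerm)

/-- Arithmetical formulas: number quantifiers, free set variables `X₀, X₁, …`, and no set
quantifiers. A quantifier binds the number variable with index `0` of its body; in the bounded
quantifiers `ball t φ` and `bex t φ` (`∀ x < t, φ` and `∃ x < t, φ`) the bound `t` lies outside
the scope of the quantifier. -/
inductive ArithFormula : Type
  | eq (s t : NumTerm)
  | lt (s t : NumTerm)
  | mem (t : NumTerm) (X : ℕ)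
  | neg (φ : ArithFormula)
  | and (φ ψ : ArithFormula)
  | or (φ ψ : ArithFormula)
  | imp (φ ψ : ArithFormula)
  | ball (t : NumTerm) (φ : ArithFormula)
  | bex (t : NumTerm) (φ : ArithFormula)
  | all (φ : ArithFormula)
  | ex (φ : ArithFormula)

/-- All quantifiers of the formula are bounded. -/
def ArithFormula.IsBounded : ArithFormula → Prop
  | .eq _ _ => True
  | .lt _ _ => True
  | .mem _ _ => True
  | .neg φ => φ.IsBounded
  | .and φ ψ => φ.IsBounded ∧ ψ.IsBounded
  | .or φ ψ => φ.IsBounded ∧ ψ.IsBounded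
  | .imp φ ψ => φ.IsBounded ∧ ψ.IsBounded
  | .ball _ φ => φ.IsBounded
  | .bex _ φ => φ.IsBounded
  | .all _ => False
  | .ex _ => False

/-- `Σ⁰₁` formulas: `∃ m, θ` with `θ` bounded. -/
def ArithFormula.IsSigma01 (φ : ArithFormula) : Prop :=
  ∃ θ : ArithFormula, θ.IsBounded ∧ φ = .ex θ

/-- `Π⁰₁` formulas: `∀ m, θ` with `θ` bounded. -/
def ArithFormula.IsPi01 (φ : ArithFormula) : Prop :=
  ∃ θ : ArithFormula, θ.IsBounded ∧ φ = .all θ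

section Semantics

variable {N : Type u} [Zero N] [One N] [Add N] [Mul N] [LT N]

/-- The assignment giving the value `x` to variable `0` and shifting the others. -/
def push (x : N) (v : ℕ → N) : ℕ → N
  | 0 => x
  | i + 1 => v i

/-- The value of a term under an assignment. -/
def NumTerm.val (v : ℕ → N) : NumTerm → N
  | .var i => v i
  | .zero => 0
  | .one => 1
  | .add s t => s.val v + t.val v
  | .mul s t => s.val v * t.val v

/-- Truth of an arithmetical formula under an assignment `v` of numbers and `V` of sets. -/
def ArithFormula.Sat (V : ℕ → Set N) : ArithFormula → (ℕ → N) → Prop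
  | .eq s t, v => s.val v = t.val v
  | .lt s t, v => s.val v < t.val v
  | .mem t X, v => t.val v ∈ V X
  | .neg φ, v => ¬ φ.Sat V v
  | .and φ ψ, v => φ.Sat V v ∧ ψ.Sat V v
  | .or φ ψ, v => φ.Sat V v ∨ ψ.Sat V v
  | .imp φ ψ, v => φ.Sat V v → ψ.Sat V v
  | .ball t φ, v => ∀ x : N, x < t.val v → φ.Sat V (push x v)
  | .bex t φ, v => ∃ x : N, x < t.val v ∧ φ.Sat V (push x v)
  | .all φ, v => ∀ x : N, φ.Sat V (push x v)
  | .ex φ, v => ∃ x : N, φ.Sat V (push x v)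

end Semantics

/-! ## The axiom systems `RCA₀` and `ACA₀` -/

/-- The numbers form (the non-negative part of) a discretely ordered commutative semiring with
identity. -/
structure DiscretelyOrderedSemiring (N : Type u) [Zero N] [One N] [Add N] [Mul N] [LT N] :
    Prop where
  add_assoc : ∀ x y z : N, (x + y) + z = x + (y + z)
  add_comm : ∀ x y : N, x + y = y + x
  add_zero : ∀ x : N, x + 0 = x
  mul_assoc : ∀ x y z : N, (x * y) * z = x * (y * z)
  mul_comm : ∀ x y : N, x * y = y * x
  mul_one : ∀ x : N, x * 1 = x
  mul_zero : ∀ x : N, x * 0 = 0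
  mul_add : ∀ x y z : N, x * (y + z) = x * y + x * z
  lt_irrefl : ∀ x : N, ¬ x < x
  lt_trans : ∀ x y z : N, x < y → y < z → x < z
  lt_trichotomy : ∀ x y : N, x < y ∨ x = y ∨ y < x
  add_lt_add : ∀ x y z : N, x < y → x + z < y + z
  mul_lt_mul : ∀ x y z : N, 0 < z → x < y → x * z < y * z
  exists_add : ∀ x y : N, x < y → ∃ z : N, x + z = y
  zero_lt_one : (0 : N) < 1
  zero_or_pos : ∀ x : N, x = 0 ∨ 0 < x
  discrete : ∀ x : N, 0 < x → x = 1 ∨ 1 < x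

/-- The `Σ⁰₁` induction scheme (with number and set parameters). -/
def SigmaInduction (M : L2Structure.{u}) : Prop :=
  ∀ φ : ArithFormula, φ.IsSigma01 →
    ∀ V : ℕ → Set M.Num, (∀ i, V i ∈ M.Sets) → ∀ v : ℕ → M.Num,
      φ.Sat V (push 0 v) →
      (∀ n : M.Num, φ.Sat V (push n v) → φ.Sat V (push (n + 1) v)) →
      ∀ n : M.Num, φ.Sat V (push n v)

/-- The `Δ⁰₁` comprehension scheme (with number and set parameters). -/
def DeltaComprehension (M : L2Structure.{u}) : Prop :=
  ∀ φ ψ : ArithFormula, φ.IsSigma01 → ψ.IsPi01 →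
    ∀ V : ℕ → Set M.Num, (∀ i, V i ∈ M.Sets) → ∀ v : ℕ → M.Num,
      (∀ n : M.Num, φ.Sat V (push n v) ↔ ψ.Sat V (push n v)) →
      ∃ X ∈ M.Sets, ∀ n : M.Num, n ∈ X ↔ φ.Sat V (push n v)

/-- The arithmetical comprehension scheme (with number and set parameters). -/
def ArithComprehension (M : L2Structure.{u}) : Prop :=
  ∀ φ : ArithFormula,
    ∀ V : ℕ → Set M.Num, (∀ i, V i ∈ M.Sets) → ∀ v : ℕ → M.Num,
      ∃ X ∈ M.Sets, ∀ n : M.Num, n ∈ X ↔ φ.Sat V (push n v)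

/-- `M` is a model of `RCA₀`. -/
def RCA0 (M : L2Structure.{u}) : Prop :=
  DiscretelyOrderedSemiring M.Num ∧ SigmaInduction M ∧ DeltaComprehension M

/-- `M` is a model of `ACA₀`. -/
def ACA0 (M : L2Structure.{u}) : Prop :=
  RCA0 M ∧ ArithComprehension M

/-! ## Coding of pairs, finite sets, functions and finite sequences

The definitions below are the usual ones inside `RCA₀`. All number quantifiers range over the
numbers of the structure. Members of `Set N` that are not required to lie in `Sets` are classes,
used only as abbreviations for the formulas that define them. -/

section Coding

variable {N : Type u} [Zero N] [One N] [Add N] [Mul N] [LT N]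

/-- The pairing function `⟨x, y⟩ = (x + y)² + x`. -/
def pair (x y : N) : N := (x + y) * (x + y) + x

/-- `x` belongs to the finite set given by the number `e`: `e = ⟨k, ⟨m, n⟩⟩`, `x < k`, and
`m(x + 1) + 1` divides `n`. -/
def FinMem (x e : N) : Prop :=
  ∃ k m n : N, e = pair k (pair m n) ∧ x < k ∧ ∃ q : N, n = (m * (x + 1) + 1) * q

/-- `e` is the code of a finite set: the least number that gives that set. -/
def IsFinCode (e : N) : Prop :=
  ∀ e' : N, e' < e → ¬ ∀ x : N, FinMem x e' ↔ FinMem x e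

/-- The class `P_f(A)` of (codes of) finite subsets of `A`. -/
def finSubsets (A : Set N) : Set N :=
  {e | IsFinCode e ∧ ∀ x : N, FinMem x e → x ∈ A}

/-- The class `ℕ × ℕ` of (codes of) pairs. -/
def allPairs : Set N := {p | ∃ m n : N, p = pair m n}

/-- `f` is (the graph of) a function from `D` to `C`. -/
def IsFunction (D C f : Set N) : Prop :=
  (∀ p ∈ f, ∃ x ∈ D, ∃ y ∈ C, p = pair x y) ∧ ∀ x ∈ D, ∃! y : N, pair x y ∈ f

/-- `s` is the code of a finite sequence of length `l`, i.e. of a function with domain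
`{i | i < l}`. -/
def IsSeq (s l : N) : Prop :=
  IsFinCode s ∧ (∀ p : N, FinMem p s → ∃ i j : N, i < l ∧ p = pair i j) ∧
    ∀ i : N, i < l → ∃! j : N, FinMem (pair i j) s

/-- `s` is the code of a finite binary sequence. -/
def IsBinarySeq (s : N) : Prop :=
  (∃ l : N, IsSeq s l) ∧ ∀ i j : N, FinMem (pair i j) s → j = 0 ∨ j = 1

/-- `T` is a subtree of the tree of finite binary sequences. -/
def IsBinaryTree (T : Set N) : Prop :=
  (∀ s ∈ T, IsBinarySeq s) ∧
    ∀ s ∈ T, ∀ t l : N, IsSeq t l → (∀ p : N, FinMem p t → FinMem p s) → t ∈ T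

/-- `T` is infinite, i.e. unbounded. -/
def IsInfinite (T : Set N) : Prop := ∀ b : N, ∃ s ∈ T, b < s

/-- `f` is an infinite path through `T`: a function all of whose finite initial segments belong
to `T`. -/
def IsPath (T f : Set N) : Prop :=
  IsFunction Set.univ Set.univ f ∧
    ∀ n : N, ∃ s ∈ T, IsSeq s n ∧ ∀ p : N, FinMem p s → p ∈ f

end Coding

/-- Weak König's lemma: every infinite subtree of the binary tree has an infinite path. -/
def WeakKoenigLemma (M : L2Structure.{u}) : Prop :=
  ∀ T ∈ M.Sets, IsBinaryTree T → IsInfinite T → ∃ f ∈ M.Sets, IsPath T f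

/-- `M` is a model of `WKL₀`. -/
def WKL0 (M : L2Structure.{u}) : Prop :=
  RCA0 M ∧ WeakKoenigLemma M

/-! ## Open covers and compactness of countable second-countable spaces

A space is given by its set `X` of points, the index set `I` of the base, and the base
`(U i)_{i ∈ I}`. The further function `k` of a strong base, which chooses basic neighbourhoods
inside intersections, does not enter into the notions below. -/

section Compactness

variable {N : Type u} [Zero N] [One N] [Add N] [Mul N] [LT N]

/-- The `m`-th set `⋃ₙ h(m, n)` of the sequence of uniformly enumerable sets coded by `h`. -/
def enumSet (h : Set N) (m : N) : Set N :=
  {x | ∃ n e : N, pair (pair m n) e ∈ h ∧ FinMem x e}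

/-- The open set `G_g = ⋃ₙ ⋃_{i ∈ g(n)} U i`. -/
def openSet (U : N → Set N) (g : Set N) : Set N :=
  {x | ∃ n e i : N, pair n e ∈ g ∧ FinMem i e ∧ x ∈ U i}

/-- The `m`-th open set `⋃ₙ ⋃_{i ∈ g(m, n)} U i` of the sequence of open sets coded by `g`. -/
def openSeq (U : N → Set N) (g : Set N) (m : N) : Set N :=
  {x | ∃ n e i : N, pair (pair m n) e ∈ g ∧ FinMem i e ∧ x ∈ U i}

end Compactness

/-- The class `Y` is an open set of the space: some function `g : ℕ → P_f(I)` in the structure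
codes it. -/
def IsOpenIn (M : L2Structure.{u}) (I : Set M.Num) (U : M.Num → Set M.Num) (Y : Set M.Num) :
    Prop :=
  ∃ g ∈ M.Sets, IsFunction Set.univ (finSubsets I) g ∧ Y = openSet U g

/-- `h : ℕ × ℕ → P_f(X)` codes an open cover of the space: each of the uniformly enumerable sets
is open, and together they cover `X`. -/
def IsOpenCover (M : L2Structure.{u}) (X I : Set M.Num) (U : M.Num → Set M.Num)
    (h : Set M.Num) : Prop :=
  h ∈ M.Sets ∧ IsFunction allPairs (finSubsets X) h ∧
    (∀ m : M.Num, IsOpenIn M I U (enumSet h m)) ∧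
    ∀ x ∈ X, ∃ m : M.Num, x ∈ enumSet h m

/-- The sequence coded by `h` is honest: a single function `g : ℕ × ℕ → P_f(I)` in the structure
writes all its members uniformly as unions of basic open sets. -/
def IsHonest (M : L2Structure.{u}) (I : Set M.Num) (U : M.Num → Set M.Num) (h : Set M.Num) :
    Prop :=
  ∃ g ∈ M.Sets, IsFunction allPairs (finSubsets I) g ∧
    ∀ m : M.Num, enumSet h m = openSeq U g m

/-- Finitely many (the first `b`) members of the sequence coded by `h` cover `X`. -/
def HasFiniteSubcover (M : L2Structure.{u}) (X : Set M.Num) (h : Set M.Num) : Prop :=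
  ∃ b : M.Num, ∀ x ∈ X, ∃ m : M.Num, m < b ∧ x ∈ enumSet h m

/-- Every open cover has a finite subcover. -/
def IsCompactSpace (M : L2Structure.{u}) (X I : Set M.Num) (U : M.Num → Set M.Num) : Prop :=
  ∀ h : Set M.Num, IsOpenCover M X I U h → HasFiniteSubcover M X h

/-- Every honest open cover has a finite subcover. -/
def IsHonestlyCompactSpace (M : L2Structure.{u}) (X I : Set M.Num) (U : M.Num → Set M.Num) :
    Prop :=
  ∀ h : Set M.Num, IsOpenCover M X I U h → IsHonest M I U h → HasFiniteSubcover M X h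

/-! ## Countable linear orders and their order topologies -/

/-- `(L, R)` is a countable linear order: `L` and `R` are sets of the structure, and `R` is
(the set of codes of pairs of) a strict linear order on `L`. -/
structure IsCountableLinearOrder (M : L2Structure.{u}) (L R : Set M.Num) : Prop where
  carrier_mem : L ∈ M.Sets
  rel_mem : R ∈ M.Sets
  rel_subset : ∀ p ∈ R, ∃ x ∈ L, ∃ y ∈ L, p = pair x y
  irrefl : ∀ x ∈ L, pair x x ∉ R
  trans : ∀ x ∈ L, ∀ y ∈ L, ∀ z ∈ L, pair x y ∈ R → pair y z ∈ R → pair x z ∈ R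
  trichotomy : ∀ x ∈ L, ∀ y ∈ L, pair x y ∈ R ∨ x = y ∨ pair y x ∈ R

/-- `(L, R)` is complete: whenever `L` is partitioned by two (possibly empty) sets `A`, `B` of
the structure with every element of `A` below every element of `B`, either `A` has a greatest
or `B` has a least element. In particular the empty order is not complete. -/
def IsCompleteOrder (M : L2Structure.{u}) (L R : Set M.Num) : Prop :=
  ∀ A ∈ M.Sets, ∀ B ∈ M.Sets, L = A ∪ B → (∀ x ∈ A, ∀ y ∈ B, pair x y ∈ R) →
    (∃ x ∈ A, ∀ y ∈ A, y = x ∨ pair y x ∈ R) ∨ (∃ x ∈ B, ∀ y ∈ B, y = x ∨ pair x y ∈ R)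

section OrderTopology

variable {N : Type u} [Zero N] [One N] [Add N] [Mul N] [LT N]

/-- `x` as an element of `L ∪ {-∞, ∞}`; the fresh symbols `-∞` and `∞` are coded by `0`, `1`. -/
def finitePoint (x : N) : N := x + 1 + 1

/-- `L ∪ {-∞, ∞}`. -/
def extendedOrder (L : Set N) : Set N :=
  {a | a = 0 ∨ a = 1 ∨ ∃ x ∈ L, a = finitePoint x}

/-- The order of `L` extended to `L ∪ {-∞, ∞}` by `-∞ ≺ x ≺ ∞`. -/
def ExtendedLT (R : Set N) (a b : N) : Prop :=
  (a = 0 ∧ b ≠ 0) ∨ (a ≠ 1 ∧ b = 1) ∨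
    ∃ x y : N, a = finitePoint x ∧ b = finitePoint y ∧ pair x y ∈ R

/-- The index set `(L ∪ {-∞, ∞}) × (L ∪ {-∞, ∞})` of the base of the order topology. -/
def intervalIndices (L : Set N) : Set N :=
  {i | ∃ a ∈ extendedOrder L, ∃ b ∈ extendedOrder L, i = pair a b}

/-- The basic open set `(a, b) = {x ∈ L | a ≺ x ≺ b}` with index `⟨a, b⟩`. -/
def interval (L R : Set N) (i : N) : Set N :=
  {x | x ∈ L ∧ ∃ a b : N, i = pair a b ∧ ExtendedLT R a (finitePoint x) ∧
    ExtendedLT R (finitePoint x) b}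

end OrderTopology

/-- For every countable linear order, if it is complete, then its order topology is compact with
respect to honest open covers. -/
def CompleteOrdersHonestlyCompact (M : L2Structure.{u}) : Prop :=
  ∀ L R : Set M.Num, IsCountableLinearOrder M L R → IsCompleteOrder M L R →
    IsHonestlyCompactSpace M L (intervalIndices L) (interval L R)

/-- For every countable linear order, if it is complete, then its order topology is compact. -/
def CompleteOrdersCompact (M : L2Structure.{u}) : Prop :=
  ∀ L R : Set M.Num, IsCountableLinearOrder M L R → IsCompleteOrder M L R →
    IsCompactSpace M L (intervalIndices L) (interval L R)

/-- `φ` and `ψ` are equivalent over the theory with models `T`: in every structure that is a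
model of `T`, `φ` holds if and only if `ψ` holds. -/
def EquivalentOver (T φ ψ : L2Structure.{u} → Prop) : Prop :=
  ∀ M : L2Structure.{u}, T M → (φ M ↔ ψ M)

end SecondOrderArithmetic

open SecondOrderArithmetic

set_option linter.unusedSectionVars false

/-! Weak König's lemma gives honest compactness as follows. An honest cover refines to a sequence
`J` of intervals. If no finite part of `J` covers `L`, each finite part misses some point `x`. Which
extended points lie below `x`, strictly or weakly, then solves a finite part of a system of
implications; the essential one is that `(a, b)` in `J` and `a ≺ x` force `b ≼ x`. By
`exists_closed_set` the whole system has a solution, an ideal point outside all intervals of `J`.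
Since every element of `L` is covered, the ideal point is not one of them, and it determines a cut
with neither a greatest element below nor a least element above. This contradicts completeness
(`exists_bound_of_intervals_cover`).

Without honesty, `Σ⁰₁` comprehension is used to decide which intervals lie in which `V_m`, and to
form the set of points up to which finitely many such intervals suffice. The classical supremum
argument then applies (`isCompactSpace_of_sigma1_comprehension`).

For the reversals, consider complete orders in which every point is isolated. The singletons form an
open cover whose `m`-th member is contained in `{m}`, so a finite subcover bounds `L` as a set of
numbers, and an unbounded `L` is contradictory.

For `ACA₀`, let `L` be an injective enumeration of a `Σ⁰₁` class, ordered so that false stages come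
first, each with boundedly many predecessors, and true stages last, each with boundedly many
successors. If the class is not a set, neither is the set of true stages, so the only gap of the
order is invisible in the model and the order is complete. Its points are isolated, but neighbours
are found only non-uniformly, which a possibly dishonest cover tolerates
(`sigma1_comprehension_of_compact`).

For `WKL₀`, let `L` be an infinite binary tree without a path, in the in-order (left subtree, node,
right subtree). A cut directs a descent through the tree; as there is no path the descent stops, at
the greatest element of the lower part or the least of the upper part. Immediate neighbours also
come from descents and have `Σ⁰₁` evidence, so the cover by singletons is honest
(`weakKoenigLemma_of_honestlyCompact`).

All this takes place inside a model. Definability is treated semantically: `Sigma1`, `Delta1`,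
`Delta1Fun` and `InModel` are type classes on predicates, functions and sets, so most instances of
induction and comprehension are justified by instance search. -/

namespace SecondOrderArithmetic

/-! ## Models of `RCA₀` as ordered semirings with a family of sets -/

/-- A model of `RCA₀`, presented with Mathlib's algebraic and order structure. -/
class RCAModel (N : Type u) extends CommSemiring N, LinearOrder N, IsStrictOrderedRing N,
    CanonicallyOrderedAdd N where
  sets : Set (Set N)
  sets_nonempty : sets.Nonempty
  add_one_le_of_lt : ∀ x y : N, x < y → x + 1 ≤ y
  sigma_induction : ∀ φ : ArithFormula, φ.IsSigma01 →
    ∀ V : ℕ → Set N, (∀ i, V i ∈ sets) → ∀ v : ℕ → N,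
      φ.Sat V (push 0 v) →
      (∀ n : N, φ.Sat V (push n v) → φ.Sat V (push (n + 1) v)) →
      ∀ n : N, φ.Sat V (push n v)
  delta_comprehension : ∀ φ ψ : ArithFormula, φ.IsSigma01 → ψ.IsPi01 →
    ∀ V : ℕ → Set N, (∀ i, V i ∈ sets) → ∀ v : ℕ → N,
      (∀ n : N, φ.Sat V (push n v) ↔ ψ.Sat V (push n v)) →
      ∃ X ∈ sets, ∀ n : N, n ∈ X ↔ φ.Sat V (push n v)

/-! ## Renaming of variables -/

/-- The renaming of variables under a binder. -/
def liftRenaming (ρ : ℕ → ℕ) : ℕ → ℕ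
  | 0 => 0
  | i + 1 => ρ i + 1

/-- Renaming of the number variables of a term. -/
def NumTerm.rename (ρ : ℕ → ℕ) : NumTerm → NumTerm
  | .var i => .var (ρ i)
  | .zero => .zero
  | .one => .one
  | .add s t => .add (s.rename ρ) (t.rename ρ)
  | .mul s t => .mul (s.rename ρ) (t.rename ρ)

/-- Renaming of the number variables (by `ρ`) and of the set variables (by `τ`). -/
def ArithFormula.rename (τ : ℕ → ℕ) : (ℕ → ℕ) → ArithFormula → ArithFormula
  | ρ, .eq s t => .eq (s.rename ρ) (t.rename ρ)
  | ρ, .lt s t => .lt (s.rename ρ) (t.rename ρ)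
  | ρ, .mem t X => .mem (t.rename ρ) (τ X)
  | ρ, .neg φ => .neg (φ.rename τ ρ)
  | ρ, .and φ ψ => .and (φ.rename τ ρ) (ψ.rename τ ρ)
  | ρ, .or φ ψ => .or (φ.rename τ ρ) (ψ.rename τ ρ)
  | ρ, .imp φ ψ => .imp (φ.rename τ ρ) (ψ.rename τ ρ)
  | ρ, .ball t φ => .ball (t.rename ρ) (φ.rename τ (liftRenaming ρ))
  | ρ, .bex t φ => .bex (t.rename ρ) (φ.rename τ (liftRenaming ρ))
  | ρ, .all φ => .all (φ.rename τ (liftRenaming ρ))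
  | ρ, .ex φ => .ex (φ.rename τ (liftRenaming ρ))

theorem ArithFormula.IsBounded.rename {φ : ArithFormula} (h : φ.IsBounded) (τ ρ : ℕ → ℕ) :
    (φ.rename τ ρ).IsBounded := by
  induction φ generalizing ρ <;> simp_all [ArithFormula.IsBounded, ArithFormula.rename]

section Renaming

variable {N : Type u} [Zero N] [One N] [Add N] [Mul N] [LT N]

theorem push_comp_liftRenaming (x : N) (v : ℕ → N) (ρ : ℕ → ℕ) :
    push x v ∘ liftRenaming ρ = push x (v ∘ ρ) := by
  funext i; cases i <;> rfl

theorem NumTerm.val_rename (ρ : ℕ → ℕ) (v : ℕ → N) (t : NumTerm) :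
    (t.rename ρ).val v = t.val (v ∘ ρ) := by
  induction t <;> simp_all [NumTerm.rename, NumTerm.val]

theorem ArithFormula.sat_rename (τ ρ : ℕ → ℕ) (V : ℕ → Set N) (φ : ArithFormula) (v : ℕ → N) :
    (φ.rename τ ρ).Sat V v ↔ φ.Sat (V ∘ τ) (v ∘ ρ) := by
  induction φ generalizing ρ v <;>
    simp_all [ArithFormula.rename, ArithFormula.Sat, NumTerm.val_rename, push_comp_liftRenaming]

end Renaming

/-- The interleaving of two sequences. -/
def interleave {α : Type*} (f g : ℕ → α) (i : ℕ) : α := if i % 2 = 0 then f (i / 2) else g (i / 2)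

theorem interleave_comp_even {α : Type*} (f g : ℕ → α) : interleave f g ∘ (fun i => 2 * i) = f := by
  funext i; simp [interleave]

theorem interleave_comp_odd {α : Type*} (f g : ℕ → α) :
    interleave f g ∘ (fun i => 2 * i + 1) = g := by
  funext i
  have h : (2 * i + 1) / 2 = i := by omega
  simp [interleave, h, Nat.add_mod]

open RCAModel

variable {N : Type u} [RCAModel N]

/-! ## Definability by bounded formulas with parameters -/

/-- The assignment whose entries are variables or constants as given by `σ`. -/
def envOf (σ : ℕ → ℕ ⊕ N) (v : ℕ → N) (i : ℕ) : N := Sum.elim v id (σ i)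

/-- Substitution of parameters commutes with binding: entries that refer to variable `0` are
redirected to the new head, and all other entries are shifted up by one. -/
theorem exists_envOf_push (σ : ℕ → ℕ ⊕ N) :
    ∃ (ρ : ℕ → ℕ) (σ' : ℕ → ℕ ⊕ N), ∀ x v, envOf σ (push x v) = push x (envOf σ' v) ∘ ρ := by
  refine ⟨fun i => if σ i = .inl 0 then 0 else i + 1, fun i => Sum.map Nat.pred id (σ i), ?_⟩
  intro x v
  funext i
  rcases h : σ i with (_ | j) | c <;> simp [envOf, h, push]

theorem envOf_interleave_even (σ σ' : ℕ → ℕ ⊕ N) (v : ℕ → N) :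
    envOf (interleave σ σ') v ∘ (fun i => 2 * i) = envOf σ v := by
  funext i
  simp only [envOf, Function.comp, ← congrFun (interleave_comp_even σ σ') i]

theorem envOf_interleave_odd (σ σ' : ℕ → ℕ ⊕ N) (v : ℕ → N) :
    envOf (interleave σ σ') v ∘ (fun i => 2 * i + 1) = envOf σ' v := by
  funext i
  simp only [envOf, Function.comp, ← congrFun (interleave_comp_odd σ σ') i]

/-- `f` is the value of a term with parameters. -/
def IsTerm (f : (ℕ → N) → N) : Prop :=
  ∃ (t : NumTerm) (σ : ℕ → ℕ ⊕ N), ∀ v, t.val (envOf σ v) = f v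

/-- `P` is defined by a bounded formula with parameters. -/
def IsDelta0 (P : (ℕ → N) → Prop) : Prop :=
  ∃ θ : ArithFormula, θ.IsBounded ∧ ∃ V : ℕ → Set N, (∀ i, V i ∈ sets) ∧
    ∃ σ : ℕ → ℕ ⊕ N, ∀ v, θ.Sat V (envOf σ v) ↔ P v

theorem isTerm_var (i : ℕ) : IsTerm (fun v : ℕ → N => v i) :=
  ⟨.var i, .inl, fun _ => rfl⟩

theorem isTerm_const (c : N) : IsTerm (fun _ : ℕ → N => c) :=
  ⟨.var 0, fun _ => .inr c, fun _ => rfl⟩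

/-- The two assignments are placed on the even and on the odd variables, so that they cannot clash.
Conjunctions and bounded quantifiers use the same device. -/
theorem IsTerm.merge {f g : (ℕ → N) → N} (hf : IsTerm f) (hg : IsTerm g) :
    ∃ (s t : NumTerm) (σ : ℕ → ℕ ⊕ N), ∀ v,
      s.val (envOf σ v) = f v ∧ t.val (envOf σ v) = g v := by
  obtain ⟨s, σ, hs⟩ := hf
  obtain ⟨t, σ', ht⟩ := hg
  refine ⟨s.rename (fun i => 2 * i), t.rename (fun i => 2 * i + 1), interleave σ σ', fun v => ?_⟩
  rw [NumTerm.val_rename, NumTerm.val_rename, envOf_interleave_even, envOf_interleave_odd]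
  exact ⟨hs v, ht v⟩

theorem IsTerm.add {f g : (ℕ → N) → N} (hf : IsTerm f) (hg : IsTerm g) :
    IsTerm (fun v => f v + g v) := by
  obtain ⟨s, t, σ, h⟩ := hf.merge hg
  exact ⟨.add s t, σ, fun v => by simp only [NumTerm.val, h]⟩

theorem IsTerm.mul {f g : (ℕ → N) → N} (hf : IsTerm f) (hg : IsTerm g) :
    IsTerm (fun v => f v * g v) := by
  obtain ⟨s, t, σ, h⟩ := hf.merge hg
  exact ⟨.mul s t, σ, fun v => by simp only [NumTerm.val, h]⟩

theorem IsDelta0.congr {P Q : (ℕ → N) → Prop} (hP : IsDelta0 P) (h : ∀ v, P v ↔ Q v) :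
    IsDelta0 Q := by
  rwa [show Q = P from funext fun v => propext (h v).symm]

theorem IsTerm.eq {f g : (ℕ → N) → N} (hf : IsTerm f) (hg : IsTerm g) :
    IsDelta0 (fun v => f v = g v) := by
  obtain ⟨s, t, σ, h⟩ := hf.merge hg
  obtain ⟨X, hX⟩ := sets_nonempty (N := N)
  exact ⟨.eq s t, trivial, fun _ => X, fun _ => hX, σ, fun v => by simp only [ArithFormula.Sat, h]⟩

theorem IsTerm.lt {f g : (ℕ → N) → N} (hf : IsTerm f) (hg : IsTerm g) :
    IsDelta0 (fun v => f v < g v) := by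
  obtain ⟨s, t, σ, h⟩ := hf.merge hg
  obtain ⟨X, hX⟩ := sets_nonempty (N := N)
  exact ⟨.lt s t, trivial, fun _ => X, fun _ => hX, σ, fun v => by simp only [ArithFormula.Sat, h]⟩

theorem IsTerm.mem {f : (ℕ → N) → N} (hf : IsTerm f) {X : Set N} (hX : X ∈ sets) :
    IsDelta0 (fun v => f v ∈ X) := by
  obtain ⟨t, σ, h⟩ := hf
  exact ⟨.mem t 0, trivial, fun _ => X, fun _ => hX, σ, fun v => by simp only [ArithFormula.Sat, h]⟩

theorem IsDelta0.rename {P : (ℕ → N) → Prop} (hP : IsDelta0 P) (ρ : ℕ → ℕ) :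
    IsDelta0 (fun v => P (fun i => v (ρ i))) := by
  obtain ⟨θ, hθ, V, hV, σ, h⟩ := hP
  refine ⟨θ, hθ, V, hV, fun i => Sum.map ρ id (σ i), fun v => ?_⟩
  beta_reduce
  rw [← h]
  apply iff_of_eq
  congr 1
  funext i
  simp only [envOf]
  cases σ i <;> rfl

/-- All variables but the first two may be replaced by parameters. -/
theorem IsDelta0.specialize {Q : (ℕ → N) → Prop} (hQ : IsDelta0 Q) (v : ℕ → N) :
    IsDelta0 (fun w : ℕ → N => Q (push (w 0) (push (w 1) v))) := by
  obtain ⟨θ, hθ, V, hV, σ, h⟩ := hQ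
  refine ⟨θ, hθ, V, hV, fun i => Sum.elim
    (fun j => match j with
      | 0 => .inl 0
      | 1 => .inl 1
      | j + 2 => .inr (v j)) .inr (σ i), fun w => ?_⟩
  beta_reduce
  rw [← h]
  apply iff_of_eq
  congr 1
  funext i
  simp only [envOf]
  rcases σ i with (_ | _ | j) | c <;> rfl

theorem IsDelta0.neg {P : (ℕ → N) → Prop} (hP : IsDelta0 P) : IsDelta0 (fun v => ¬ P v) := by
  obtain ⟨θ, hθ, V, hV, σ, h⟩ := hP
  exact ⟨.neg θ, hθ, V, hV, σ, fun v => by simp only [ArithFormula.Sat, h]⟩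

theorem IsDelta0.and {P Q : (ℕ → N) → Prop} (hP : IsDelta0 P) (hQ : IsDelta0 Q) :
    IsDelta0 (fun v => P v ∧ Q v) := by
  obtain ⟨θ, hθ, V, hV, σ, h⟩ := hP
  obtain ⟨θ', hθ', V', hV', σ', h'⟩ := hQ
  refine ⟨.and (θ.rename (fun i => 2 * i) (fun i => 2 * i))
    (θ'.rename (fun i => 2 * i + 1) (fun i => 2 * i + 1)), ⟨hθ.rename _ _, hθ'.rename _ _⟩,
    interleave V V', fun i => ?_, interleave σ σ', fun v => ?_⟩
  · unfold interleave; split_ifs <;> simp [hV, hV']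
  · simp only [ArithFormula.Sat, ArithFormula.sat_rename, interleave_comp_even,
      interleave_comp_odd, envOf_interleave_even, envOf_interleave_odd, h, h']

theorem IsDelta0.or {P Q : (ℕ → N) → Prop} (hP : IsDelta0 P) (hQ : IsDelta0 Q) :
    IsDelta0 (fun v => P v ∨ Q v) :=
  (hP.neg.and hQ.neg).neg.congr fun v => by tauto

theorem IsDelta0.bex {t : (ℕ → N) → N} {P : (ℕ → N) → Prop} (ht : IsTerm t) (hP : IsDelta0 P) :
    IsDelta0 (fun v => ∃ x, x < t v ∧ P (push x v)) := by
  obtain ⟨θ, hθ, V, hV, σ, h⟩ := hP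
  obtain ⟨s, σ', hs⟩ := ht
  obtain ⟨ρ, σ'', hρ⟩ := exists_envOf_push σ
  refine ⟨.bex (s.rename (fun i => 2 * i + 1))
    (θ.rename id (liftRenaming (fun i => 2 * i) ∘ ρ)), hθ.rename _ _, V, hV,
    interleave σ'' σ', fun v => ?_⟩
  simp only [ArithFormula.Sat, ArithFormula.sat_rename, NumTerm.val_rename, envOf_interleave_odd, hs,
    ← Function.comp_assoc, push_comp_liftRenaming, envOf_interleave_even, ← hρ, Function.comp_id, h]

theorem IsDelta0.ball {t : (ℕ → N) → N} {P : (ℕ → N) → Prop} (ht : IsTerm t) (hP : IsDelta0 P) :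
    IsDelta0 (fun v => ∀ x, x < t v → P (push x v)) :=
  (hP.neg.bex ht).neg.congr fun v => by push Not; rfl

/-! ## `Σ⁰₁` definability and its closure properties -/

theorem lt_add_one_iff {x y : N} : x < y + 1 ↔ x ≤ y := by
  constructor
  · intro h
    by_contra! h'
    exact absurd (lt_of_lt_of_le h (add_one_le_of_lt _ _ h')) (lt_irrefl _)
  · intro h
    exact lt_of_le_of_lt h (lt_add_of_pos_right y one_pos)

theorem add_one_le_iff {x y : N} : x + 1 ≤ y ↔ x < y :=
  ⟨fun h => lt_of_lt_of_le (lt_add_of_pos_right x one_pos) h, add_one_le_of_lt x y⟩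

/-- `P` is defined by a `Σ⁰₁` formula with parameters. -/
class Sigma1 (P : (ℕ → N) → Prop) : Prop where
  exists_delta0 : ∃ Q : (ℕ → N) → Prop, IsDelta0 Q ∧ ∀ v, P v ↔ ∃ x, Q (push x v)

theorem Sigma1.congr {P Q : (ℕ → N) → Prop} (hP : Sigma1 P) (h : ∀ v, P v ↔ Q v) :
    Sigma1 Q := by
  rwa [show Q = P from funext fun v => propext (h v).symm]

theorem IsDelta0.sigma1 {P : (ℕ → N) → Prop} (hP : IsDelta0 P) : Sigma1 P :=
  ⟨_, hP.rename Nat.succ, fun _ => ⟨fun h => ⟨0, h⟩, fun ⟨_, h⟩ => h⟩⟩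

theorem Sigma1.rename {P : (ℕ → N) → Prop} (hP : Sigma1 P) (ρ : ℕ → ℕ) :
    Sigma1 (fun v => P (fun i => v (ρ i))) := by
  obtain ⟨Q, hQ, h⟩ := hP
  refine ⟨_, hQ.rename (liftRenaming ρ), fun v => ?_⟩
  simp only [h]
  refine exists_congr fun x => iff_of_eq (congrArg Q ?_)
  exact (push_comp_liftRenaming x v ρ).symm

theorem IsDelta0.bex_below {Q : (ℕ → N) → Prop} (hQ : IsDelta0 Q) :
    IsDelta0 (fun w => ∃ x, x < w 0 + 1 ∧ Q (push x (fun i => w (i + 1)))) := by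
  refine ((hQ.rename (liftRenaming Nat.succ)).bex
    ((isTerm_var 0).add (isTerm_const 1))).congr fun w => ?_
  refine exists_congr fun x => and_congr_right fun _ => iff_of_eq (congrArg Q ?_)
  exact push_comp_liftRenaming x w Nat.succ

/-- Only one leading unbounded quantifier is allowed; it is spent on a common bound for the two
witnesses, which then become bounded. `Sigma1.ex_push` contracts two quantifiers in the same way. -/
instance Sigma1.and {P P' : (ℕ → N) → Prop} [hP : Sigma1 P] [hP' : Sigma1 P'] :
    Sigma1 (fun v => P v ∧ P' v) := by
  obtain ⟨Q, hQ, h⟩ := hP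
  obtain ⟨Q', hQ', h'⟩ := hP'
  refine ⟨_, hQ.bex_below.and hQ'.bex_below, fun v => ?_⟩
  simp only [h, h', push, lt_add_one_iff]
  constructor
  · rintro ⟨⟨x, hx⟩, ⟨y, hy⟩⟩
    exact ⟨max x y, ⟨x, le_max_left _ _, hx⟩, ⟨y, le_max_right _ _, hy⟩⟩
  · rintro ⟨_, ⟨x, _, hx⟩, ⟨y, _, hy⟩⟩
    exact ⟨⟨x, hx⟩, ⟨y, hy⟩⟩

instance Sigma1.or {P P' : (ℕ → N) → Prop} [hP : Sigma1 P] [hP' : Sigma1 P'] :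
    Sigma1 (fun v => P v ∨ P' v) := by
  obtain ⟨Q, hQ, h⟩ := hP
  obtain ⟨Q', hQ', h'⟩ := hP'
  refine ⟨_, hQ.or hQ', fun v => ?_⟩
  simp only [h, h', exists_or]

theorem Sigma1.ex_push {P : (ℕ → N) → Prop} (hP : Sigma1 P) :
    Sigma1 (fun v => ∃ x, P (push x v)) := by
  obtain ⟨Q, hQ, h⟩ := hP
  refine ⟨fun w => ∃ y, y < w 0 + 1 ∧ ∃ x, x < w 0 + 1 ∧
    Q (push x (push y (fun i => w (i + 1)))), ?_, fun v => ?_⟩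
  · have h1 := ((hQ.rename (liftRenaming (liftRenaming Nat.succ))).bex
      ((isTerm_var 1).add (isTerm_const 1))).bex ((isTerm_var 0).add (isTerm_const 1))
    refine h1.congr fun w => ?_
    refine exists_congr fun y => and_congr_right fun _ => exists_congr fun x =>
      and_congr_right fun _ => iff_of_eq (congrArg Q ?_)
    funext i
    rcases i with _ | _ | i <;> rfl
  · simp only [h, push, lt_add_one_iff]
    constructor
    · rintro ⟨y, x, hx⟩
      exact ⟨max x y, y, le_max_right _ _, x, le_max_left _ _, hx⟩
    · rintro ⟨_, y, _, x, _, hx⟩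
      exact ⟨y, x, hx⟩

/-- Here the matrix takes the assignment and the bound value as separate arguments, a shape that
instance search can unify with a concrete existential statement. -/
instance Sigma1.ex {P : (ℕ → N) → N → Prop} [hP : Sigma1 (fun w => P (fun i => w (i + 1)) (w 0))] :
    Sigma1 (fun v => ∃ x, P v x) :=
  hP.ex_push

theorem Sigma1.specialize {P : (ℕ → N) → Prop} (hP : Sigma1 P) (v : ℕ → N) :
    Sigma1 (fun w => P (push (w 0) v)) := by
  obtain ⟨Q, hQ, h⟩ := hP
  exact ⟨_, hQ.specialize v, fun w => h _⟩

theorem Sigma1.exists_formula {P : (ℕ → N) → Prop} (hP : Sigma1 P) (u : ℕ → N) :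
    ∃ θ : ArithFormula, θ.IsBounded ∧ ∃ V : ℕ → Set N, (∀ i, V i ∈ sets) ∧
      ∃ v : ℕ → N, ∀ n, P (push n u) ↔ ∃ x, θ.Sat V (push x (push n v)) := by
  obtain ⟨Q, ⟨θ, hθ, V, hV, σ, h⟩, hQ⟩ := hP
  obtain ⟨ρ, σ', h1⟩ := exists_envOf_push σ
  obtain ⟨ρ', σ'', h2⟩ := exists_envOf_push σ'
  refine ⟨θ.rename id (liftRenaming ρ' ∘ ρ), hθ.rename _ _, V, hV, envOf σ'' u, fun n => ?_⟩
  rw [hQ]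
  refine exists_congr fun x => ?_
  rw [ArithFormula.sat_rename, ← Function.comp_assoc, push_comp_liftRenaming, ← h2, ← h1,
    Function.comp_id, h]

theorem sigma1_induction {P : N → Prop} [hP : Sigma1 (fun v : ℕ → N => P (v 0))] (zero : P 0)
    (succ : ∀ n, P n → P (n + 1)) (n : N) : P n := by
  obtain ⟨θ, hθ, V, hV, v, h⟩ := hP.exists_formula (fun _ => 0)
  have := sigma_induction (.ex θ) ⟨θ, hθ, rfl⟩ V hV v
  simp only [ArithFormula.Sat, ← h] at this
  exact this zero succ n

/-- This is `Σ⁰₁` collection: induction on `n` yields one bound for the witnesses of all `y < n`,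
and the bounded quantifier moves inside the unbounded one. -/
theorem Sigma1.ball_var {P : (ℕ → N) → Prop} (hP : Sigma1 P) (i : ℕ) :
    Sigma1 (fun v => ∀ x, x < v i → P (push x v)) := by
  obtain ⟨Q, hQ, h⟩ := hP
  have h1 : IsDelta0 (fun w => ∀ y, y < w (i + 1) → ∃ x, x < w 0 + 1 ∧
      Q (push x (push y (fun i => w (i + 1))))) := by
    have h1 := ((hQ.rename (liftRenaming (liftRenaming Nat.succ))).bex
      ((isTerm_var 1).add (isTerm_const 1))).ball (isTerm_var (i + 1))
    refine h1.congr fun w => ?_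
    refine forall_congr' fun y => imp_congr_right fun _ => exists_congr fun x =>
      and_congr_right fun _ => iff_of_eq (congrArg Q ?_)
    funext i
    rcases i with _ | _ | i <;> rfl
  refine ⟨_, h1, fun v => ⟨fun H => ?_, fun ⟨b, H⟩ y hy => ?_⟩⟩
  · have key : ∀ n : N, ∃ b : N, ∀ y, y < n → y < v i →
        ∃ x, x < b + 1 ∧ Q (push x (push y v)) := by
      have h2 : Sigma1 (fun u : ℕ → N => ∃ b : N, ∀ y, y < u 0 → y < v i →
          ∃ x, x < b + 1 ∧ Q (push x (push y v))) := by
        let P' : (ℕ → N) → Prop := fun w => ∀ y, y < w 1 → y < v i →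
          ∃ x, x < w 0 + 1 ∧ Q (push x (push y v))
        have h3 : IsDelta0 P' := by
          have h4 := hQ.specialize v
          have h5 := (((isTerm_var 0).lt (isTerm_const (v i))).neg.or
            (h4.bex ((isTerm_var 1).add (isTerm_const 1)))).ball (isTerm_var 1)
          refine h5.congr fun w => forall_congr' fun y => imp_congr_right fun _ => ?_
          simp only [push]
          tauto
        exact h3.sigma1.ex_push
      refine sigma1_induction ⟨0, fun y hy => absurd hy (not_lt.mpr zero_le)⟩ ?_
      rintro n ⟨b, hb⟩
      by_cases hn : n < v i
      · obtain ⟨x, hx⟩ := (h _).1 (H n hn)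
        refine ⟨max b x, fun y hy hyi => ?_⟩
        rcases (lt_add_one_iff.1 hy).lt_or_eq with hy | rfl
        · obtain ⟨x', hx', hQ'⟩ := hb y hy hyi
          exact ⟨x', lt_add_one_iff.2 ((lt_add_one_iff.1 hx').trans (le_max_left _ _)), hQ'⟩
        · exact ⟨x, lt_add_one_iff.2 (le_max_right _ _), hx⟩
      · refine ⟨b, fun y hy hyi => hb y ?_ hyi⟩
        exact lt_of_lt_of_le hyi (not_lt.1 hn)
    obtain ⟨b, hb⟩ := key (v i)
    exact ⟨b, fun y hy => hb y hy hy⟩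
  · obtain ⟨x, _, hx⟩ := H y hy
    exact (h _).2 ⟨x, hx⟩

/-! ## `Δ⁰₁` predicates and functions -/

/-- Both `P` and its negation are `Σ⁰₁`. -/
class Delta1 (P : (ℕ → N) → Prop) : Prop where
  pos : Sigma1 P
  neg : Sigma1 (fun v => ¬ P v)

/-- The graph of `f` is `Σ⁰₁`. -/
class Delta1Fun (f : (ℕ → N) → N) : Prop where
  graph : Sigma1 (fun w : ℕ → N => f (fun i => w (i + 1)) = w 0)

/-- `X` is a set of the model. -/
class InModel (X : Set N) : Prop where
  mem : X ∈ sets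

instance (priority := low) Delta1.sigma1 {P : (ℕ → N) → Prop} [h : Delta1 P] : Sigma1 P := h.pos

theorem Delta1.congr {P Q : (ℕ → N) → Prop} (hP : Delta1 P) (h : ∀ v, P v ↔ Q v) :
    Delta1 Q := by
  rwa [show Q = P from funext fun v => propext (h v).symm]

theorem IsDelta0.delta1 {P : (ℕ → N) → Prop} (hP : IsDelta0 P) : Delta1 P :=
  ⟨hP.sigma1, hP.neg.sigma1⟩

theorem Delta1.rename {P : (ℕ → N) → Prop} (hP : Delta1 P) (ρ : ℕ → ℕ) :
    Delta1 (fun v => P (fun i => v (ρ i))) :=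
  ⟨hP.pos.rename ρ, hP.neg.rename ρ⟩

theorem Delta1Fun.rename {f : (ℕ → N) → N} (hf : Delta1Fun f) (ρ : ℕ → ℕ) :
    Delta1Fun (fun v => f (fun i => v (ρ i))) :=
  ⟨hf.graph.rename (liftRenaming ρ)⟩

instance Delta1.not {P : (ℕ → N) → Prop} [h : Delta1 P] : Delta1 (fun v => ¬ P v) :=
  ⟨h.neg, h.pos.congr fun _ => not_not.symm⟩

instance Delta1.and {P Q : (ℕ → N) → Prop} [hP : Delta1 P] [hQ : Delta1 Q] :
    Delta1 (fun v => P v ∧ Q v) := by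
  have := hP.pos; have := hQ.pos; have := hP.neg; have := hQ.neg
  exact ⟨inferInstance, (Sigma1.or (P := fun v => ¬ P v) (P' := fun v => ¬ Q v)).congr
    fun v => by tauto⟩

instance Delta1.or {P Q : (ℕ → N) → Prop} [hP : Delta1 P] [hQ : Delta1 Q] :
    Delta1 (fun v => P v ∨ Q v) :=
  (Delta1.not (P := fun v => ¬ P v ∧ ¬ Q v)).congr fun v => by tauto

instance Delta1.imp {P Q : (ℕ → N) → Prop} [hP : Delta1 P] [hQ : Delta1 Q] :
    Delta1 (fun v => P v → Q v) :=
  (Delta1.or (P := fun v => ¬ P v) (Q := Q)).congr fun v => by tauto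

instance Delta1.iff {P Q : (ℕ → N) → Prop} [hP : Delta1 P] [hQ : Delta1 Q] :
    Delta1 (fun v => P v ↔ Q v) :=
  (Delta1.and (P := fun v => P v → Q v) (Q := fun v => Q v → P v)).congr fun v => by tauto

instance Sigma1.imp {P Q : (ℕ → N) → Prop} [hP : Delta1 P] [hQ : Sigma1 Q] :
    Sigma1 (fun v => P v → Q v) := by
  have := hP.neg
  exact (Sigma1.or (P := fun v => ¬ P v) (P' := Q)).congr fun v => by tauto

/-- A value of `f` is named by an existential quantifier over its graph. Applied also to the negated
predicate, this shows that a `Σ⁰₁` graph is enough to preserve `Δ⁰₁`. -/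
theorem Sigma1.subst {P : (ℕ → N) → N → Prop} {f : (ℕ → N) → N} (hf : Delta1Fun f)
    (hP : Sigma1 (fun w => P (fun i => w (i + 1)) (w 0))) : Sigma1 (fun v => P v (f v)) := by
  have h := hf.graph
  have : Sigma1 (fun v => ∃ x, f v = x ∧ P v x) := Sigma1.ex (hP := Sigma1.and)
  exact this.congr fun v => by simp

theorem Delta1.subst {P : (ℕ → N) → N → Prop} {f : (ℕ → N) → N} (hf : Delta1Fun f)
    (hP : Delta1 (fun w => P (fun i => w (i + 1)) (w 0))) : Delta1 (fun v => P v (f v)) :=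
  ⟨hP.pos.subst hf, Sigma1.subst (P := fun v x => ¬ P v x) hf hP.neg⟩

theorem Delta1.subst₁ {P : N → Prop} (h : Delta1 (fun w : ℕ → N => P (w 0)))
    (f : (ℕ → N) → N) [hf : Delta1Fun f] : Delta1 (fun v => P (f v)) :=
  Delta1.subst (P := fun _ x => P x) hf h

theorem Delta1.subst₂ {P : N → N → Prop} (h : Delta1 (fun w : ℕ → N => P (w 0) (w 1)))
    (f g : (ℕ → N) → N) [hf : Delta1Fun f] [hg : Delta1Fun g] :
    Delta1 (fun v => P (f v) (g v)) :=
  Delta1.subst (P := fun v x => P x (g v)) hf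
    (Delta1.subst (P := fun v x => P (v 0) x) (hg.rename Nat.succ)
      (h.rename (fun | 0 => 1 | _ => 0)))

instance Delta1Fun.var (i : ℕ) : Delta1Fun (fun v : ℕ → N => v i) :=
  ⟨((isTerm_var _).eq (isTerm_var _)).sigma1⟩

instance Delta1Fun.const (c : N) : Delta1Fun (fun _ : ℕ → N => c) :=
  ⟨((isTerm_const _).eq (isTerm_var _)).sigma1⟩

instance Delta1.const (p : Prop) : Delta1 (fun _ : ℕ → N => p) := by
  by_cases h : p
  · exact ((isTerm_const 0).eq (isTerm_const (0 : N))).delta1.congr fun _ => by simp [h]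
  · exact ((isTerm_const 0).eq (isTerm_const (0 : N))).neg.delta1.congr fun _ => by simp [h]

instance Delta1.eq {f g : (ℕ → N) → N} [Delta1Fun f] [Delta1Fun g] :
    Delta1 (fun v => f v = g v) :=
  Delta1.subst₂ ((isTerm_var _).eq (isTerm_var _)).delta1 f g

instance Delta1.lt {f g : (ℕ → N) → N} [Delta1Fun f] [Delta1Fun g] :
    Delta1 (fun v => f v < g v) :=
  Delta1.subst₂ ((isTerm_var _).lt (isTerm_var _)).delta1 f g

instance Delta1.le {f g : (ℕ → N) → N} [Delta1Fun f] [Delta1Fun g] :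
    Delta1 (fun v => f v ≤ g v) :=
  (Delta1.not (P := fun v => g v < f v)).congr fun _ => not_lt

instance Delta1.mem {f : (ℕ → N) → N} [Delta1Fun f] {X : Set N} [hX : InModel X] :
    Delta1 (fun v => f v ∈ X) :=
  Delta1.subst₁ ((isTerm_var _).mem hX.mem).delta1 f

theorem Delta1Fun.of_graph₁ {F : N → N} (h : Sigma1 (fun w : ℕ → N => F (w 0) = w 1))
    (f : (ℕ → N) → N) [hf : Delta1Fun f] : Delta1Fun (fun v => F (f v)) :=
  ⟨Sigma1.subst (P := fun w x => F x = w 0) (hf.rename Nat.succ)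
    (h.rename fun | 0 => 0 | _ => 1)⟩

theorem Delta1Fun.of_graph₂ {F : N → N → N} (h : Sigma1 (fun w : ℕ → N => F (w 0) (w 1) = w 2))
    (f g : (ℕ → N) → N) [hf : Delta1Fun f] [hg : Delta1Fun g] :
    Delta1Fun (fun v => F (f v) (g v)) :=
  ⟨Sigma1.subst (P := fun w x => F x (g fun i => w (i + 1)) = w 0) (hf.rename Nat.succ)
    (Sigma1.subst (P := fun w x => F (w 0) x = w 1) ((hg.rename Nat.succ).rename Nat.succ)
      (h.rename fun | 0 => 1 | 1 => 0 | _ => 2))⟩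

instance Delta1Fun.add {f g : (ℕ → N) → N} [Delta1Fun f] [Delta1Fun g] :
    Delta1Fun (fun v => f v + g v) :=
  Delta1Fun.of_graph₂ (((isTerm_var _).add (isTerm_var _)).eq (isTerm_var _)).sigma1 f g

instance Delta1Fun.mul {f g : (ℕ → N) → N} [Delta1Fun f] [Delta1Fun g] :
    Delta1Fun (fun v => f v * g v) :=
  Delta1Fun.of_graph₂ (((isTerm_var _).mul (isTerm_var _)).eq (isTerm_var _)).sigma1 f g

instance Delta1Fun.pair {f g : (ℕ → N) → N} [Delta1Fun f] [Delta1Fun g] :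
    Delta1Fun (fun v => pair (f v) (g v)) :=
  inferInstanceAs (Delta1Fun (fun v => (f v + g v) * (f v + g v) + f v))

instance Sigma1.ball {t : (ℕ → N) → N} {P : (ℕ → N) → N → Prop} [ht : Delta1Fun t]
    [hP : Sigma1 (fun w => P (fun i => w (i + 1)) (w 0))] :
    Sigma1 (fun v => ∀ x, x < t v → P v x) := by
  refine Sigma1.subst (P := fun v b => ∀ x, x < b → P v x) ht ?_
  exact (hP.rename fun | 0 => 0 | i + 1 => i + 2).ball_var 0

theorem sigma1_bex {t : (ℕ → N) → N} {P : (ℕ → N) → N → Prop} (ht : Delta1Fun t)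
    (hP : Sigma1 (fun w => P (fun i => w (i + 1)) (w 0))) :
    Sigma1 (fun v => ∃ x, x < t v ∧ P v x) := by
  have := ht.rename Nat.succ
  refine Sigma1.ex (hP := ?_)
  exact Sigma1.and (hP := (Delta1.lt (f := fun w => w 0)
    (g := fun w => t (fun i => w (i + 1)))).pos)

instance Delta1.bex {t : (ℕ → N) → N} {P : (ℕ → N) → N → Prop} [ht : Delta1Fun t]
    [hP : Delta1 (fun w => P (fun i => w (i + 1)) (w 0))] :
    Delta1 (fun v => ∃ x, x < t v ∧ P v x) :=
  ⟨sigma1_bex ht hP.pos, (Sigma1.ball (t := t) (P := fun v x => ¬ P v x)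
    (hP := hP.neg)).congr fun v => by push Not; rfl⟩

instance Delta1.ball {t : (ℕ → N) → N} {P : (ℕ → N) → N → Prop} [ht : Delta1Fun t]
    [hP : Delta1 (fun w => P (fun i => w (i + 1)) (w 0))] :
    Delta1 (fun v => ∀ x, x < t v → P v x) :=
  (Delta1.not (P := fun v => ∃ x, x < t v ∧ ¬ P v x)).congr fun v => by push Not; rfl

/-! ## Comprehension, induction and least numbers -/

/-- This is `Δ⁰₁` comprehension. The formulas for the predicate and for its negation come with
different parameters, which are interleaved to fit the single assignment of the scheme. -/
instance InModel.setOf {P : N → Prop} [hP : Delta1 (fun v : ℕ → N => P (v 0))] :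
    InModel {x | P x} := by
  obtain ⟨θ, hθ, V, hV, v, h⟩ := hP.pos.exists_formula (fun _ => 0)
  obtain ⟨θ', hθ', V', hV', v', h'⟩ := hP.neg.exists_formula (fun _ => 0)
  set ρ := liftRenaming (liftRenaming (fun i => 2 * i))
  set ρ' := liftRenaming (liftRenaming (fun i => 2 * i + 1))
  have e : ∀ n, (ArithFormula.ex (θ.rename (fun i => 2 * i) ρ)).Sat (interleave V V')
      (push n (interleave v v')) ↔ P n := fun n => by
    simp only [ArithFormula.Sat, ArithFormula.sat_rename, ρ, push_comp_liftRenaming,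
      interleave_comp_even, ← h]
    rfl
  have e' : ∀ n, (ArithFormula.all (.neg (θ'.rename (fun i => 2 * i + 1) ρ'))).Sat
      (interleave V V') (push n (interleave v v')) ↔ P n := fun n => by
    have := h' n
    simp only [ArithFormula.Sat, ArithFormula.sat_rename, ρ', push_comp_liftRenaming,
      interleave_comp_odd, ← not_exists, ← this]
    exact not_not
  obtain ⟨X, hX, hX'⟩ := delta_comprehension _ _ ⟨_, hθ.rename _ ρ, rfl⟩
    ⟨.neg _, hθ'.rename _ ρ', rfl⟩ (interleave V V')
    (fun i => by unfold interleave; split_ifs <;> simp [hV, hV']) (interleave v v')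
    (fun n => (e n).trans (e' n).symm)
  rw [show {x | P x} = X from Set.ext fun n => ((hX' n).trans (e n)).symm]
  exact ⟨hX⟩

/-- Without a least element one could descend from `a` arbitrarily often: by induction on `n` some
`x` with `P x` satisfies `x + n ≤ a`, which fails for `n = a + 1`. -/
theorem exists_least {P : N → Prop} [hP : Sigma1 (fun v : ℕ → N => P (v 0))] {a : N} (ha : P a) :
    ∃ x, P x ∧ ∀ y, y < x → ¬ P y := by
  by_contra! H
  have key : ∀ n : N, ∃ x, P x ∧ x + n ≤ a := by
    have : Sigma1 (fun v : ℕ → N => P (v 0)) := hP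
    have h1 : Sigma1 (fun v : ℕ → N => ∃ x, P x ∧ x + v 0 ≤ a) := inferInstance
    refine sigma1_induction ⟨a, ha, by simp⟩ ?_
    rintro n ⟨x, hx, hn⟩
    obtain ⟨y, hy, hPy⟩ := H x hx
    refine ⟨y, hPy, le_trans ?_ hn⟩
    have := add_one_le_of_lt _ _ hy
    grind
  obtain ⟨x, _, h⟩ := key (a + 1)
  have : a + 1 ≤ a := le_trans (le_add_of_nonneg_left zero_le) h
  exact absurd (add_one_le_iff.1 this) (lt_irrefl _)

/-- The least strict upper bound is a successor `d + 1`. If there were no greatest element, `d`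
would already be a strict upper bound. -/
theorem exists_greatest {P : N → Prop} [hP : Delta1 (fun v : ℕ → N => P (v 0))] {a b : N}
    (ha : P a) (hb : ∀ x, P x → x < b) : ∃ x, P x ∧ ∀ y, P y → y ≤ x := by
  obtain ⟨c, hc, hl⟩ := exists_least (P := fun c => ∀ x, x < b → P x → x < c)
    (a := b) (fun x hx _ => hx)
  by_contra! H
  obtain ⟨y, hy, hay⟩ := H a ha
  have hc0 : 0 < c := lt_of_le_of_lt zero_le (hc a (hb a ha) ha)
  obtain ⟨d, rfl⟩ := exists_add_of_le (add_one_le_of_lt _ _ hc0)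
  refine hl d (by rw [zero_add, add_comm]; exact lt_add_one_iff.2 le_rfl) fun x hx hPx => ?_
  obtain ⟨y, hy, hxy⟩ := H x hPx
  have h1 := hc y (hb y hy) hy
  rw [zero_add, add_comm, lt_add_one_iff] at h1
  exact lt_of_lt_of_le hxy h1

/-! ## Pairs and codes of finite sets -/

theorem lt_add_one_self (x : N) : x < x + 1 := lt_add_one_iff.2 le_rfl

theorem eq_zero_or_exists_add_one (x : N) : x = 0 ∨ ∃ y, x = y + 1 := by
  rcases eq_or_lt_of_le (zero_le (a := x)) with h | h
  · exact .inl h.symm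
  · obtain ⟨y, hy⟩ := exists_add_of_le (add_one_le_of_lt _ _ h)
    exact .inr ⟨y, by rw [hy]; ring⟩

theorem le_mul_self_of_nat (a : N) : a ≤ a * a := by
  rcases eq_zero_or_exists_add_one a with rfl | ⟨b, rfl⟩
  · simp
  · exact le_mul_of_one_le_right zero_le (le_add_of_nonneg_left zero_le)

theorem left_le_pair (x y : N) : x ≤ pair x y := le_add_of_nonneg_left zero_le

theorem right_le_pair (x y : N) : y ≤ pair x y :=
  ((le_add_of_nonneg_left zero_le).trans (le_mul_self_of_nat (x + y))).trans
    (le_add_of_nonneg_right zero_le)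

/-- The term `x` added to the square is too small to reach the next square: `(x + y)² + x < (x + y +
1)²`. -/
theorem pair_lt_pair_of_add_lt {x y x' y' : N} (h : x + y < x' + y') : pair x y < pair x' y' := by
  obtain ⟨z, hz⟩ := exists_add_of_le (add_one_le_of_lt _ _ h)
  refine lt_of_lt_of_le ?_ (le_add_of_nonneg_right zero_le)
  rw [hz, pair]
  have h0 : (x + y) * (x + y) + x + (x + y + y + 1 + z * z + (1 + 1) * z * (x + y + 1)) =
    (x + y + 1 + z) * (x + y + 1 + z) := by ring
  rw [← h0]
  refine lt_of_lt_of_le (lt_add_one_self _) ?_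
  have h1 : 1 ≤ x + y + y + 1 + z * z + (1 + 1) * z * (x + y + 1) := by
    have : x + y + y + 1 + z * z + (1 + 1) * z * (x + y + 1) =
      1 + (x + y + y + z * z + (1 + 1) * z * (x + y + 1)) := by ring
    rw [this]
    exact le_add_of_nonneg_right zero_le
  gcongr

theorem pair_inj {x y x' y' : N} : pair x y = pair x' y' ↔ x = x' ∧ y = y' := by
  refine ⟨fun h => ?_, fun ⟨h, h'⟩ => by rw [h, h']⟩
  rcases lt_trichotomy (x + y) (x' + y') with h' | h' | h'
  · exact absurd h (pair_lt_pair_of_add_lt h').ne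
  · have hx : x = x' := by rw [pair, pair, h'] at h; exact add_left_cancel h
    subst hx
    exact ⟨rfl, add_left_cancel h'⟩
  · exact absurd h (pair_lt_pair_of_add_lt h').ne'

theorem FinMem.lt {x e : N} (h : FinMem x e) : x < e := by
  obtain ⟨k, m, n, rfl, h, _⟩ := h
  exact lt_of_lt_of_le h (left_le_pair _ _)

theorem finMem_iff (x e : N) : FinMem x e ↔ ∃ k, k < e + 1 ∧ ∃ m, m < e + 1 ∧ ∃ n, n < e + 1 ∧
    (e = pair k (pair m n) ∧ x < k ∧ ∃ q, q < n + 1 ∧ n = (m * (x + 1) + 1) * q) := by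
  constructor
  · rintro ⟨k, m, n, rfl, hx, q, hq⟩
    have h1 := left_le_pair k (pair m n)
    have h2 := right_le_pair k (pair m n)
    refine ⟨k, lt_add_one_iff.2 h1, m, lt_add_one_iff.2 ((left_le_pair m n).trans h2), n,
      lt_add_one_iff.2 ((right_le_pair m n).trans h2), rfl, hx, q, lt_add_one_iff.2 ?_, hq⟩
    rw [hq]
    exact le_mul_of_one_le_left zero_le (le_add_of_nonneg_left zero_le)
  · rintro ⟨k, _, m, _, n, _, h, hx, q, _, hq⟩
    exact ⟨k, m, n, h, hx, q, hq⟩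

instance Delta1.finMem {f g : (ℕ → N) → N} [Delta1Fun f] [Delta1Fun g] :
    Delta1 (fun v => FinMem (f v) (g v)) := by
  refine Delta1.subst₂ ?_ f g
  simp only [finMem_iff]
  infer_instance

theorem isFinCode_iff (e : N) : IsFinCode e ↔
    ∀ e', e' < e → ¬ ∀ x, x < e + 1 → (FinMem x e' ↔ FinMem x e) := by
  refine forall_congr' fun e' => imp_congr_right fun he => not_congr ?_
  refine ⟨fun h x _ => h x, fun h x => ⟨fun hx => ?_, fun hx => ?_⟩⟩
  · exact (h x (hx.lt.trans (he.trans (lt_add_one_self _)))).1 hx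
  · exact (h x (hx.lt.trans (lt_add_one_self _))).2 hx

instance Delta1.isFinCode {f : (ℕ → N) → N} [Delta1Fun f] :
    Delta1 (fun v => IsFinCode (f v)) := by
  refine Delta1.subst₁ ?_ f
  simp only [isFinCode_iff]
  infer_instance

theorem IsFinCode.ext {e e' : N} (h : IsFinCode e) (h' : IsFinCode e')
    (H : ∀ x, FinMem x e ↔ FinMem x e') : e = e' := by
  rcases lt_trichotomy e e' with hl | hl | hl
  · exact absurd H (h' e hl)
  · exact hl
  · exact absurd (fun x => (H x).symm) (h e' hl)

/-- The moduli `m (x + 1) + 1` for `x < k` are pairwise coprime if `m` is a common multiple of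
the numbers `1, …, k`. -/
theorem dvd_of_dvd_mul_modulus {k m n x j : N} (hm : ∀ d, d < k → (d + 1) ∣ m) (hx : x < k)
    (hj : j < k) (hxj : x ≠ j) (h : (m * (x + 1) + 1) ∣ n * (m * (j + 1) + 1)) :
    (m * (x + 1) + 1) ∣ n := by
  set p := m * (x + 1) + 1 with hp
  obtain ⟨a, ha⟩ := h
  -- There is no subtraction, so divisibility is concluded from an equation with multiples of `p` on
  -- both sides.
  have cancel : ∀ C D : N, n + p * C = p * D → p ∣ n := by
    intro C D hCD
    have h1 : p * C ≤ p * D := by rw [← hCD]; exact le_add_of_nonneg_left zero_le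
    have hp0 : 0 < p := lt_of_le_of_lt zero_le (lt_add_one_self _)
    obtain ⟨E, rfl⟩ := exists_add_of_le (le_of_mul_le_mul_left h1 hp0)
    refine ⟨E, ?_⟩
    rw [mul_add, add_comm] at hCD
    exact add_left_cancel hCD
  rcases lt_or_gt_of_ne hxj with hlt | hlt
  · obtain ⟨d, rfl⟩ := exists_add_of_le (add_one_le_of_lt _ _ hlt)
    have hd : d < k := lt_of_le_of_lt (le_add_of_nonneg_left zero_le) hj
    obtain ⟨r, hr⟩ := hm d hd
    -- With `q = m (j + 1) + 1` one has `(j + 1) p = (x + 1) q + (d + 1)`. Multiplying by `(x + 1)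
    -- r` turns the remainder `d + 1` into `m (x + 1) = p - 1`, which gives a Bézout identity for
    -- `p` and `q`.
    refine cancel (n * ((x + 1) * r * (x + 1 + d + 1))) (n + a * ((x + 1) * (x + 1) * r)) ?_
    have e : p * (n + a * ((x + 1) * (x + 1) * r)) =
      p * n + (p * a) * ((x + 1) * (x + 1) * r) := by ring
    rw [e, ← ha, hp, hr]
    ring
  · obtain ⟨d, rfl⟩ := exists_add_of_le (add_one_le_of_lt _ _ hlt)
    have hd : d < k := lt_of_le_of_lt (le_add_of_nonneg_left zero_le) hx
    obtain ⟨r, hr⟩ := hm d hd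
    -- here `(j + 1) p + (d + 1) = (x + 1) q`
    refine cancel (a * ((j + 1 + d + 1) * (j + 1 + d + 1) * r))
      (n * (1 + (j + 1 + d + 1) * r * (j + 1))) ?_
    have e : p * (a * ((j + 1 + d + 1) * (j + 1 + d + 1) * r)) =
      (p * a) * ((j + 1 + d + 1) * (j + 1 + d + 1) * r) := by ring
    rw [e, ← ha, hp, hr]
    ring

/-- Gödel's coding by divisibility: `m` is a common multiple of `1, …, k`, so that the moduli `m (x
+ 1) + 1` are coprime, and `n` is the product of the moduli of the elements. Both are built by `Σ⁰₁`
induction; the code is then the least number with the same elements. -/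
theorem exists_finCode {P : N → Prop} [hP : Delta1 (fun v : ℕ → N => P (v 0))] (k : N) :
    ∃ e, IsFinCode e ∧ ∀ x, FinMem x e ↔ x < k ∧ P x := by
  have dvd_iff : ∀ a b : N, (a + 1) ∣ b ↔ ∃ q, q < b + 1 ∧ b = (a + 1) * q := by
    intro a b
    constructor
    · rintro ⟨q, rfl⟩
      exact ⟨q, lt_add_one_iff.2 (le_mul_of_one_le_left zero_le
        (le_add_of_nonneg_left zero_le)), rfl⟩
    · rintro ⟨q, _, h⟩
      exact ⟨q, h⟩
  have dvd_delta : ∀ f g : (ℕ → N) → N, Delta1Fun f → Delta1Fun g →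
      Delta1 (fun v => (f v + 1) ∣ g v) := by
    intro f g hf hg
    refine Delta1.subst₂ (P := fun a b => (a + 1) ∣ b) ?_ f g
    simp only [dvd_iff]
    infer_instance
  obtain ⟨m, hm0, hm⟩ : ∃ m : N, 0 < m ∧ ∀ d, d < k → (d + 1) ∣ m := by
    have h1 : Delta1 (fun w : ℕ → N => (w 0 + 1) ∣ w 1) := dvd_delta _ _ inferInstance inferInstance
    have h2 : Sigma1 (fun v : ℕ → N => ∃ m : N, 0 < m ∧ ∀ d, d < v 0 → (d + 1) ∣ m) :=
      inferInstance
    refine sigma1_induction (P := fun k => ∃ m : N, 0 < m ∧ ∀ d, d < k → (d + 1) ∣ m)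
      ⟨1, one_pos, fun d hd => absurd hd (not_lt.2 zero_le)⟩ ?_ k
    rintro n ⟨m, hm0, hm⟩
    refine ⟨m * (n + 1), mul_pos hm0 (lt_of_le_of_lt zero_le (lt_add_one_self _)),
      fun d hd => ?_⟩
    rcases (lt_add_one_iff.1 hd).lt_or_eq with hd | rfl
    · exact (hm d hd).mul_right _
    · exact dvd_mul_left _ _
  obtain ⟨n, hn⟩ : ∃ n : N, ∀ x, x < k → ((m * (x + 1) + 1) ∣ n ↔ x < k ∧ P x) := by
    have h1 : Delta1 (fun w : ℕ → N => (m * (w 0 + 1) + 1) ∣ w 1) :=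
      dvd_delta (fun w => m * (w 0 + 1)) _ inferInstance inferInstance
    have hP0 : Delta1 (fun w : ℕ → N => P (w 0)) := hP
    refine sigma1_induction (P := fun l => ∃ n : N, ∀ x, x < k →
      ((m * (x + 1) + 1) ∣ n ↔ x < l ∧ P x)) ?_ ?_ k
    · refine ⟨1, fun x hx => ⟨fun h => ?_, fun h => absurd h.1 (not_lt.2 zero_le)⟩⟩
      obtain ⟨q, hq⟩ := h
      have h2 : (m * (x + 1) + 1) ≤ 1 := by
        rcases eq_zero_or_exists_add_one q with rfl | ⟨r, rfl⟩
        · simp at hq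
        · calc m * (x + 1) + 1 ≤ (m * (x + 1) + 1) * (r + 1) :=
                le_mul_of_one_le_right zero_le (le_add_of_nonneg_left zero_le)
            _ = 1 := hq.symm
      have h3 : 0 < m * (x + 1) := mul_pos hm0 (lt_of_le_of_lt zero_le (lt_add_one_self _))
      exact absurd h2 (not_le.2 (lt_add_of_pos_left _ h3))
    · rintro l ⟨n, hn⟩
      by_cases hl : l < k ∧ P l
      · refine ⟨n * (m * (l + 1) + 1), fun x hx => ?_⟩
        by_cases hxl : x = l
        · subst hxl
          exact ⟨fun _ => ⟨lt_add_one_self _, hl.2⟩, fun _ => dvd_mul_left _ _⟩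
        · rw [lt_add_one_iff, le_iff_lt_or_eq, or_iff_left hxl, ← hn x hx]
          exact ⟨dvd_of_dvd_mul_modulus hm hx hl.1 hxl, fun h => h.mul_right _⟩
      · refine ⟨n, fun x hx => ?_⟩
        rw [hn x hx]
        refine ⟨fun h => ⟨h.1.trans (lt_add_one_self _), h.2⟩, fun h => ⟨?_, h.2⟩⟩
        refine lt_of_le_of_ne (lt_add_one_iff.1 h.1) ?_
        rintro rfl
        exact hl ⟨hx, h.2⟩
  have h0 : ∀ x, FinMem x (pair k (pair m n)) ↔ x < k ∧ P x := by
    intro x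
    constructor
    · rintro ⟨k', m', n', h, hx, hq⟩
      obtain ⟨rfl, h'⟩ := pair_inj.1 h
      obtain ⟨rfl, rfl⟩ := pair_inj.1 h'
      exact (hn x hx).1 hq
    · intro h
      exact ⟨k, m, n, rfl, h.1, (hn x h.1).2 h⟩
  have hP0 : Delta1 (fun w : ℕ → N => P (w 0)) := hP
  have hP1 : Delta1 (fun w : ℕ → N => ∀ x, x < w 0 + k →  (FinMem x (w 0) ↔ x < k ∧ P x)) :=
    inferInstance
  -- Beyond `e + k` both sides are false, so this bound loses nothing and makes the predicate `Δ⁰₁`.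
  obtain ⟨e, he, hl⟩ := exists_least (P := fun e => ∀ x, x < e + k → (FinMem x e ↔ x < k ∧ P x))
    (a := pair k (pair m n)) (fun x _ => h0 x)
  have he' : ∀ x, FinMem x e ↔ x < k ∧ P x := fun x =>
    ⟨fun h => (he x (h.lt.trans_le (le_add_of_nonneg_right zero_le))).1 h,
      fun h => (he x (h.1.trans_le (le_add_of_nonneg_left zero_le))).2 h⟩
  exact ⟨e, fun e' h1 h2 => hl e' h1 fun x _ => (h2 x).trans (he' x), he'⟩

/-! ## Finite binary sequences -/

theorem IsSeq.le {s l : N} (h : IsSeq s l) : l ≤ s := by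
  by_contra! hl
  obtain ⟨j, hj, _⟩ := h.2.2 s hl
  exact absurd hj.lt (not_lt.2 (left_le_pair _ _))

theorem isSeq_iff (s l : N) : IsSeq s l ↔ IsFinCode s ∧
    (∀ p, p < s → FinMem p s → ∃ i, i < l ∧ ∃ j, j < s ∧ p = pair i j) ∧
    ∀ i, i < l → ∃ j, j < s ∧ FinMem (pair i j) s ∧
      ∀ j', j' < s → FinMem (pair i j') s → j' = j := by
  refine and_congr_right fun _ => and_congr ?_ ?_
  · refine forall_congr' fun p => ⟨fun h _ hp => ?_, fun h hp => ?_⟩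
    · obtain ⟨i, j, hi, rfl⟩ := h hp
      exact ⟨i, hi, j, (right_le_pair _ _).trans_lt hp.lt, rfl⟩
    · obtain ⟨i, hi, j, _, h⟩ := h hp.lt hp
      exact ⟨i, j, hi, h⟩
  · refine forall_congr' fun i => imp_congr_right fun hi => ⟨fun ⟨j, hj, hj'⟩ => ?_,
      fun ⟨j, _, hj, hj'⟩ => ⟨j, hj, fun y hy => hj' y ((right_le_pair _ _).trans_lt hy.lt) hy⟩⟩
    exact ⟨j, (right_le_pair _ _).trans_lt hj.lt, hj, fun j' _ => hj' j'⟩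

/-- `s` is the code of a binary sequence of length `l`. -/
def IsBitSeq (s l : N) : Prop := IsSeq s l ∧ ∀ i j : N, FinMem (pair i j) s → j = 0 ∨ j = 1

theorem isBitSeq_iff (s l : N) : IsBitSeq s l ↔ IsSeq s l ∧
    ∀ i, i < s → ∀ j, j < s → FinMem (pair i j) s → j = 0 ∨ j = 1 :=
  and_congr_right fun _ => ⟨fun h i _ j _ => h i j, fun h i j hij =>
    h i ((left_le_pair _ _).trans_lt hij.lt) j ((right_le_pair _ _).trans_lt hij.lt) hij⟩

instance Delta1.isBitSeq {f g : (ℕ → N) → N} [Delta1Fun f] [Delta1Fun g] :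
    Delta1 (fun v => IsBitSeq (f v) (g v)) := by
  refine Delta1.subst₂ ?_ f g
  simp only [isBitSeq_iff, isSeq_iff]
  infer_instance

theorem isBinarySeq_iff (s : N) : IsBinarySeq s ↔ ∃ l, IsBitSeq s l :=
  ⟨fun ⟨⟨l, hl⟩, h⟩ => ⟨l, hl, h⟩, fun ⟨l, hl, h⟩ => ⟨⟨l, hl⟩, h⟩⟩

/-- The `i`-th entry of the sequence `s` is `1`. -/
def Bit (s i : N) : Prop := FinMem (pair i 1) s

instance Delta1.bit {f g : (ℕ → N) → N} [Delta1Fun f] [Delta1Fun g] :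
    Delta1 (fun v => Bit (f v) (g v)) :=
  inferInstanceAs (Delta1 (fun v => FinMem (pair (g v) 1) (f v)))

theorem IsBitSeq.le {s l : N} (h : IsBitSeq s l) : l ≤ s := h.1.le

theorem IsBitSeq.lt_of_bit {s l i : N} (h : IsBitSeq s l) (hi : Bit s i) : i < l := by
  obtain ⟨i', j, hl, e⟩ := h.1.2.1 _ hi
  rwa [(pair_inj.1 e).1]

theorem IsBitSeq.finMem_iff {s l : N} (h : IsBitSeq s l) (p : N) :
    FinMem p s ↔ ∃ i, i < l ∧ ((p = pair i 1 ∧ Bit s i) ∨ (p = pair i 0 ∧ ¬ Bit s i)) := by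
  constructor
  · intro hp
    obtain ⟨i, j, hi, rfl⟩ := h.1.2.1 _ hp
    refine ⟨i, hi, ?_⟩
    rcases h.2 i j hp with rfl | rfl
    · refine .inr ⟨rfl, fun h' => ?_⟩
      exact zero_ne_one ((h.1.2.2 i hi).unique hp h')
    · exact .inl ⟨rfl, hp⟩
  · rintro ⟨i, hi, ⟨rfl, h'⟩ | ⟨rfl, h'⟩⟩
    · exact h'
    · obtain ⟨j, hj, _⟩ := h.1.2.2 i hi
      rcases h.2 i j hj with rfl | rfl
      · exact hj
      · exact absurd hj h'

theorem IsBitSeq.subset {s t k l : N} (ht : IsBitSeq t k) (hs : IsBitSeq s l) (hkl : k ≤ l)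
    (h : ∀ i, i < k → (Bit t i ↔ Bit s i)) (p : N) (hp : FinMem p t) : FinMem p s := by
  obtain ⟨i, hi, hp⟩ := (ht.finMem_iff p).1 hp
  rw [h i hi] at hp
  exact (hs.finMem_iff p).2 ⟨i, hi.trans_le hkl, hp⟩

theorem IsBitSeq.ext {s t l : N} (hs : IsBitSeq s l) (ht : IsBitSeq t l)
    (h : ∀ i, i < l → (Bit s i ↔ Bit t i)) : s = t :=
  hs.1.1.ext ht.1.1 fun p =>
    ⟨hs.subset ht le_rfl h p, ht.subset hs le_rfl (fun i hi => (h i hi).symm) p⟩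

theorem IsBitSeq.length_unique {s k l : N} (h : IsBitSeq s k) (h' : IsBitSeq s l) : k = l := by
  rcases lt_trichotomy k l with hl | hl | hl
  · obtain ⟨j, hj, _⟩ := h'.1.2.2 k hl
    obtain ⟨i, j', hi, e⟩ := h.1.2.1 _ hj
    exact absurd hi ((pair_inj.1 e).1 ▸ lt_irrefl _)
  · exact hl
  · obtain ⟨j, hj, _⟩ := h.1.2.2 l hl
    obtain ⟨i, j', hi, e⟩ := h'.1.2.1 _ hj
    exact absurd hi ((pair_inj.1 e).1 ▸ lt_irrefl _)

theorem exists_isBitSeq {P : N → Prop} [hP : Delta1 (fun v : ℕ → N => P (v 0))] (l : N) :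
    ∃ s, IsBitSeq s l ∧ ∀ i, i < l → (Bit s i ↔ P i) := by
  have hP0 : Delta1 (fun w : ℕ → N => P (w 0)) := hP
  have hX : InModel {x | P x} := inferInstance
  obtain ⟨s, hs, hs'⟩ := exists_finCode (P := fun p => ∃ i, i < l ∧
    ((p = pair i 1 ∧ i ∈ {x | P x}) ∨ (p = pair i 0 ∧ ¬ i ∈ {x | P x}))) (pair l 1)
  have hlt : ∀ i, i < l → pair i 1 < pair l (1 : N) ∧ pair i 0 < pair l (1 : N) := fun i hi =>
    ⟨pair_lt_pair_of_add_lt (by gcongr), pair_lt_pair_of_add_lt (add_lt_add hi one_pos)⟩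
  have key : ∀ i j, FinMem (pair i j) s ↔ i < l ∧ ((j = 1 ∧ P i) ∨ (j = 0 ∧ ¬ P i)) := by
    intro i j
    rw [hs']
    constructor
    · rintro ⟨_, i', hi, ⟨h, h'⟩ | ⟨h, h'⟩⟩ <;> obtain ⟨rfl, rfl⟩ := pair_inj.1 h
      · exact ⟨hi, .inl ⟨rfl, h'⟩⟩
      · exact ⟨hi, .inr ⟨rfl, h'⟩⟩
    · rintro ⟨hi, ⟨rfl, h⟩ | ⟨rfl, h⟩⟩
      · exact ⟨(hlt i hi).1, i, hi, .inl ⟨rfl, h⟩⟩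
      · exact ⟨(hlt i hi).2, i, hi, .inr ⟨rfl, h⟩⟩
  refine ⟨s, ⟨⟨hs, fun p hp => ?_, fun i hi => ?_⟩, fun i j h => ?_⟩, fun i hi => ?_⟩
  · obtain ⟨_, i, hi, ⟨h, _⟩ | ⟨h, _⟩⟩ := (hs' p).1 hp
    exacts [⟨i, 1, hi, h⟩, ⟨i, 0, hi, h⟩]
  · by_cases h : P i
    · exact ⟨1, (key i 1).2 ⟨hi, .inl ⟨rfl, h⟩⟩, fun j hj => by have := (key i j).1 hj; tauto⟩
    · exact ⟨0, (key i 0).2 ⟨hi, .inr ⟨rfl, h⟩⟩, fun j hj => by have := (key i j).1 hj; tauto⟩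
  · have := (key i j).1 h
    tauto
  · refine (key i 1).trans ⟨fun h => ?_, fun h => ⟨hi, .inl ⟨rfl, h⟩⟩⟩
    rcases h.2 with h | h
    · exact h.2
    · exact absurd h.1 one_ne_zero

theorem IsBitSeq.of_subset {s t k l : N} (hs : IsBitSeq s l) (ht : IsSeq t k)
    (h : ∀ p, FinMem p t → FinMem p s) :
    IsBitSeq t k ∧ k ≤ l ∧ ∀ i, i < k → (Bit t i ↔ Bit s i) := by
  have ht' : IsBitSeq t k := ⟨ht, fun i j hij => hs.2 i j (h _ hij)⟩
  refine ⟨ht', ?_, fun i hi => ⟨fun h' => h _ h', fun h' => ?_⟩⟩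
  · by_contra! hl
    obtain ⟨j, hj, _⟩ := ht.2.2 l hl
    obtain ⟨i, j', hi, e⟩ := hs.1.2.1 _ (h _ hj)
    exact absurd hi ((pair_inj.1 e).1 ▸ lt_irrefl _)
  · by_contra hb
    have h0 := h _ ((ht'.finMem_iff (pair i 0)).2 ⟨i, hi, .inr ⟨rfl, hb⟩⟩)
    exact zero_ne_one ((hs.1.2.2 i (hs.lt_of_bit h')).unique h0 h')

/-- Weak König's lemma for a system of implications: if all finite parts of the system have
solutions in the model, then so has the whole system. -/
theorem exists_closed_set
    (wkl : ∀ T : Set N, T ∈ sets → IsBinaryTree T → IsInfinite T → ∃ f ∈ sets, IsPath T f)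
    {E : Set N} [hE : InModel E] (u v : N)
    (h : ∀ n, ∃ X, InModel X ∧ u ∈ X ∧ v ∉ X ∧
      ∀ j a b, pair j (pair a b) ∈ E → pair j (pair a b) < n → a ∈ X → b ∈ X) :
    ∃ X, InModel X ∧ u ∈ X ∧ v ∉ X ∧ ∀ j a b, pair j (pair a b) ∈ E → a ∈ X → b ∈ X := by
  -- A sequence of length `l` is tested against the implications with code below `l`. Codes bound
  -- their components, so both bits of such an implication are already decided, and the condition
  -- passes to initial segments.
  let C : N → N → Prop := fun s l => (u < l → Bit s u) ∧ (v < l → ¬ Bit s v) ∧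
    ∀ p, p < l → p ∈ E → ∀ j, j < p + 1 → ∀ a, a < p + 1 → ∀ b, b < p + 1 →
      p = pair j (pair a b) → Bit s a → Bit s b
  have bounds : ∀ j a b : N, j ≤ pair j (pair a b) ∧ a ≤ pair j (pair a b) ∧
      b ≤ pair j (pair a b) := fun j a b =>
    ⟨left_le_pair _ _, (left_le_pair _ _).trans (right_le_pair _ _),
      (right_le_pair _ _).trans (right_le_pair _ _)⟩
  have hC : ∀ s l j a b, C s l → pair j (pair a b) ∈ E → pair j (pair a b) < l → Bit s a →
      Bit s b := fun s l j a b h1 h2 h3 =>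
    h1.2.2 _ h3 h2 j (lt_add_one_iff.2 (bounds j a b).1) a (lt_add_one_iff.2 (bounds j a b).2.1) b
      (lt_add_one_iff.2 (bounds j a b).2.2) rfl
  let T : Set N := {s | ∃ l, l < s + 1 ∧ IsBitSeq s l ∧ C s l}
  have hT : InModel T := by
    refine @InModel.setOf N _ (fun s => ∃ l, l < s + 1 ∧ IsBitSeq s l ∧ C s l) ?_
    simp only [C]
    infer_instance
  obtain ⟨f, hf, hf1, hf2⟩ := wkl T hT.mem
    ⟨fun s ⟨l, _, hl, _⟩ => (isBinarySeq_iff s).2 ⟨l, hl⟩, by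
      rintro s ⟨l, -, hl, hu, hv, hCl⟩ t k ht hts
      obtain ⟨ht', hkl, hb⟩ := hl.of_subset ht hts
      refine ⟨k, lt_add_one_iff.2 ht'.le, ht', fun h => (hb u h).2 (hu (h.trans_le hkl)),
        fun h h' => hv (h.trans_le hkl) ((hb v h).1 h'),
        fun p hp hpE j hj a ha b hb' e hba => ?_⟩
      have hbk : b < k := by
        subst e
        exact (bounds j a b).2.2.trans_lt hp
      exact (hb b hbk).2 (hCl p (hp.trans_le hkl) hpE j hj a ha b hb' e
        ((hb a (ht'.lt_of_bit hba)).1 hba))⟩ (by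
      intro b
      obtain ⟨X, hX, hu, hv, hXE⟩ := h (b + 1)
      obtain ⟨s, hs, hs'⟩ := exists_isBitSeq (P := fun i => i ∈ X) (b + 1)
      refine ⟨s, ⟨b + 1, lt_add_one_iff.2 hs.le, hs, fun h => (hs' u h).2 hu,
        fun h h' => hv ((hs' v h).1 h'), fun p hp hpE j hj a ha b' hb' e hba => ?_⟩,
        (lt_add_one_self b).trans_le hs.le⟩
      subst e
      exact (hs' b' ((bounds j a b').2.2.trans_lt hp)).2 (hXE j a b' hpE hp
        ((hs' a (hs.lt_of_bit hba)).1 hba)))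
  have hf' : InModel f := ⟨hf⟩
  have key : ∀ n, ∃ s, C s n ∧ ∀ i, i < n → (Bit s i ↔ pair i 1 ∈ f) := by
    intro n
    obtain ⟨s, ⟨l, -, hl, hCl⟩, hs, hsf⟩ := hf2 n
    have hsb : IsBitSeq s n := ⟨hs, hl.2⟩
    obtain rfl := hsb.length_unique hl
    refine ⟨s, hCl, fun i hi => ⟨fun h => hsf _ h, fun h => ?_⟩⟩
    by_contra hb
    have h0 := hsf _ ((hsb.finMem_iff (pair i 0)).2 ⟨i, hi, .inr ⟨rfl, hb⟩⟩)
    exact zero_ne_one ((hf1.2 i trivial).unique h0 h)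
  refine ⟨{i | pair i 1 ∈ f}, inferInstance, ?_, ?_, fun j a b hE' ha => ?_⟩
  · obtain ⟨s, hs, hb⟩ := key (u + 1)
    exact (hb u (lt_add_one_self u)).1 (hs.1 (lt_add_one_self u))
  · obtain ⟨s, hs, hb⟩ := key (v + 1)
    exact fun h => hs.2.1 (lt_add_one_self v) ((hb v (lt_add_one_self v)).2 h)
  · obtain ⟨s, hs, hb⟩ := key (pair j (pair a b) + 1)
    have h1 := lt_add_one_iff.2 (bounds j a b).2.1
    have h2 := lt_add_one_iff.2 (bounds j a b).2.2
    exact (hb b h2).1 (hC s _ j a b hs hE' (lt_add_one_self _) ((hb a h1).2 ha))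

/-- The two-sorted structure of a model of `RCA₀`. -/
abbrev RCAModel.toL2 (N : Type u) [RCAModel N] : L2Structure.{u} where
  Num := N
  Sets := sets
  sets_nonempty := RCAModel.sets_nonempty

/-! ## Order topologies -/

instance Delta1Fun.finitePoint {f : (ℕ → N) → N} [Delta1Fun f] :
    Delta1Fun (fun v => finitePoint (f v)) :=
  inferInstanceAs (Delta1Fun (fun v => f v + 1 + 1))

theorem finitePoint_inj {x y : N} : finitePoint x = finitePoint y ↔ x = y := by
  simp [finitePoint]

theorem finitePoint_ne_zero (x : N) : finitePoint x ≠ 0 :=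
  (lt_of_le_of_lt zero_le (lt_add_one_self (x + 1))).ne'

theorem finitePoint_ne_one (x : N) : finitePoint x ≠ 1 := by
  intro h
  have h1 : x + 1 + 1 = 0 + 1 := by rw [zero_add]; exact h
  exact (lt_of_le_of_lt zero_le (lt_add_one_self x)).ne' (add_right_cancel h1)

theorem lt_finitePoint (x : N) : x < finitePoint x :=
  (lt_add_one_self x).trans (lt_add_one_self (x + 1))

/-- `a` lies below the point `x` of the order, for a point `a` of the extended order. -/
def BelowPoint (R : Set N) (a x : N) : Prop := a = 0 ∨ ∃ y, a = finitePoint y ∧ pair y x ∈ R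

/-- `b` lies above the point `x` of the order, for a point `b` of the extended order. -/
def AbovePoint (R : Set N) (b x : N) : Prop := b = 1 ∨ ∃ y, b = finitePoint y ∧ pair x y ∈ R

theorem belowPoint_finitePoint {R : Set N} {x y : N} :
    BelowPoint R (finitePoint y) x ↔ pair y x ∈ R := by
  simp [BelowPoint, finitePoint_ne_zero, finitePoint_inj]

theorem abovePoint_finitePoint {R : Set N} {x y : N} :
    AbovePoint R (finitePoint y) x ↔ pair x y ∈ R := by
  simp [AbovePoint, finitePoint_ne_one, finitePoint_inj]

instance Delta1.belowPoint {f g : (ℕ → N) → N} [Delta1Fun f] [Delta1Fun g] {R : Set N}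
    [InModel R] : Delta1 (fun v => BelowPoint R (f v) (g v)) := by
  refine Delta1.subst₂ ?_ f g
  have : ∀ a x, BelowPoint R a x ↔ a = 0 ∨ ∃ y, y < a ∧ (a = finitePoint y ∧ pair y x ∈ R) :=
    fun a x => or_congr_right (exists_congr fun y =>
      ⟨fun h => ⟨h.1 ▸ lt_finitePoint y, h⟩, fun h => h.2⟩)
  simp only [this]
  infer_instance

instance Delta1.abovePoint {f g : (ℕ → N) → N} [Delta1Fun f] [Delta1Fun g] {R : Set N}
    [InModel R] : Delta1 (fun v => AbovePoint R (f v) (g v)) := by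
  refine Delta1.subst₂ ?_ f g
  have : ∀ a x, AbovePoint R a x ↔ a = 1 ∨ ∃ y, y < a ∧ (a = finitePoint y ∧ pair x y ∈ R) :=
    fun a x => or_congr_right (exists_congr fun y =>
      ⟨fun h => ⟨h.1 ▸ lt_finitePoint y, h⟩, fun h => h.2⟩)
  simp only [this]
  infer_instance

theorem extendedLT_finitePoint_right {R : Set N} {a x : N} :
    ExtendedLT R a (finitePoint x) ↔ BelowPoint R a x := by
  simp only [ExtendedLT, BelowPoint, ne_eq, finitePoint_ne_zero, finitePoint_ne_one, finitePoint_inj,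
    not_false_eq_true, and_true, and_false, false_or]
  refine or_congr_right ⟨?_, ?_⟩
  · rintro ⟨y, _, h, rfl, h'⟩
    exact ⟨y, h, h'⟩
  · rintro ⟨y, h, h'⟩
    exact ⟨y, x, h, rfl, h'⟩

theorem extendedLT_finitePoint_left {R : Set N} {b x : N} :
    ExtendedLT R (finitePoint x) b ↔ AbovePoint R b x := by
  simp only [ExtendedLT, AbovePoint, ne_eq, finitePoint_ne_zero, finitePoint_ne_one, finitePoint_inj,
    not_false_eq_true, true_and, false_and, false_or]
  refine or_congr_right ⟨?_, ?_⟩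
  · rintro ⟨_, y, rfl, h, h'⟩
    exact ⟨y, h, h'⟩
  · rintro ⟨y, h, h'⟩
    exact ⟨x, y, rfl, h, h'⟩

theorem mem_interval_iff {L R : Set N} {x i : N} : x ∈ interval L R i ↔
    x ∈ L ∧ ∃ a b, i = pair a b ∧ BelowPoint R a x ∧ AbovePoint R b x := by
  simp only [interval, extendedLT_finitePoint_right, extendedLT_finitePoint_left]
  rfl

theorem mem_interval_pair {L R : Set N} {x a b : N} : x ∈ interval L R (pair a b) ↔
    x ∈ L ∧ BelowPoint R a x ∧ AbovePoint R b x := by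
  rw [mem_interval_iff]
  refine and_congr_right fun _ => ⟨?_, fun h => ⟨a, b, rfl, h⟩⟩
  rintro ⟨a', b', h, h'⟩
  obtain ⟨rfl, rfl⟩ := pair_inj.1 h
  exact h'

instance Delta1.mem_interval {f g : (ℕ → N) → N} [Delta1Fun f] [Delta1Fun g] {L R : Set N}
    [InModel L] [InModel R] : Delta1 (fun v => f v ∈ interval L R (g v)) := by
  refine Delta1.subst₂ (P := fun x i => x ∈ interval L R i) ?_ f g
  have : ∀ x i, x ∈ interval L R i ↔ x ∈ L ∧ ∃ a, a < i + 1 ∧ ∃ b, b < i + 1 ∧ (i = pair a b ∧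
      BelowPoint R a x ∧ AbovePoint R b x) := by
    intro x i
    rw [mem_interval_iff]
    refine and_congr_right fun _ => ⟨?_, fun ⟨a, _, b, _, h⟩ => ⟨a, b, h⟩⟩
    rintro ⟨a, b, rfl, h⟩
    exact ⟨a, lt_add_one_iff.2 (left_le_pair _ _), b, lt_add_one_iff.2 (right_le_pair _ _), rfl, h⟩
  simp only [this]
  infer_instance

theorem add_self_inj {a b : N} : a + a = b + b ↔ a = b := by
  refine ⟨fun h => ?_, fun h => by rw [h]⟩
  rcases lt_trichotomy a b with hl | hl | hl
  · exact absurd h (add_lt_add hl hl).ne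
  · exact hl
  · exact absurd h (add_lt_add hl hl).ne'

theorem add_self_ne_add_self_add_one (a b : N) : a + a ≠ b + b + 1 := by
  intro h
  rcases lt_or_ge b a with hl | hl
  · have h1 := add_lt_add_of_le_of_lt (add_one_le_of_lt _ _ hl) hl
    rw [h] at h1
    exact absurd h1 (by rw [add_right_comm]; exact lt_irrefl _)
  · exact absurd h (lt_add_one_iff.2 (add_le_add hl hl)).ne

theorem le_add_self (a : N) : a ≤ a + a := le_add_of_nonneg_right zero_le

/-! ### Compactness for honest covers from weak König's lemma -/

section Cover

variable {L R : Set N}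

theorem IsCountableLinearOrder.left_mem (h : IsCountableLinearOrder (toL2 N) L R) {x y : N}
    (hxy : pair x y ∈ R) : x ∈ L := by
  obtain ⟨x', hx, y', _, e⟩ := h.rel_subset _ hxy
  exact (pair_inj.1 e).1 ▸ hx

theorem IsCountableLinearOrder.right_mem (h : IsCountableLinearOrder (toL2 N) L R) {x y : N}
    (hxy : pair x y ∈ R) : y ∈ L := by
  obtain ⟨x', _, y', hy, e⟩ := h.rel_subset _ hxy
  exact (pair_inj.1 e).2 ▸ hy

theorem IsCountableLinearOrder.trans' (h : IsCountableLinearOrder (toL2 N) L R) {x y z : N}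
    (hxy : pair x y ∈ R) (hyz : pair y z ∈ R) : pair x z ∈ R :=
  h.trans x (h.left_mem hxy) y (h.right_mem hxy) z (h.right_mem hyz) hxy hyz

theorem IsCountableLinearOrder.irrefl' (h : IsCountableLinearOrder (toL2 N) L R) {x : N} :
    pair x x ∉ R := fun hx => h.irrefl x (h.left_mem hx) hx

/-- The set `X` describes the position of `x`: `a + a ∈ X` means `a ≺ x`, and `a + a + 1 ∈ X` means
`a ≼ x`. Since `0` and `1` stand for `-∞` and `∞`, the code `0 + 0` is in and `1 + 1 + 1` is out. An
interval `(a, b)` missing `x` with `a ≺ x` must have `b ≼ x`. -/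
theorem exists_closed_set_of_not_covered (h : IsCountableLinearOrder (toL2 N) L R)
    [InModel R] {J : Set N}
    (hJ : ∀ k a b, pair k (pair a b) ∈ J → b ∈ extendedOrder L) {n x : N} (hx : x ∈ L)
    (hn : ∀ k i, pair k i ∈ J → pair k i < n → x ∉ interval L R i) :
    ∃ X, InModel X ∧ (0 : N) + 0 ∈ X ∧ (1 : N) + 1 + 1 ∉ X ∧ (∀ a, a + a ∈ X → a + a + 1 ∈ X) ∧
      (∀ y z, pair y z ∈ R → finitePoint z + finitePoint z + 1 ∈ X →
        finitePoint y + finitePoint y ∈ X) ∧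
      ∀ k a b, pair k (pair a b) ∈ J → pair k (pair a b) < n → a + a ∈ X → b + b + 1 ∈ X := by
  have hX : InModel {w | (∃ a, a < w + 1 ∧ (w = a + a ∧ BelowPoint R a x)) ∨
    ∃ a, a < w + 1 ∧ (w = a + a + 1 ∧ (BelowPoint R a x ∨ a = finitePoint x))} := inferInstance
  set X : Set N := {w | (∃ a, a < w + 1 ∧ (w = a + a ∧ BelowPoint R a x)) ∨
    ∃ a, a < w + 1 ∧ (w = a + a + 1 ∧ (BelowPoint R a x ∨ a = finitePoint x))} with hXdef
  have h1 : ∀ a, a + a ∈ X ↔ BelowPoint R a x := by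
    intro a
    constructor
    · rintro (⟨a', _, e, h⟩ | ⟨a', _, e, _⟩)
      · rwa [add_self_inj.1 e]
      · exact absurd e (add_self_ne_add_self_add_one _ _)
    · exact fun h => .inl ⟨a, lt_add_one_iff.2 (le_add_self a), rfl, h⟩
  have h2 : ∀ a, a + a + 1 ∈ X ↔ BelowPoint R a x ∨ a = finitePoint x := by
    intro a
    constructor
    · rintro (⟨a', _, e, h⟩ | ⟨a', _, e, h⟩)
      · exact absurd e.symm (add_self_ne_add_self_add_one _ _)
      · rwa [add_self_inj.1 (add_right_cancel e)]
    · exact fun h => .inr ⟨a, lt_add_one_iff.2 ((le_add_self a).trans (lt_add_one_self _).le),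
        rfl, h⟩
  refine ⟨X, hX, (h1 0).2 (.inl rfl), fun h => ?_, fun a ha => (h2 a).2 (.inl ((h1 a).1 ha)),
    fun y z hyz hz => (h1 _).2 (belowPoint_finitePoint.2 ?_), fun k a b hj hlt ha => ?_⟩
  · rcases (h2 1).1 h with (h | ⟨y, h, _⟩) | h
    · exact one_ne_zero h
    · exact finitePoint_ne_one _ h.symm
    · exact finitePoint_ne_one _ h.symm
  · rcases (h2 _).1 hz with hz | hz
    · exact h.trans' hyz (belowPoint_finitePoint.1 hz)
    · rwa [← finitePoint_inj.1 hz]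
  · rw [h1] at ha
    rw [h2]
    by_contra hb
    push Not at hb
    refine hn k _ hj hlt (mem_interval_pair.2 ⟨hx, ha, ?_⟩)
    rcases hJ k a b hj with rfl | rfl | ⟨z, hz, rfl⟩
    · exact absurd (.inl rfl) hb.1
    · exact .inl rfl
    · rw [abovePoint_finitePoint]
      rw [belowPoint_finitePoint] at hb
      rcases h.trichotomy x hx z hz with h' | h' | h'
      · exact h'
      · exact absurd (h' ▸ rfl) hb.2
      · exact absurd h' hb.1

/-- Compactness of complete orders with respect to sequences of intervals, from weak König's
lemma. -/
theorem exists_bound_of_intervals_cover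
    (wkl : ∀ T : Set N, T ∈ sets → IsBinaryTree T → IsInfinite T → ∃ f ∈ sets, IsPath T f)
    (h : IsCountableLinearOrder (toL2 N) L R) (hc : IsCompleteOrder (toL2 N) L R)
    {J : Set N} [hJ' : InModel J] (hJ : ∀ k a b, pair k (pair a b) ∈ J → b ∈ extendedOrder L)
    (hcov : ∀ x ∈ L, ∃ k i, pair k i ∈ J ∧ x ∈ interval L R i) :
    ∃ n, ∀ x ∈ L, ∃ k i, pair k i ∈ J ∧ pair k i < n ∧ x ∈ interval L R i := by
  by_contra! hn
  have hL : InModel L := ⟨h.carrier_mem⟩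
  have hR : InModel R := ⟨h.rel_mem⟩
  -- The index `j` carries the element of `J` responsible for an implication of the third kind. That
  -- an interval occurs in `J` with some index is only `Σ⁰₁`; with its witness recorded, the system
  -- is a set.
  let E : Set N := {e | ∃ j, j < e + 1 ∧ ∃ p, p < e + 1 ∧ ∃ q, q < e + 1 ∧
    (e = pair j (pair p q) ∧ ((∃ a, a < p + 1 ∧ (p = a + a ∧ q = a + a + 1)) ∨
      (∃ y, y < q ∧ ∃ z, z < p ∧ (pair y z ∈ R ∧ p = finitePoint z + finitePoint z + 1 ∧
        q = finitePoint y + finitePoint y)) ∨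
      ∃ k, k < j + 1 ∧ ∃ a, a < j + 1 ∧ ∃ b, b < j + 1 ∧ (j = pair k (pair a b) ∧ j ∈ J ∧
        p = a + a ∧ q = b + b + 1)))}
  have hE : InModel E := InModel.setOf
  have bounds : ∀ j a b : N, j < pair j (pair a b) + 1 ∧ a < pair j (pair a b) + 1 ∧
      b < pair j (pair a b) + 1 := fun j a b => by
    simp only [lt_add_one_iff]
    exact ⟨left_le_pair _ _, (left_le_pair _ _).trans (right_le_pair _ _),
      (right_le_pair _ _).trans (right_le_pair _ _)⟩
  obtain ⟨X, hX, hu, hv, hXE⟩ := exists_closed_set wkl (E := E) (0 + 0) (1 + 1 + 1) (fun n => by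
    obtain ⟨x, hx, hxn⟩ := hn n
    obtain ⟨X, hX, hu, hv, h1, h2, h3⟩ := exists_closed_set_of_not_covered h hJ hx hxn
    refine ⟨X, hX, hu, hv, fun j p q hE' hlt hp => ?_⟩
    obtain ⟨j', _, p', _, q', _, e, hE'⟩ := hE'
    obtain ⟨rfl, e'⟩ := pair_inj.1 e
    obtain ⟨rfl, rfl⟩ := pair_inj.1 e'
    rcases hE' with ⟨a, _, rfl, rfl⟩ | ⟨y, _, z, _, hyz, rfl, rfl⟩ |
      ⟨k, _, a, _, b, _, rfl, hj, rfl, rfl⟩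
    · exact h1 a hp
    · exact h2 y z hyz hp
    · exact h3 k a b hj ((left_le_pair _ _).trans_lt hlt) hp)
  have h1 : ∀ a, a + a ∈ X → a + a + 1 ∈ X := fun a => hXE 0 _ _
    ⟨0, (bounds _ _ _).1, _, (bounds _ _ _).2.1, _, (bounds _ _ _).2.2, rfl,
      .inl ⟨a, lt_add_one_iff.2 (le_add_self a), rfl, rfl⟩⟩
  have h2 : ∀ y z, pair y z ∈ R → finitePoint z + finitePoint z + 1 ∈ X →
      finitePoint y + finitePoint y ∈ X := fun y z hyz => hXE 0 _ _
    ⟨0, (bounds _ _ _).1, _, (bounds _ _ _).2.1, _, (bounds _ _ _).2.2, rfl,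
      .inr (.inl ⟨y, (lt_finitePoint y).trans_le (le_add_self _), z,
        ((lt_finitePoint z).trans_le (le_add_self _)).trans (lt_add_one_self _), hyz, rfl, rfl⟩)⟩
  have h3 : ∀ k a b, pair k (pair a b) ∈ J → a + a ∈ X → b + b + 1 ∈ X := fun k a b hj =>
    hXE (pair k (pair a b)) _ _
    ⟨_, (bounds _ _ _).1, _, (bounds _ _ _).2.1, _, (bounds _ _ _).2.2, rfl,
      .inr (.inr ⟨k, (bounds _ _ _).1, a, (bounds _ _ _).2.1, b, (bounds _ _ _).2.2, rfl, hj, rfl,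
        rfl⟩)⟩
  -- a point below `y` belongs to the lower part of the cut as soon as `y` does
  have below : ∀ a y, BelowPoint R a y → finitePoint y + finitePoint y + 1 ∈ X → a + a ∈ X := by
    rintro a y (rfl | ⟨z, rfl, hz⟩) hy
    · exact hu
    · exact h2 z y hz hy
  have above : ∀ b y, AbovePoint R b y → b + b + 1 ∈ X → finitePoint y + finitePoint y ∈ X := by
    rintro b y (rfl | ⟨z, rfl, hz⟩) hy
    · exact absurd hy hv
    · exact h2 y z hz hy
  have hA : InModel {y | y ∈ L ∧ finitePoint y + finitePoint y ∈ X} := InModel.setOf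
  have hB : InModel {y | y ∈ L ∧ ¬ finitePoint y + finitePoint y ∈ X} := InModel.setOf
  have hcov' : ∀ y ∈ L, ∃ k a b, pair k (pair a b) ∈ J ∧ BelowPoint R a y ∧ AbovePoint R b y := by
    intro y hy
    obtain ⟨k, i, hj, hi⟩ := hcov y hy
    obtain ⟨_, a, b, rfl, ha, hb⟩ := mem_interval_iff.1 hi
    exact ⟨k, a, b, hj, ha, hb⟩
  -- The ideal point is not an element of `L`: if `y` is weakly below it and lies in the interval
  -- `(a, b)` of `J`, then `a` is strictly below it, hence `b` weakly, hence `y` strictly.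
  have hPQ : ∀ y ∈ L, finitePoint y + finitePoint y + 1 ∈ X → finitePoint y + finitePoint y ∈ X := by
    intro y hy hP
    obtain ⟨k, a, b, hj, ha, hb⟩ := hcov' y hy
    exact above b y hb (h3 k a b hj (below a y ha hP))
  rcases hc _ hA.mem _ hB.mem (by ext y; simp only [Set.mem_union, Set.mem_ofPred_eq]; tauto)
    (fun y hy z hz => by
      rcases h.trichotomy y hy.1 z hz.1 with h' | rfl | h'
      · exact h'
      · exact absurd hy.2 hz.2
      · exact absurd (h2 z y h' (h1 _ hy.2)) hz.2)
    with ⟨y, hy, hmax⟩ | ⟨y, hy, hmin⟩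
  -- The right end of an interval of `J` around the greatest element is again below the ideal point,
  -- so it is neither `∞` nor a larger element of `L`.
  · obtain ⟨k, a, b, hj, ha, hb⟩ := hcov' y hy.1
    have hb' := h3 k a b hj (below a y ha (h1 _ hy.2))
    rcases hb with rfl | ⟨z, rfl, hz⟩
    · exact hv hb'
    · rcases hmax z ⟨h.right_mem hz, hPQ z (h.right_mem hz) hb'⟩ with rfl | h'
      · exact h.irrefl' hz
      · exact h.irrefl' (h.trans' hz h')
  -- By minimality of `y`, the left end of an interval of `J` around it is below the ideal point;
  -- then so is the right end, and with it `y`.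
  · obtain ⟨k, a, b, hj, ha, hb⟩ := hcov' y hy.1
    refine hy.2 (above b y hb (h3 k a b hj ?_))
    rcases ha with rfl | ⟨z, rfl, hz⟩
    · exact hu
    · by_contra hzX
      rcases hmin z ⟨h.left_mem hz, hzX⟩ with rfl | h'
      · exact h.irrefl' hz
      · exact h.irrefl' (h.trans' hz h')

/-- Complete orders are compact with respect to honest open covers, from weak König's lemma. -/
theorem isHonestlyCompactSpace_of_wkl
    (wkl : ∀ T : Set N, T ∈ sets → IsBinaryTree T → IsInfinite T → ∃ f ∈ sets, IsPath T f)
    (h : IsCountableLinearOrder (toL2 N) L R) (hc : IsCompleteOrder (toL2 N) L R) :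
    IsHonestlyCompactSpace (toL2 N) L (intervalIndices L) (interval L R) := by
  rintro e ⟨_, _, _, hcov⟩ ⟨g, hg, hgf, hge⟩
  have hg' : InModel g := ⟨hg⟩
  -- The index of each interval retains its place `c = ⟨m, l⟩` in the cover, so a bound on elements
  -- of `J` also bounds `m`.
  let J : Set N := {j | ∃ c, c < j + 1 ∧ ∃ e, e < j + 1 ∧ ∃ i, i < j + 1 ∧
    (j = pair (pair c e) i ∧ pair c e ∈ g ∧ FinMem i e)}
  have hJ : InModel J := InModel.setOf
  have mem_J : ∀ c e i, pair (pair c e) i ∈ J ↔ pair c e ∈ g ∧ FinMem i e := by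
    intro c e i
    constructor
    · rintro ⟨c', _, e', _, i', _, h, h'⟩
      obtain ⟨h1, rfl⟩ := pair_inj.1 h
      obtain ⟨rfl, rfl⟩ := pair_inj.1 h1
      exact h'
    · intro h
      refine ⟨c, ?_, e, ?_, i, ?_, rfl, h⟩
      · exact lt_add_one_iff.2 ((left_le_pair _ _).trans (left_le_pair _ _))
      · exact lt_add_one_iff.2 ((right_le_pair _ _).trans (left_le_pair _ _))
      · exact lt_add_one_iff.2 (right_le_pair _ _)
  obtain ⟨n, hn⟩ := exists_bound_of_intervals_cover wkl h hc (J := J) (by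
    rintro k a b ⟨c, _, e, _, i, _, hk, hg, hi⟩
    obtain ⟨p, hp, e', he', hpe⟩ := hgf.1 _ hg
    obtain ⟨-, rfl⟩ := pair_inj.1 hpe
    obtain ⟨a', _, b', hb', h'⟩ := he'.2 _ hi
    rw [← (pair_inj.1 hk).2] at h'
    exact (pair_inj.1 h').2 ▸ hb') (by
    intro x hx
    obtain ⟨m, hm⟩ := hcov x hx
    rw [hge] at hm
    obtain ⟨n, e, i, hg, hi, hxi⟩ := hm
    exact ⟨_, _, (mem_J _ _ _).2 ⟨hg, hi⟩, hxi⟩)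
  refine ⟨n, fun x hx => ?_⟩
  obtain ⟨k, i, hj, hlt, hxi⟩ := hn x hx
  obtain ⟨c, _, e', _, i', _, hk, hg, hi⟩ := id hj
  obtain ⟨rfl, rfl⟩ := pair_inj.1 hk
  obtain ⟨p, ⟨m, l, rfl⟩, e'', he', hpe⟩ := hgf.1 _ hg
  obtain ⟨rfl, rfl⟩ := pair_inj.1 hpe
  refine ⟨m, lt_of_le_of_lt ?_ hlt, ?_⟩
  · exact ((left_le_pair m l).trans (left_le_pair _ _)).trans (left_le_pair _ _)
  · rw [hge]
    exact ⟨l, _, _, hg, hi, hxi⟩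

end Cover

/-! ### Compactness for arbitrary covers from `Σ⁰₁` comprehension -/

section Sigma1Comprehension

variable {L R : Set N}

theorem abovePoint_of_le (h : IsCountableLinearOrder (toL2 N) L R) {b x y : N}
    (hb : AbovePoint R b x) (hy : y = x ∨ pair y x ∈ R) : AbovePoint R b y := by
  rcases hy with rfl | hy
  · exact hb
  · rcases hb with rfl | ⟨z, rfl, hz⟩
    · exact .inl rfl
    · exact .inr ⟨z, rfl, h.trans' hy hz⟩

/-- Complete orders are compact, from `Σ⁰₁` comprehension. -/
theorem isCompactSpace_of_sigma1_comprehension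
    (sc : ∀ P : N → Prop, Sigma1 (fun v : ℕ → N => P (v 0)) → {x | P x} ∈ sets)
    (h : IsCountableLinearOrder (toL2 N) L R) (hc : IsCompleteOrder (toL2 N) L R) :
    IsCompactSpace (toL2 N) L (intervalIndices L) (interval L R) := by
  rintro f ⟨hf, -, hopen, hcov⟩
  have hL : InModel L := ⟨h.carrier_mem⟩
  have hR : InModel R := ⟨h.rel_mem⟩
  have hf' : InModel f := ⟨hf⟩
  -- the pairs `(m, x)` such that `x` belongs to the `m`-th set
  let W : Set N := {w | ∃ m x n e, w = pair m x ∧ pair (pair m n) e ∈ f ∧ FinMem x e}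
  have hW : InModel W := ⟨sc _ inferInstance⟩
  have mem_W : ∀ m x, pair m x ∈ W ↔ x ∈ enumSet f m := by
    intro m x
    constructor
    · rintro ⟨m', x', n, e, hw, h⟩
      obtain ⟨rfl, rfl⟩ := pair_inj.1 hw
      exact ⟨n, e, h⟩
    · rintro ⟨n, e, h⟩
      exact ⟨m, x, n, e, rfl, h⟩
  -- the pairs `(m, i)` such that the `i`-th interval is not contained in the `m`-th set
  let J : Set N := {w | ∃ m i x, w = pair m i ∧ x ∈ interval L R i ∧ ¬ pair m x ∈ W}
  have hJ : InModel J := ⟨sc _ inferInstance⟩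
  have mem_J : ∀ m i, pair m i ∉ J → ∀ x ∈ interval L R i, x ∈ enumSet f m := by
    intro m i hJ x hx
    by_contra hm
    exact hJ ⟨m, i, x, rfl, hx, fun h => hm ((mem_W m x).1 h)⟩
  let Cov : N → N → Prop := fun n y =>
    ∃ m, m < n ∧ ∃ i, i < n ∧ (¬ pair m i ∈ J ∧ y ∈ interval L R i)
  have Cov.mono : ∀ {n n' y}, n ≤ n' → Cov n y → Cov n' y :=
    fun hn ⟨m, hm, i, hi, h⟩ => ⟨m, hm.trans_le hn, i, hi.trans_le hn, h⟩
  -- Failure of the first `n` intervals to cover everything up to `x` is the `Σ⁰₁` side; its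
  -- complement is then available as a set as well.
  let U : Set N := {w | ∃ n x y, w = pair n x ∧ (y = x ∨ pair y x ∈ R) ∧ ¬ Cov n y}
  have hU : InModel U := ⟨sc _ (by simp only [Cov]; infer_instance)⟩
  have mem_U : ∀ n x, pair n x ∉ U ↔ ∀ y, y = x ∨ pair y x ∈ R → Cov n y := by
    intro n x
    constructor
    · intro h y hy
      by_contra hn
      exact h ⟨n, x, y, rfl, hy, hn⟩
    · rintro h ⟨n', x', y, hw, hy, hn⟩
      obtain ⟨rfl, rfl⟩ := pair_inj.1 hw
      exact hn (h y hy)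
  -- The points up to and including which finitely many intervals suffice.
  let A : Set N := {x | x ∈ L ∧ ∃ n, ¬ pair n x ∈ U}
  have hA : InModel A := ⟨sc _ inferInstance⟩
  have hB : InModel {x | x ∈ L ∧ ¬ x ∈ A} := InModel.setOf
  have hcov' : ∀ x ∈ L, ∃ m a b, ¬ pair m (pair a b) ∈ J ∧ BelowPoint R a x ∧
      AbovePoint R b x := by
    intro x hx
    obtain ⟨m, hm⟩ := hcov x hx
    obtain ⟨g, _, _, hg⟩ := hopen m
    have hx' := hm
    rw [hg] at hx'
    obtain ⟨n, e, i, hne, hi, hxi⟩ := hx'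
    obtain ⟨_, a, b, rfl, ha, hb⟩ := mem_interval_iff.1 hxi
    refine ⟨m, a, b, ?_, ha, hb⟩
    rintro ⟨m', i', y, hw, hy, hy'⟩
    obtain ⟨rfl, rfl⟩ := pair_inj.1 hw
    refine hy' ((mem_W _ _).2 ?_)
    rw [hg]
    exact ⟨n, e, _, hne, hi, hy⟩
  -- One more interval `(a, b)` extends a finite cover of everything up to `a` to everything below
  -- `b`.
  have extend : ∀ m a b, pair m (pair a b) ∉ J → (a = 0 ∨ ∃ z ∈ A, a = finitePoint z) →
      ∃ n, ∀ y ∈ L, AbovePoint R b y → Cov n y := by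
    intro m a b hm ha
    rcases ha with rfl | ⟨z, ⟨hzL, n, hz⟩, rfl⟩
    · refine ⟨m + pair 0 b + 1, fun y hy hby => ⟨m, ?_, pair 0 b, ?_, hm, ?_⟩⟩
      · exact lt_add_one_iff.2 (le_add_of_nonneg_right zero_le)
      · exact lt_add_one_iff.2 (le_add_of_nonneg_left zero_le)
      · exact mem_interval_pair.2 ⟨hy, .inl rfl, hby⟩
    · rw [mem_U] at hz
      refine ⟨n + (m + pair (finitePoint z) b + 1), fun y hy hby => ?_⟩
      rcases h.trichotomy z hzL y hy with h' | h' | h'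
      · refine Cov.mono (le_add_of_nonneg_left zero_le) ⟨m, ?_, pair (finitePoint z) b, ?_, hm, ?_⟩
        · exact lt_add_one_iff.2 (le_add_of_nonneg_right zero_le)
        · exact lt_add_one_iff.2 (le_add_of_nonneg_left zero_le)
        · exact mem_interval_pair.2 ⟨hy, belowPoint_finitePoint.2 h', hby⟩
      · exact Cov.mono (le_add_of_nonneg_right zero_le) (hz y (.inl h'.symm))
      · exact Cov.mono (le_add_of_nonneg_right zero_le) (hz y (.inr h'))
  have mem_A : ∀ x ∈ L, ∀ n, (∀ y, y = x ∨ pair y x ∈ R → Cov n y) → x ∈ A :=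
    fun x hx n hn => ⟨hx, n, (mem_U n x).2 hn⟩
  have down : ∀ x ∈ A, ∀ y, pair y x ∈ R → y ∈ A := by
    rintro x ⟨_, n, hn⟩ y hyx
    rw [mem_U] at hn
    refine mem_A y (h.left_mem hyx) n fun z hz => hn z (.inr ?_)
    rcases hz with rfl | hz
    · exact hyx
    · exact h.trans' hz hyx
  rcases hc A hA.mem _ hB.mem (by
      ext y
      refine ⟨fun hy => ?_, fun hy => hy.elim (fun h => h.1) (fun h => h.1)⟩
      by_cases hyA : y ∈ A
      · exact .inl hyA
      · exact .inr ⟨hy, hyA⟩)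
    (fun x hx y hy => by
      rcases h.trichotomy x hx.1 y hy.1 with h' | rfl | h'
      · exact h'
      · exact absurd hx hy.2
      · exact absurd (down x hx y h') hy.2)
    with ⟨x, hx, hmax⟩ | ⟨x, hx, hmin⟩
  · obtain ⟨m, a, b, hm, ha, hb⟩ := hcov' x hx.1
    obtain ⟨n, hn⟩ := extend m a b hm (ha.imp_right fun ⟨z, hz, hzx⟩ => ⟨z, down x hx z hzx, hz⟩)
    rcases hb with rfl | ⟨z, rfl, hz⟩
    · refine ⟨n, fun y hy => ?_⟩
      obtain ⟨m, hm, i, _, hJ, hi⟩ := hn y hy (.inl rfl)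
      exact ⟨m, hm, mem_J m i hJ y hi⟩
    -- Everything below `z` is finitely covered, and one more interval catches `z` itself, so `z` is
    -- an element of `A` above its greatest element.
    · exfalso
      have hzL := h.right_mem hz
      obtain ⟨m', a', b', hm', ha', hb'⟩ := hcov' z hzL
      have hzA : z ∈ A := by
        refine mem_A z hzL (n + (m' + pair a' b' + 1)) fun y hy => ?_
        rcases hy with rfl | hy
        · refine Cov.mono (le_add_of_nonneg_left zero_le) ⟨m', ?_, pair a' b', ?_, hm', ?_⟩
          · exact lt_add_one_iff.2 (le_add_of_nonneg_right zero_le)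
          · exact lt_add_one_iff.2 (le_add_of_nonneg_left zero_le)
          · exact mem_interval_pair.2 ⟨hzL, ha', hb'⟩
        · exact Cov.mono (le_add_of_nonneg_right zero_le)
            (hn y (h.left_mem hy) (abovePoint_finitePoint.2 hy))
      rcases hmax z hzA with rfl | h'
      · exact h.irrefl' hz
      · exact h.irrefl' (h.trans' hz h')
  · exfalso
    obtain ⟨m, a, b, hm, ha, hb⟩ := hcov' x hx.1
    obtain ⟨n, hn⟩ := extend m a b hm (ha.imp_right fun ⟨z, hz, hzx⟩ => ⟨z, by
      by_contra hzA
      rcases hmin z ⟨h.left_mem hzx, hzA⟩ with rfl | h'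
      · exact h.irrefl' hzx
      · exact h.irrefl' (h.trans' hzx h'), hz⟩)
    refine hx.2 (mem_A x hx.1 n fun y hy => hn y ?_ (abovePoint_of_le h hb hy))
    rcases hy with rfl | hy
    · exact hx.1
    · exact h.left_mem hy

theorem sigma1_comprehension_of_arith (ac : ArithComprehension (toL2 N)) (P : N → Prop)
    (hP : Sigma1 (fun v : ℕ → N => P (v 0))) : {x | P x} ∈ sets := by
  obtain ⟨θ, _, V, hV, v, h⟩ := hP.exists_formula (fun _ => 0)
  obtain ⟨X, hX, hX'⟩ := ac (.ex θ) V hV v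
  rwa [show {x | P x} = X from Set.ext fun n => ((h n).trans (hX' n).symm)]

/-! ## Arithmetical comprehension from `Σ⁰₁` comprehension -/

theorem NumTerm.exists_support (t : NumTerm) :
    ∃ K, ∀ v w : ℕ → N, (∀ i, i < K → v i = w i) → t.val v = t.val w := by
  induction t with
  | var i => exact ⟨i + 1, fun v w h => h i (Nat.lt_succ_self i)⟩
  | zero => exact ⟨0, fun _ _ _ => rfl⟩
  | one => exact ⟨0, fun _ _ _ => rfl⟩
  | add s t hs ht | mul s t hs ht =>
    obtain ⟨K, hK⟩ := hs
    obtain ⟨K', hK'⟩ := ht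
    refine ⟨max K K', fun v w h => ?_⟩
    simp only [NumTerm.val]
    rw [hK v w fun i hi => h i (lt_max_of_lt_left hi),
      hK' v w fun i hi => h i (lt_max_of_lt_right hi)]

theorem push_eq_push {K : ℕ} {v w : ℕ → N} (h : ∀ i, i < K → v i = w i) (x : N) (i : ℕ)
    (hi : i < K) : push x v i = push x w i := by
  cases i with
  | zero => rfl
  | succ i => exact h i (Nat.lt_of_succ_lt hi)

/-- The support is a standard natural number, which allows the contraction of variables by induction
in the metatheory. -/
theorem ArithFormula.exists_support (V : ℕ → Set N) (φ : ArithFormula) :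
    ∃ K, ∀ v w : ℕ → N, (∀ i, i < K → v i = w i) → (φ.Sat V v ↔ φ.Sat V w) := by
  induction φ with
  | eq s t | lt s t =>
    obtain ⟨K, hK⟩ := s.exists_support (N := N)
    obtain ⟨K', hK'⟩ := t.exists_support (N := N)
    refine ⟨max K K', fun v w h => ?_⟩
    simp only [ArithFormula.Sat]
    rw [hK v w fun i hi => h i (lt_max_of_lt_left hi),
      hK' v w fun i hi => h i (lt_max_of_lt_right hi)]
  | mem t X =>
    obtain ⟨K, hK⟩ := t.exists_support (N := N)
    exact ⟨K, fun v w h => by simp only [ArithFormula.Sat, hK v w h]⟩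
  | neg φ hφ =>
    obtain ⟨K, hK⟩ := hφ
    exact ⟨K, fun v w h => by simp only [ArithFormula.Sat, hK v w h]⟩
  | and φ ψ hφ hψ | or φ ψ hφ hψ | imp φ ψ hφ hψ =>
    obtain ⟨K, hK⟩ := hφ
    obtain ⟨K', hK'⟩ := hψ
    refine ⟨max K K', fun v w h => ?_⟩
    simp only [ArithFormula.Sat]
    rw [hK v w fun i hi => h i (lt_max_of_lt_left hi),
      hK' v w fun i hi => h i (lt_max_of_lt_right hi)]
  | ball t φ hφ | bex t φ hφ =>
    obtain ⟨K, hK⟩ := t.exists_support (N := N)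
    obtain ⟨K', hK'⟩ := hφ
    refine ⟨max K K', fun v w h => ?_⟩
    simp only [ArithFormula.Sat]
    have h' := fun x => hK' (push x v) (push x w)
      (push_eq_push (fun i hi => h i (lt_max_of_lt_right hi)) x)
    simp only [hK v w fun i hi => h i (lt_max_of_lt_left hi), h']
  | all φ hφ | ex φ hφ =>
    obtain ⟨K, hK⟩ := hφ
    refine ⟨K, fun v w h => ?_⟩
    have h' := fun x => hK (push x v) (push x w) (push_eq_push h x)
    simp only [ArithFormula.Sat, h']

theorem Sigma1.exists_support {P : (ℕ → N) → Prop} (hP : Sigma1 P) :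
    ∃ K, ∀ v w : ℕ → N, (∀ i, i < K → v i = w i) → (P v ↔ P w) := by
  obtain ⟨Q, ⟨θ, _, V, _, σ, hθ⟩, hQ⟩ := hP
  obtain ⟨ρ, σ', h⟩ := exists_envOf_push σ
  obtain ⟨K, hK⟩ := (θ.rename id ρ).exists_support V
  -- the entries of `envOf σ' v` below `K` depend on finitely many entries of `v`
  obtain ⟨K', hK'⟩ : ∃ K', ∀ v w : ℕ → N, (∀ i, i < K' → v i = w i) →
      ∀ i, i < K → envOf σ' v i = envOf σ' w i := by
    clear hK
    induction K with
    | zero => exact ⟨0, fun _ _ _ i hi => absurd hi (Nat.not_lt_zero i)⟩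
    | succ K ih =>
      obtain ⟨K', hK'⟩ := ih
      obtain ⟨K'', hK''⟩ : ∃ K'', ∀ v w : ℕ → N, (∀ i, i < K'' → v i = w i) →
          envOf σ' v K = envOf σ' w K := by
        rcases hσ : σ' K with j | c
        · exact ⟨j + 1, fun v w h => by simpa [envOf, hσ] using h j (Nat.lt_succ_self j)⟩
        · exact ⟨0, fun v w h => by simp [envOf, hσ]⟩
      refine ⟨max K' K'', fun v w h i hi => ?_⟩
      rcases Nat.lt_succ_iff_lt_or_eq.1 hi with hi | rfl
      · exact hK' v w (fun i hi => h i (lt_max_of_lt_left hi)) i hi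
      · exact hK'' v w fun i hi => h i (lt_max_of_lt_right hi)
  refine ⟨K', fun v w hvw => ?_⟩
  rw [hQ, hQ]
  refine exists_congr fun x => ?_
  have := hK (push x (envOf σ' v)) (push x (envOf σ' w)) (push_eq_push (hK' v w hvw) x)
  rwa [ArithFormula.sat_rename, ArithFormula.sat_rename, ← h, ← h, Function.comp_id, hθ, hθ] at this

/-- Comprehension speaks only about unary predicates. Pairing the first two variables lowers the
arity, until one variable is left and the predicate is membership in a set of the model. -/
theorem delta1_of_sigma1_of_support
    (sc : ∀ P : N → Prop, Sigma1 (fun v : ℕ → N => P (v 0)) → {x | P x} ∈ sets) (K : ℕ) :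
    ∀ P : (ℕ → N) → Prop, Sigma1 P →
      (∀ v w : ℕ → N, (∀ i, i < K + 1 → v i = w i) → (P v ↔ P w)) → Delta1 P := by
  induction K with
  | zero =>
    intro P hP hK
    have hP' : Sigma1 (fun v : ℕ → N => P (fun _ => v 0)) := hP.rename fun _ => 0
    have : InModel {x | P (fun _ => x)} := ⟨sc (fun x => P (fun _ => x)) hP'⟩
    have h1 : Delta1 (fun v : ℕ → N => v 0 ∈ {x | P (fun _ => x)}) := inferInstance
    exact h1.congr fun v => hK _ _ fun i hi => by rw [Nat.lt_one_iff.1 hi]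
  | succ K ih =>
    intro P hP hK
    let ρ : ℕ → ℕ := fun i => match i with
      | 0 => 1
      | 1 => 0
      | i + 2 => i + 3
    let ρ' : ℕ → ℕ := fun i => match i with
      | 0 => 0
      | i + 1 => i + 3
    let P' : (ℕ → N) → Prop := fun v => ∃ a b, v 0 = pair a b ∧
      P (push a (push b fun i => v (i + 1)))
    have hP' : Sigma1 P' := by
      have h1 : Sigma1 (fun w : ℕ → N => P (push (w 1) (push (w 0) fun i => w (i + 3)))) :=
        (hP.rename ρ).congr fun w => iff_of_eq (congrArg P (by
          funext i
          rcases i with _ | _ | i <;> rfl))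
      exact Sigma1.ex (hP := Sigma1.ex (hP := Sigma1.and (hP' := h1)))
    have hd : Delta1 P' := by
      refine ih P' hP' fun v w h => exists_congr fun a => exists_congr fun b => ?_
      rw [h 0 (Nat.succ_pos _)]
      refine and_congr_right fun _ => hK _ _ fun i hi => ?_
      rcases i with _ | _ | i
      · rfl
      · rfl
      · exact h (i + 1) (by omega)
    have hd' : Delta1 (fun w : ℕ → N => P' (push (w 0) fun i => w (i + 3))) :=
      (hd.rename ρ').congr fun w => by
        rw [show (fun i => w (ρ' i)) = push (w 0) fun i => w (i + 3) from
          funext fun i => by rcases i with _ | i <;> rfl]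
    refine (Delta1.subst (P := fun v x => P' (push x fun i => v (i + 2)))
      (f := fun v => pair (v 0) (v 1)) inferInstance hd').congr fun v => ?_
    constructor
    · rintro ⟨a, b, hab, h⟩
      obtain ⟨rfl, rfl⟩ := pair_inj.1 hab
      refine (iff_of_eq (congrArg P ?_)).1 h
      funext i
      rcases i with _ | _ | i <;> rfl
    · intro h
      refine ⟨v 0, v 1, rfl, (iff_of_eq (congrArg P ?_)).1 h⟩
      funext i
      rcases i with _ | _ | i <;> rfl

theorem Sigma1.delta1
    (sc : ∀ P : N → Prop, Sigma1 (fun v : ℕ → N => P (v 0)) → {x | P x} ∈ sets)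
    {P : (ℕ → N) → Prop} (hP : Sigma1 P) : Delta1 P := by
  obtain ⟨K, hK⟩ := hP.exists_support
  exact delta1_of_sigma1_of_support sc K P hP fun v w h => hK v w fun i hi => h i (by omega)

theorem NumTerm.delta1Fun (t : NumTerm) : Delta1Fun (fun v : ℕ → N => t.val v) := by
  induction t with
  | var i => exact Delta1Fun.var i
  | zero => exact Delta1Fun.const 0
  | one => exact Delta1Fun.const 1
  | add s t hs ht => exact Delta1Fun.add
  | mul s t hs ht => exact Delta1Fun.mul

theorem push_tail_head (w : ℕ → N) : push (w 0) (fun i => w (i + 1)) = w := by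
  funext i
  cases i <;> rfl

/-- Once `Σ⁰₁` predicates are `Δ⁰₁`, every unbounded quantifier can be absorbed in turn, so the
arithmetical hierarchy collapses by induction on the formula. -/
theorem ArithFormula.delta1
    (sc : ∀ P : N → Prop, Sigma1 (fun v : ℕ → N => P (v 0)) → {x | P x} ∈ sets)
    (V : ℕ → Set N) (hV : ∀ i, V i ∈ sets) (φ : ArithFormula) :
    Delta1 (fun v => φ.Sat V v) := by
  induction φ with
  | eq s t =>
    have := s.delta1Fun (N := N); have := t.delta1Fun (N := N)
    exact Delta1.eq
  | lt s t =>
    have := s.delta1Fun (N := N); have := t.delta1Fun (N := N)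
    exact Delta1.lt
  | mem t X =>
    have := t.delta1Fun (N := N); have : InModel (V X) := ⟨hV X⟩
    exact Delta1.mem
  | neg φ hφ => exact Delta1.not
  | and φ ψ hφ hψ => exact Delta1.and
  | or φ ψ hφ hψ => exact Delta1.or
  | imp φ ψ hφ hψ => exact Delta1.imp
  | ball t φ hφ =>
    have := t.delta1Fun (N := N)
    exact Delta1.ball (hP := hφ.congr fun w => by rw [push_tail_head])
  | bex t φ hφ =>
    have := t.delta1Fun (N := N)
    exact Delta1.bex (hP := hφ.congr fun w => by rw [push_tail_head])
  | all φ hφ =>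
    have h1 : Sigma1 (fun v => ∃ x, ¬ φ.Sat V (push x v)) :=
      Sigma1.ex (hP := hφ.neg.congr fun w => by rw [push_tail_head])
    exact (h1.delta1 sc).not.congr fun v => by simp only [ArithFormula.Sat]; push Not; rfl
  | ex φ hφ =>
    have h1 : Sigma1 (fun v => ∃ x, φ.Sat V (push x v)) :=
      Sigma1.ex (hP := hφ.pos.congr fun w => by rw [push_tail_head])
    exact h1.delta1 sc

theorem arithComprehension_of_sigma1
    (sc : ∀ P : N → Prop, Sigma1 (fun v : ℕ → N => P (v 0)) → {x | P x} ∈ sets) :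
    ArithComprehension (toL2 N) := by
  intro φ V hV v
  have h := φ.delta1 sc V hV
  have h' : Delta1 (fun w : ℕ → N => φ.Sat V (push (w 0) v)) :=
    ⟨h.pos.specialize v, h.neg.specialize v⟩
  have : InModel {n | φ.Sat V (push n v)} := InModel.setOf
  exact ⟨_, this.mem, fun n => Iff.rfl⟩

end Sigma1Comprehension

/-! ## Covers by singletons -/

/-- The bound `x < c + 1` makes each section finite, so the least code of the section at `c = ⟨m,
n⟩` is a legitimate value of the function. -/
theorem exists_finSubsets_function {Q : N → N → Prop}
    [hQ : Delta1 (fun v : ℕ → N => Q (v 0) (v 1))] {C : Set N}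
    (hC : ∀ c x, Q c x → x < c + 1 ∧ x ∈ C) :
    ∃ f ∈ sets, IsFunction allPairs (finSubsets C) f ∧
      ∀ m n x, (∃ e, pair (pair m n) e ∈ f ∧ FinMem x e) ↔ Q (pair m n) x := by
  have hD : ∀ f g : (ℕ → N) → N, [Delta1Fun f] → [Delta1Fun g] → Delta1 (fun v => Q (f v) (g v)) :=
    fun f g _ _ => Delta1.subst₂ hQ f g
  have hD' := hD (fun w => pair (w 3) (w 2)) (fun w => w 0)
  have hcode : ∀ c e, (∀ x, x < e + c + 1 → (FinMem x e ↔ Q c x)) ↔ ∀ x, FinMem x e ↔ Q c x := by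
    refine fun c e => ⟨fun h x => ⟨fun hx => (h x ?_).1 hx, fun hx => (h x ?_).2 hx⟩,
      fun h x _ => h x⟩
    · exact hx.lt.trans (lt_add_one_iff.2 (le_add_of_nonneg_right zero_le))
    · refine (hC c x hx).1.trans_le ?_
      rw [add_assoc]
      exact le_add_of_nonneg_left zero_le
  let f : Set N := {w | ∃ m, m < w + 1 ∧ ∃ n, n < w + 1 ∧ ∃ e, e < w + 1 ∧
    (w = pair (pair m n) e ∧ IsFinCode e ∧
      ∀ x, x < e + pair m n + 1 → (FinMem x e ↔ Q (pair m n) x))}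
  have hf : InModel f := InModel.setOf
  have mem_f : ∀ m n e, pair (pair m n) e ∈ f ↔
      IsFinCode e ∧ ∀ x, FinMem x e ↔ Q (pair m n) x := by
    intro m n e
    constructor
    · rintro ⟨m', _, n', _, e', _, h, h'⟩
      obtain ⟨h1, rfl⟩ := pair_inj.1 h
      obtain ⟨rfl, rfl⟩ := pair_inj.1 h1
      rwa [hcode] at h'
    · intro h
      refine ⟨m, ?_, n, ?_, e, ?_, rfl, by rwa [hcode]⟩
      · exact lt_add_one_iff.2 ((left_le_pair _ _).trans (left_le_pair _ _))
      · exact lt_add_one_iff.2 ((right_le_pair _ _).trans (left_le_pair _ _))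
      · exact lt_add_one_iff.2 (right_le_pair _ _)
  have ex : ∀ c, ∃ e, IsFinCode e ∧ ∀ x, FinMem x e ↔ Q c x := by
    intro c
    have := hD (fun _ => c) (fun w => w 0)
    obtain ⟨e, he, he'⟩ := exists_finCode (P := fun x => Q c x) (c + 1)
    exact ⟨e, he, fun x => (he' x).trans ⟨fun h => h.2, fun h => ⟨(hC c x h).1, h⟩⟩⟩
  refine ⟨f, hf.mem, ⟨?_, ?_⟩, fun m n x => ⟨?_, fun h => ?_⟩⟩
  · intro p hp
    obtain ⟨m, _, n, _, e, _, rfl, _⟩ := id hp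
    obtain ⟨h1, h2⟩ := (mem_f m n e).1 hp
    exact ⟨_, ⟨m, n, rfl⟩, e, ⟨h1, fun x hx => (hC _ x ((h2 x).1 hx)).2⟩, rfl⟩
  · rintro _ ⟨m, n, rfl⟩
    obtain ⟨e, he, he'⟩ := ex (pair m n)
    refine ⟨e, (mem_f m n e).2 ⟨he, he'⟩, fun e' h => ?_⟩
    obtain ⟨h1, h2⟩ := (mem_f m n e').1 h
    exact h1.ext he fun x => (h2 x).trans (he' x).symm
  · rintro ⟨e, he, hx⟩
    exact (((mem_f m n e).1 he).2 x).1 hx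
  · obtain ⟨e, he, he'⟩ := ex (pair m n)
    exact ⟨e, (mem_f m n e).2 ⟨he, he'⟩, (he' x).2 h⟩

/-- Membership is decidable, so the second argument `n` plays no role except to be present: each
value is the singleton or empty according to `m`. -/
theorem exists_singleton_cover (L : Set N) [InModel L] :
    ∃ f ∈ sets, IsFunction allPairs (finSubsets L) f ∧
      ∀ m, enumSet f m = {x | x ∈ L ∧ x = m} := by
  obtain ⟨f, hf, hf1, hf2⟩ := exists_finSubsets_function
    (Q := fun c x => x ∈ L ∧ ∃ n, n < c + 1 ∧ c = pair x n) (C := L) (by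
      rintro c x ⟨hx, n, _, rfl⟩
      exact ⟨lt_add_one_iff.2 (left_le_pair _ _), hx⟩)
  refine ⟨f, hf, hf1, fun m => Set.ext fun x => ?_⟩
  simp only [enumSet, Set.mem_ofPred_eq, hf2]
  constructor
  · rintro ⟨n, hx, n', _, h⟩
    exact ⟨hx, (pair_inj.1 h).1.symm⟩
  · rintro ⟨hx, rfl⟩
    exact ⟨0, hx, 0, lt_of_le_of_lt zero_le (lt_add_one_self _), rfl⟩

/-- A `Σ⁰₁` class is the projection of a set. -/
theorem Sigma1.exists_projection {P : N → Prop} (hP : Sigma1 (fun v : ℕ → N => P (v 0))) :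
    ∃ G : Set N, InModel G ∧ ∀ y, P y ↔ ∃ w, pair y w ∈ G := by
  obtain ⟨Q, hQ, hPQ⟩ := hP
  have hD : Delta1 (fun w : ℕ → N => Q (push (w 0) (push (w 1) fun _ => 0))) :=
    (hQ.specialize fun _ => 0).delta1
  refine ⟨{p | ∃ y, y < p + 1 ∧ ∃ w, w < p + 1 ∧ (p = pair y w ∧
    Q (push w (push y fun _ => 0)))}, InModel.setOf, fun y => ?_⟩
  rw [show P y ↔ ∃ w, Q (push w (push y fun _ => 0)) from hPQ (push y fun _ => 0)]
  refine exists_congr fun w => ⟨fun h => ⟨y, lt_add_one_iff.2 (left_le_pair _ _), w,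
    lt_add_one_iff.2 (right_le_pair _ _), rfl, h⟩, ?_⟩
  rintro ⟨y', _, w', _, e, h⟩
  obtain ⟨rfl, rfl⟩ := pair_inj.1 e
  exact h

theorem isOpenIn_of_finCode {I : Set N} {U : N → Set N} {e : N} (he : e ∈ finSubsets I) :
    IsOpenIn (toL2 N) I U {x | ∃ i, FinMem i e ∧ x ∈ U i} := by
  have hg : InModel {w | ∃ n, n < w + 1 ∧ w = pair n e} := inferInstance
  have mem_g : ∀ n e', pair n e' ∈ {w | ∃ n, n < w + 1 ∧ w = pair n e} ↔ e' = e := by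
    intro n e'
    constructor
    · rintro ⟨n', _, h⟩
      exact (pair_inj.1 h).2
    · rintro rfl
      exact ⟨n, lt_add_one_iff.2 (left_le_pair _ _), rfl⟩
  refine ⟨_, hg.mem, ⟨?_, fun n _ => ⟨e, (mem_g n e).2 rfl, fun e' h => (mem_g n e').1 h⟩⟩, ?_⟩
  · rintro p ⟨n, _, rfl⟩
    exact ⟨n, trivial, e, he, rfl⟩
  · ext x
    constructor
    · rintro ⟨i, hi, hx⟩
      exact ⟨0, e, i, (mem_g 0 e).2 rfl, hi, hx⟩
    · rintro ⟨n, e', i, h, hi, hx⟩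
      rw [(mem_g n e').1 h] at hi
      exact ⟨i, hi, hx⟩

/-! ### Orders with isolated points -/

section Discrete

variable {L R : Set N}

theorem interval_eq_singleton (h : IsCountableLinearOrder (toL2 N) L R) {a b m : N} (hm : m ∈ L)
    (ha : BelowPoint R a m) (ha' : ∀ q, pair q m ∈ R → ¬ BelowPoint R a q)
    (hb : AbovePoint R b m) (hb' : ∀ q, pair m q ∈ R → ¬ AbovePoint R b q) :
    interval L R (pair a b) = {x | x ∈ L ∧ x = m} := by
  ext x
  rw [mem_interval_pair]
  refine and_congr_right fun hx => ⟨fun hab => ?_, fun e => e ▸ ⟨ha, hb⟩⟩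
  rcases h.trichotomy x hx m hm with h' | h' | h'
  · exact absurd hab.1 (ha' x h')
  · exact h'
  · exact absurd hab.2 (hb' x h')

theorem pair_mem_intervalIndices (h : IsCountableLinearOrder (toL2 N) L R) {a b m : N}
    (ha : BelowPoint R a m) (hb : AbovePoint R b m) : pair a b ∈ intervalIndices L :=
  ⟨a, ha.imp_right fun ⟨y, hy, hym⟩ => .inr ⟨y, h.left_mem hym, hy⟩, b,
    .inr (hb.imp_right fun ⟨y, hy, hym⟩ => ⟨y, h.right_mem hym, hy⟩), rfl⟩

/-- A bounded set has a greatest element with respect to a linear order. -/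
theorem exists_max_of_bounded {R X : Set N} [InModel R] [InModel X]
    (trans : ∀ x ∈ X, ∀ y ∈ X, ∀ z ∈ X, pair x y ∈ R → pair y z ∈ R → pair x z ∈ R)
    (total : ∀ x ∈ X, ∀ y ∈ X, pair x y ∈ R ∨ x = y ∨ pair y x ∈ R) {a b : N} (ha : a ∈ X)
    (hb : ∀ x ∈ X, x < b) : ∃ x ∈ X, ∀ y ∈ X, y = x ∨ pair y x ∈ R := by
  have key : ∀ n : N, (∃ a, a < n ∧ a ∈ X) →
      ∃ x, x < n ∧ (x ∈ X ∧ ∀ y, y < n → y ∈ X → (y = x ∨ pair y x ∈ R)) := by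
    refine sigma1_induction (fun ⟨a, ha, _⟩ => absurd ha (not_lt.2 zero_le)) fun n ih _ => ?_
    by_cases hn : ∃ a, a < n ∧ a ∈ X
    · obtain ⟨x, hxn, hx, hmax⟩ := ih hn
      by_cases hnX : n ∈ X ∧ pair x n ∈ R
      · refine ⟨n, lt_add_one_self n, hnX.1, fun y hy hyX => ?_⟩
        rcases (lt_add_one_iff.1 hy).lt_or_eq with hy | rfl
        · rcases hmax y hy hyX with rfl | h
          · exact .inr hnX.2
          · exact .inr (trans y hyX x hx n hnX.1 h hnX.2)
        · exact .inl rfl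
      · refine ⟨x, hxn.trans (lt_add_one_self n), hx, fun y hy hyX => ?_⟩
        rcases (lt_add_one_iff.1 hy).lt_or_eq with hy | rfl
        · exact hmax y hy hyX
        · rcases total y hyX x hx with h | h | h
          · exact .inr h
          · exact .inl h
          · exact absurd ⟨hyX, h⟩ hnX
    · rename_i h
      obtain ⟨a, ha, haX⟩ := h
      rcases (lt_add_one_iff.1 ha).lt_or_eq with ha | rfl
      · exact absurd ⟨a, ha, haX⟩ hn
      · refine ⟨a, lt_add_one_self a, haX, fun y hy hyX => ?_⟩
        rcases (lt_add_one_iff.1 hy).lt_or_eq with hy | rfl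
        · exact absurd ⟨y, hy, hyX⟩ hn
        · exact .inl rfl
  obtain ⟨x, _, hx, hmax⟩ := key b ⟨a, hb a ha, ha⟩
  exact ⟨x, hx, fun y hy => hmax y (hb y hy) hy⟩

theorem IsCountableLinearOrder.exists_max (h : IsCountableLinearOrder (toL2 N) L R) {X : Set N}
    [InModel X] (hX : X ⊆ L) {a b : N} (ha : a ∈ X) (hb : ∀ x ∈ X, x < b) :
    ∃ x ∈ X, ∀ y ∈ X, y = x ∨ pair y x ∈ R := by
  have hR : InModel R := ⟨h.rel_mem⟩
  exact exists_max_of_bounded (fun x _ y _ z _ => h.trans')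
    (fun x hx y hy => h.trichotomy x (hX hx) y (hX hy)) ha hb

/-- The reversed relation is again a set of the model, and a minimum is a maximum for it. -/
theorem IsCountableLinearOrder.exists_min (h : IsCountableLinearOrder (toL2 N) L R) {X : Set N}
    [InModel X] (hX : X ⊆ L) {a b : N} (ha : a ∈ X) (hb : ∀ x ∈ X, x < b) :
    ∃ x ∈ X, ∀ y ∈ X, y = x ∨ pair x y ∈ R := by
  have hR : InModel R := ⟨h.rel_mem⟩
  have hR' : InModel {w | ∃ x, x < w + 1 ∧ ∃ y, y < w + 1 ∧ (w = pair x y ∧ pair y x ∈ R)} :=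
    inferInstance
  have mem_R' : ∀ x y, pair x y ∈ {w | ∃ x, x < w + 1 ∧ ∃ y, y < w + 1 ∧
      (w = pair x y ∧ pair y x ∈ R)} ↔ pair y x ∈ R := by
    intro x y
    constructor
    · rintro ⟨x', _, y', _, e, h⟩
      obtain ⟨rfl, rfl⟩ := pair_inj.1 e
      exact h
    · exact fun h => ⟨x, lt_add_one_iff.2 (left_le_pair _ _), y,
        lt_add_one_iff.2 (right_le_pair _ _), rfl, h⟩
  obtain ⟨x, hx, hmax⟩ := exists_max_of_bounded (R := {w | ∃ x, x < w + 1 ∧ ∃ y, y < w + 1 ∧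
    (w = pair x y ∧ pair y x ∈ R)}) (X := X)
    (fun x _ y _ z _ hxy hyz => (mem_R' x z).2 (h.trans' ((mem_R' y z).1 hyz) ((mem_R' x y).1 hxy)))
    (fun x hx y hy => by
      rw [mem_R', mem_R']
      rcases h.trichotomy y (hX hy) x (hX hx) with h' | h' | h'
      exacts [.inl h', .inr (.inl h'.symm), .inr (.inr h')]) ha hb
  exact ⟨x, hx, fun y hy => (hmax y hy).imp_right (mem_R' y x).1⟩

/-- An order in which all points are isolated is bounded as a set if it is compact. -/
theorem exists_bound_of_isCompactSpace (h : IsCountableLinearOrder (toL2 N) L R)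
    (hc : IsCompactSpace (toL2 N) L (intervalIndices L) (interval L R))
    (hpred : ∀ m ∈ L, ∃ a, BelowPoint R a m ∧ ∀ q, pair q m ∈ R → ¬ BelowPoint R a q)
    (hsucc : ∀ m ∈ L, ∃ b, AbovePoint R b m ∧ ∀ q, pair m q ∈ R → ¬ AbovePoint R b q) :
    ∃ n, ∀ x ∈ L, x < n := by
  have hL : InModel L := ⟨h.carrier_mem⟩
  obtain ⟨f, hf, hf1, hf2⟩ := exists_singleton_cover L
  -- The code of each singleton is chosen separately for each `m`; nothing makes the neighbours `a`
  -- and `b` uniform in `m`, so the cover need not be honest.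
  have hopen : ∀ m, IsOpenIn (toL2 N) (intervalIndices L) (interval L R) (enumSet f m) := by
    intro m
    by_cases hm : m ∈ L
    · obtain ⟨a, ha, ha'⟩ := hpred m hm
      obtain ⟨b, hb, hb'⟩ := hsucc m hm
      obtain ⟨e, he, he'⟩ := exists_finCode (P := fun i => i = pair a b) (pair a b + 1)
      have := isOpenIn_of_finCode (I := intervalIndices L) (U := interval L R) (e := e)
        ⟨he, fun x hx => ((he' x).1 hx).2 ▸ pair_mem_intervalIndices h ha hb⟩
      convert this using 1
      rw [hf2, ← interval_eq_singleton h hm ha ha' hb hb']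
      ext x
      constructor
      · exact fun hx => ⟨_, (he' _).2 ⟨lt_add_one_self _, rfl⟩, hx⟩
      · rintro ⟨i, hi, hx⟩
        rwa [((he' i).1 hi).2] at hx
    · obtain ⟨e, he, he'⟩ := exists_finCode (P := fun _ : N => False) 0
      have := isOpenIn_of_finCode (I := intervalIndices L) (U := interval L R) (e := e)
        ⟨he, fun x hx => ((he' x).1 hx).2.elim⟩
      convert this using 1
      rw [hf2]
      ext x
      constructor
      · rintro ⟨hx, rfl⟩
        exact absurd hx hm
      · rintro ⟨i, hi, _⟩
        exact ((he' i).1 hi).2.elim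
  obtain ⟨n, hn⟩ := hc f ⟨hf, hf1, hopen, fun x hx => ⟨x, by rw [hf2]; exact ⟨hx, rfl⟩⟩⟩
  refine ⟨n, fun x hx => ?_⟩
  obtain ⟨m, hm, hxm⟩ := hn x hx
  rw [hf2] at hxm
  exact hxm.2 ▸ hm

end Discrete

/-! ## The order of true stages -/

open Classical in
/-- The first component of a pair. -/
noncomputable def pairFst (p : N) : N := if h : ∃ x y, p = pair x y then h.choose else 0

theorem pairFst_pair (x y : N) : pairFst (pair x y) = x := by
  have h : ∃ x' y', pair x y = pair x' y' := ⟨x, y, rfl⟩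
  rw [pairFst, dif_pos h]
  exact (pair_inj.1 h.choose_spec.choose_spec).1.symm

instance delta1Fun_pairFst {f : (ℕ → N) → N} [Delta1Fun f] :
    Delta1Fun (fun v => pairFst (f v)) := by
  refine Delta1Fun.of_graph₁ ?_ f
  have : ∀ p x : N, pairFst p = x ↔ (∃ y, y < p + 1 ∧ p = pair x y) ∨
      (x = 0 ∧ ¬ ∃ a, a < p + 1 ∧ ∃ b, b < p + 1 ∧ p = pair a b) := by
    intro p x
    by_cases hp : ∃ a b, p = pair a b
    · obtain ⟨a, b, rfl⟩ := hp
      rw [pairFst_pair]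
      constructor
      · rintro rfl
        exact .inl ⟨b, lt_add_one_iff.2 (right_le_pair _ _), rfl⟩
      · rintro (⟨y, _, h⟩ | ⟨_, h⟩)
        · exact (pair_inj.1 h).1
        · exact absurd ⟨a, lt_add_one_iff.2 (left_le_pair _ _), b,
            lt_add_one_iff.2 (right_le_pair _ _), rfl⟩ h
    · rw [pairFst, dif_neg hp]
      constructor
      · rintro rfl
        exact .inr ⟨rfl, fun ⟨a, _, b, _, h⟩ => hp ⟨a, b, h⟩⟩
      · rintro (⟨y, _, h⟩ | ⟨h, _⟩)
        · exact absurd ⟨_, _, h⟩ hp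
        · exact h.symm
  simp only [this]
  infer_instance

section TrueStages

variable (L : Set N)

/-- Stage `p` looks true at stage `q`. -/
def LooksTrue (p q : N) : Prop := ∀ r, r < q + 1 → r ∈ L → p < r → pairFst p < pairFst r

instance Delta1.looksTrue [InModel L] {f g : (ℕ → N) → N} [Delta1Fun f] [Delta1Fun g] :
    Delta1 (fun v => LooksTrue L (f v) (g v)) := by
  refine Delta1.subst₂ (P := fun p q => LooksTrue L p q) ?_ f g
  simp only [LooksTrue]
  infer_instance

/-- Stage `p` is true. -/
def IsTrueStage (p : N) : Prop := p ∈ L ∧ ∀ r ∈ L, p < r → pairFst p < pairFst r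

/-- Stages that turn out to be false are placed below, and true stages above the later ones. -/
def StageLT (p q : N) : Prop := (p < q ∧ ¬ LooksTrue L p q) ∨ (q < p ∧ LooksTrue L q p)

instance Delta1.stageLT [InModel L] {f g : (ℕ → N) → N} [Delta1Fun f] [Delta1Fun g] :
    Delta1 (fun v => StageLT L (f v) (g v)) := by
  refine Delta1.subst₂ (P := fun p q => StageLT L p q) ?_ f g
  simp only [StageLT]
  infer_instance

/-- The relation `StageLT` on `L`. -/
def stageOrder : Set N := {w | ∃ p, p < w + 1 ∧ ∃ q, q < w + 1 ∧ (w = pair p q ∧ p ∈ L ∧ q ∈ L ∧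
  StageLT L p q)}

instance InModel.stageOrder [InModel L] : InModel (stageOrder L) := InModel.setOf

variable {L}

theorem pair_mem_stageOrder {p q : N} :
    pair p q ∈ stageOrder L ↔ p ∈ L ∧ q ∈ L ∧ StageLT L p q := by
  constructor
  · rintro ⟨p', _, q', _, e, h⟩
    obtain ⟨rfl, rfl⟩ := pair_inj.1 e
    exact h
  · exact fun h => ⟨p, lt_add_one_iff.2 (left_le_pair _ _), q,
      lt_add_one_iff.2 (right_le_pair _ _), rfl, h⟩

theorem LooksTrue.mono {p q r : N} (h : LooksTrue L p r) (hqr : q ≤ r) : LooksTrue L p q :=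
  fun s hs => h s (hs.trans_le (add_le_add_left hqr 1))

theorem LooksTrue.trans {p q r : N} (hq : q ∈ L) (hpq : p < q) (h : LooksTrue L p q)
    (h' : LooksTrue L q r) : LooksTrue L p r := by
  intro s hs hsL hps
  rcases le_or_gt s q with hsq | hsq
  · exact h s (lt_add_one_iff.2 hsq) hsL hps
  · exact (h q (lt_add_one_self q) hq hpq).trans (h' s hs hsL hsq)

theorem StageLT.trans {p q r : N} (hp : p ∈ L) (hq : q ∈ L) (hr : r ∈ L)
    (h : StageLT L p q) (h' : StageLT L q r) : StageLT L p r := by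
  rcases h with ⟨hpq, h⟩ | ⟨hpq, h⟩ <;> rcases h' with ⟨hqr, h'⟩ | ⟨hqr, h'⟩
  · exact .inl ⟨hpq.trans hqr, fun ht => h (ht.mono hqr.le)⟩
  · rcases lt_trichotomy p r with hpr | rfl | hpr
    · exact .inl ⟨hpr, fun ht => h (ht.trans hr hpr h')⟩
    · exact absurd h' h
    · exact .inr ⟨hpr, h'.mono hpq.le⟩
  · rcases lt_trichotomy p r with hpr | rfl | hpr
    · exact .inl ⟨hpr, fun ht => h' (h.trans hp hpq ht)⟩
    · exact absurd h h'
    · exact absurd (h.mono hpr.le) h'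
  · exact .inr ⟨hqr.trans hpq, h'.trans hq hqr h⟩

theorem stageOrder_isCountableLinearOrder [hL : InModel L] :
    IsCountableLinearOrder (toL2 N) L (stageOrder L) where
  carrier_mem := hL.mem
  rel_mem := (InModel.stageOrder L).mem
  rel_subset := fun _ ⟨x, _, y, _, e, hx, hy, _⟩ => ⟨x, hx, y, hy, e⟩
  irrefl := fun x _ h => by
    rcases (pair_mem_stageOrder.1 h).2.2 with ⟨h, _⟩ | ⟨h, _⟩ <;> exact lt_irrefl _ h
  trans := fun x hx y hy z hz hxy hyz => pair_mem_stageOrder.2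
    ⟨hx, hz, (pair_mem_stageOrder.1 hxy).2.2.trans hx hy hz (pair_mem_stageOrder.1 hyz).2.2⟩
  trichotomy := fun x hx y hy => by
    simp only [pair_mem_stageOrder, hx, hy, true_and, StageLT]
    rcases lt_trichotomy x y with h | h | h
    · by_cases ht : LooksTrue L x y
      · exact .inr (.inr (.inr ⟨h, ht⟩))
      · exact .inl (.inl ⟨h, ht⟩)
    · exact .inr (.inl h)
    · by_cases ht : LooksTrue L y x
      · exact .inl (.inr ⟨h, ht⟩)
      · exact .inr (.inr (.inl ⟨h, ht⟩))

theorem IsTrueStage.looksTrue {p : N} (h : IsTrueStage L p) (q : N) : LooksTrue L p q :=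
  fun r _ hr hpr => h.2 r hr hpr

theorem IsTrueStage.lt_of_stageLT {p q : N} (h : IsTrueStage L p) (hpq : StageLT L p q) :
    q < p := by
  rcases hpq with ⟨_, h'⟩ | ⟨h', _⟩
  · exact absurd (h.looksTrue q) h'
  · exact h'

/-- Some later stage `r` enumerates a smaller value and exposes `p` as false. From `r` on, `p` no
longer looks true, so such stages are placed above `p`. -/
theorem exists_bound_of_not_isTrueStage
    (inj : ∀ p ∈ L, ∀ q ∈ L, pairFst p = pairFst q → p = q) {p : N} (hp : p ∈ L)
    (h : ¬ IsTrueStage L p) :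
    ∃ r ∈ L, p < r ∧ pairFst r < pairFst p ∧ ∀ q, StageLT L q p → q < r := by
  simp only [IsTrueStage, hp, true_and] at h
  push Not at h
  obtain ⟨r, hr, hpr, hle⟩ := h
  have hlt : pairFst r < pairFst p := lt_of_le_of_ne hle fun e => hpr.ne' (inj r hr p hp e)
  refine ⟨r, hr, hpr, hlt, fun q hq => ?_⟩
  by_contra! hrq
  rcases hq with ⟨h', _⟩ | ⟨_, h'⟩
  · exact absurd (h'.trans hpr) (not_lt.2 hrq)
  · exact absurd (h' r (lt_add_one_iff.2 hrq) hr hpr) (not_lt.2 hle)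

/-- Otherwise `p` comes before `q` in number and looks true at `q`, while the stage `r` exposing `p`
comes after `q`. The value at `q` is then above that at `p` and below that at `r`, but the value at
`r` is below that at `p`. -/
theorem stageLT_of_isTrueStage (inj : ∀ p ∈ L, ∀ q ∈ L, pairFst p = pairFst q → p = q) {p q : N}
    (hp : p ∈ L) (h : ¬ IsTrueStage L p) (hq : IsTrueStage L q) : StageLT L p q := by
  obtain ⟨r, hr, hpr, hlt, hb⟩ := exists_bound_of_not_isTrueStage inj hp h
  by_contra hpq
  have hqp : StageLT L q p := by
    rcases lt_trichotomy p q with h' | rfl | h'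
    · refine .inr ⟨h', ?_⟩
      by_contra ht
      exact hpq (.inl ⟨h', ht⟩)
    · exact absurd hq h
    · exact absurd (.inr ⟨h', hq.looksTrue p⟩) hpq
  have hqr := hb q hqp
  have hpq' := hq.lt_of_stageLT hqp
  have h1 := hq.2 r hr hqr
  rcases hqp with ⟨h', _⟩ | ⟨_, h'⟩
  · exact absurd hpq' h'.asymm
  · exact absurd ((h' q (lt_add_one_self q) hq.1 hpq').trans h1) hlt.asymm

variable [hL : InModel L] (unbounded : ∀ b, ∃ p ∈ L, b ≤ p)
  (inj : ∀ p ∈ L, ∀ q ∈ L, pairFst p = pairFst q → p = q)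

-- Among the stages from `b` on, the one with the least value is true.
include unbounded inj in
theorem exists_isTrueStage_ge (b : N) : ∃ p, IsTrueStage L p ∧ b ≤ p := by
  obtain ⟨p, hp, hbp⟩ := unbounded b
  obtain ⟨y, ⟨q, hq, hbq, rfl⟩, hmin⟩ := exists_least
    (P := fun y => ∃ p, p ∈ L ∧ b ≤ p ∧ pairFst p = y) ⟨p, hp, hbp, rfl⟩
  refine ⟨q, ⟨hq, fun r hr hqr => ?_⟩, hbq⟩
  rcases lt_trichotomy (pairFst q) (pairFst r) with h | h | h
  · exact h
  · exact absurd (inj q hq r hr h) hqr.ne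
  · exact absurd ⟨r, hr, hbq.trans hqr.le, rfl⟩ (hmin _ h)

include unbounded inj in
/-- The range is computable from the set of true stages. -/
theorem range_mem_of_trueStages_mem (h : {p | IsTrueStage L p} ∈ sets) :
    {y | ∃ p ∈ L, pairFst p = y} ∈ sets := by
  have hTr : InModel {p | IsTrueStage L p} := ⟨h⟩
  set Tr : Set N := {p | IsTrueStage L p} with hTrdef
  have ex : ∀ y : N, ∃ p, p ∈ Tr ∧ y ≤ pairFst p := by
    refine sigma1_induction ?_ fun y ⟨p, hp, hy⟩ => ?_
    · obtain ⟨p, hp, _⟩ := exists_isTrueStage_ge unbounded inj 0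
      exact ⟨p, hp, zero_le⟩
    · obtain ⟨q, hq, hpq⟩ := exists_isTrueStage_ge unbounded inj (p + 1)
      exact ⟨q, hq, add_one_le_iff.2
        (hy.trans_lt (And.right hp q hq.1 (add_one_le_iff.1 hpq)))⟩
  have bound : ∀ p ∈ Tr, ∀ r ∈ L, pairFst r ≤ pairFst p → r < p + 1 := by
    intro p hp r hr hrp
    rw [lt_add_one_iff]
    by_contra! hpr
    exact absurd (And.right hp r hr hpr) (not_lt.2 hrp)
  -- After a true stage `p` only larger values appear, so a number up to the value at `p` that was
  -- not enumerated by then never will be.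
  have neg : Sigma1 (fun v : ℕ → N => ¬ ∃ p ∈ L, pairFst p = v 0) := by
    have h1 : Sigma1 (fun v : ℕ → N => ∃ p, p ∈ Tr ∧ v 0 ≤ pairFst p ∧
      ¬ ∃ r, r < p + 1 ∧ (r ∈ L ∧ pairFst r = v 0)) := inferInstance
    refine h1.congr fun v => ⟨?_, fun h => ?_⟩
    · rintro ⟨p, hp, hy, hr⟩ ⟨r, hrL, hry⟩
      exact hr ⟨r, bound p hp r hrL (hry ▸ hy), hrL, hry⟩
    · obtain ⟨p, hp, hy⟩ := ex (v 0)
      exact ⟨p, hp, hy, fun ⟨r, _, hr⟩ => h ⟨r, hr⟩⟩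
  have hd : Delta1 (fun v : ℕ → N => ∃ p ∈ L, pairFst p = v 0) := ⟨inferInstance, neg⟩
  exact InModel.setOf.mem

-- A cut without a greatest or least element would separate false from true stages. A true stage in
-- `A` has boundedly many elements above it, so `A` would have a greatest element; a false stage in
-- `B` has boundedly many below it, so `B` would have a least. Hence `B` would be the class of true
-- stages, which is not a set.
include unbounded inj in
theorem isCompleteOrder_stageOrder (h : {p | IsTrueStage L p} ∉ sets) :
    IsCompleteOrder (toL2 N) L (stageOrder L) := by
  have hlin := stageOrder_isCountableLinearOrder (L := L)
  intro A hA B hB hAB hlt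
  by_contra! hno
  obtain ⟨hmax, hmin⟩ := hno
  have hA' : InModel A := ⟨hA⟩
  have hB' : InModel B := ⟨hB⟩
  have hAL : ∀ {x}, x ∈ A → x ∈ L := fun hx => hAB ▸ Or.inl hx
  have hBL : ∀ {x}, x ∈ B → x ∈ L := fun hx => hAB ▸ Or.inr hx
  have hA1 : ∀ p ∈ A, ¬ IsTrueStage L p := by
    intro p hp ht
    have : InModel {q | q ∈ A ∧ (q = p ∨ pair p q ∈ stageOrder L)} := inferInstance
    obtain ⟨m, hm, hm'⟩ := hlin.exists_max
      (X := {q | q ∈ A ∧ (q = p ∨ pair p q ∈ stageOrder L)}) (fun x hx => hAL hx.1)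
      (a := p) (b := p + 1) ⟨hp, .inl rfl⟩ (by
        rintro x ⟨_, rfl | hx⟩
        · exact lt_add_one_self x
        · exact (ht.lt_of_stageLT (pair_mem_stageOrder.1 hx).2.2).trans (lt_add_one_self p))
    obtain ⟨y, hy, hym, hym'⟩ := hmax m hm.1
    rcases hlin.trichotomy p ht.1 y (hAL hy) with h' | h' | h'
    · exact (hm' y ⟨hy, .inr h'⟩).elim hym hym'
    · exact (hm' y ⟨hy, .inl h'.symm⟩).elim hym hym'
    · rcases hm.2 with rfl | hpm
      · exact hym' h'
      · exact hym' (hlin.trans' h' hpm)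
  have hB1 : ∀ p ∈ B, IsTrueStage L p := by
    intro p hp
    by_contra ht
    obtain ⟨r, hr, hpr, _, hb⟩ := exists_bound_of_not_isTrueStage inj (hBL hp) ht
    have : InModel {q | q ∈ B ∧ (q = p ∨ pair q p ∈ stageOrder L)} := inferInstance
    obtain ⟨m, hm, hm'⟩ := hlin.exists_min
      (X := {q | q ∈ B ∧ (q = p ∨ pair q p ∈ stageOrder L)}) (fun x hx => hBL hx.1)
      (a := p) (b := r) ⟨hp, .inl rfl⟩ (by
        rintro x ⟨_, rfl | hx⟩
        · exact hpr
        · exact hb x (pair_mem_stageOrder.1 hx).2.2)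
    obtain ⟨y, hy, hym, hym'⟩ := hmin m hm.1
    rcases hlin.trichotomy y (hBL hy) p (hBL hp) with h' | h' | h'
    · exact (hm' y ⟨hy, .inr h'⟩).elim hym hym'
    · exact (hm' y ⟨hy, .inl h'⟩).elim hym hym'
    · rcases hm.2 with rfl | hpm
      · exact hym' h'
      · exact hym' (hlin.trans' hpm h')
  refine h ?_
  rwa [show {p | IsTrueStage L p} = B from Set.ext fun p => ⟨fun hp => ?_, hB1 p⟩]
  rcases (hAB ▸ hp.1 : p ∈ A ∪ B) with h' | h'
  · exact absurd hp (hA1 p h')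
  · exact h'

-- It suffices to find `p₀` below `m` with boundedly many points in between. For true `m` a later
-- true stage serves, as only smaller numbers lie above it; for false `m` there are boundedly many
-- points below `m` altogether.
include unbounded inj in
theorem stageOrder_exists_pred {m : N} (hm : m ∈ L) :
    ∃ a, BelowPoint (stageOrder L) a m ∧
      ∀ q, pair q m ∈ stageOrder L → ¬ BelowPoint (stageOrder L) a q := by
  have hlin := stageOrder_isCountableLinearOrder (L := L)
  by_cases hmin : ∃ q, pair q m ∈ stageOrder L
  · obtain ⟨p₀, b, hp₀, hb⟩ : ∃ p₀ b, pair p₀ m ∈ stageOrder L ∧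
        ∀ q, pair p₀ q ∈ stageOrder L → pair q m ∈ stageOrder L → q < b := by
      by_cases ht : IsTrueStage L m
      · obtain ⟨p, hp, hmp⟩ := exists_isTrueStage_ge unbounded inj (m + 1)
        refine ⟨p, p, pair_mem_stageOrder.2 ⟨hp.1, hm, .inr ⟨add_one_le_iff.1 hmp,
          ht.looksTrue p⟩⟩, fun q hq _ => hp.lt_of_stageLT (pair_mem_stageOrder.1 hq).2.2⟩
      · obtain ⟨r, _, _, _, hb⟩ := exists_bound_of_not_isTrueStage inj hm ht
        obtain ⟨q, hq⟩ := hmin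
        exact ⟨q, r, hq, fun q _ hq => hb q (pair_mem_stageOrder.1 hq).2.2⟩
    have : InModel {q | pair q m ∈ stageOrder L ∧ (q = p₀ ∨ pair p₀ q ∈ stageOrder L)} :=
      inferInstance
    obtain ⟨x, ⟨hxm, hx⟩, hmax⟩ := hlin.exists_max
      (X := {q | pair q m ∈ stageOrder L ∧ (q = p₀ ∨ pair p₀ q ∈ stageOrder L)})
      (fun x hx => hlin.left_mem hx.1) (a := p₀) (b := b + (p₀ + 1)) ⟨hp₀, .inl rfl⟩ (by
        rintro x ⟨hxm, rfl | hx⟩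
        · exact (lt_add_one_self x).trans_le (le_add_of_nonneg_left zero_le)
        · exact (hb x hx hxm).trans_le (le_add_of_nonneg_right zero_le))
    refine ⟨finitePoint x, belowPoint_finitePoint.2 hxm, fun q hqm hxq => ?_⟩
    rw [belowPoint_finitePoint] at hxq
    have hpq : pair p₀ q ∈ stageOrder L := by
      rcases hx with rfl | hx
      · exact hxq
      · exact hlin.trans' hx hxq
    rcases hmax q ⟨hqm, .inr hpq⟩ with rfl | h'
    · exact hlin.irrefl' hxq
    · exact hlin.irrefl' (hlin.trans' hxq h')
  · exact ⟨0, .inl rfl, fun q hq => absurd ⟨q, hq⟩ hmin⟩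

-- A true `m` has boundedly many points above it, and a false stage above `m` bounds the points
-- below itself. In the remaining case `m` is false and exactly the true stages lie above it, so
-- these would form a set.
include inj in
theorem stageOrder_exists_succ (h : {p | IsTrueStage L p} ∉ sets) {m : N} (hm : m ∈ L) :
    ∃ b, AbovePoint (stageOrder L) b m ∧
      ∀ q, pair m q ∈ stageOrder L → ¬ AbovePoint (stageOrder L) b q := by
  have hlin := stageOrder_isCountableLinearOrder (L := L)
  by_cases hmax : ∃ q, pair m q ∈ stageOrder L
  · obtain ⟨p₀, b, hp₀, hb⟩ : ∃ p₀ b, pair m p₀ ∈ stageOrder L ∧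
        ∀ q, pair q p₀ ∈ stageOrder L → pair m q ∈ stageOrder L → q < b := by
      by_cases ht : IsTrueStage L m
      · obtain ⟨q, hq⟩ := hmax
        exact ⟨q, m, hq, fun q _ hq => ht.lt_of_stageLT (pair_mem_stageOrder.1 hq).2.2⟩
      · by_cases hf : ∃ p, ¬ IsTrueStage L p ∧ pair m p ∈ stageOrder L
        · obtain ⟨p, hp, hmp⟩ := hf
          obtain ⟨r, _, _, _, hb⟩ := exists_bound_of_not_isTrueStage inj (hlin.right_mem hmp) hp
          exact ⟨p, r, hmp, fun q hq _ => hb q (pair_mem_stageOrder.1 hq).2.2⟩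
        · refine absurd ?_ h
          have : InModel {p | pair m p ∈ stageOrder L} := inferInstance
          rw [show {p | IsTrueStage L p} = {p | pair m p ∈ stageOrder L} from
            Set.ext fun p => ⟨fun hp => pair_mem_stageOrder.2
              ⟨hm, hp.1, stageLT_of_isTrueStage inj hm ht hp⟩, fun hp => ?_⟩]
          · exact this.mem
          · by_contra hp'
            exact hf ⟨p, hp', hp⟩
    have : InModel {q | pair m q ∈ stageOrder L ∧ (q = p₀ ∨ pair q p₀ ∈ stageOrder L)} :=
      inferInstance
    obtain ⟨x, ⟨hxm, hx⟩, hmin⟩ := hlin.exists_min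
      (X := {q | pair m q ∈ stageOrder L ∧ (q = p₀ ∨ pair q p₀ ∈ stageOrder L)})
      (fun x hx => hlin.right_mem hx.1) (a := p₀) (b := b + (p₀ + 1)) ⟨hp₀, .inl rfl⟩ (by
        rintro x ⟨hxm, rfl | hx⟩
        · exact (lt_add_one_self x).trans_le (le_add_of_nonneg_left zero_le)
        · exact (hb x hx hxm).trans_le (le_add_of_nonneg_right zero_le))
    refine ⟨finitePoint x, abovePoint_finitePoint.2 hxm, fun q hqm hxq => ?_⟩
    rw [abovePoint_finitePoint] at hxq
    have hpq : pair q p₀ ∈ stageOrder L := by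
      rcases hx with rfl | hx
      · exact hxq
      · exact hlin.trans' hxq hx
    rcases hmin q ⟨hqm, .inr hpq⟩ with rfl | h'
    · exact hlin.irrefl' hxq
    · exact hlin.irrefl' (hlin.trans' hxq h')
  · exact ⟨1, .inl rfl, fun q hq => absurd ⟨q, hq⟩ hmax⟩

end TrueStages

/-- `Σ⁰₁` comprehension from the compactness of complete orders. -/
theorem sigma1_comprehension_of_compact
    (H : ∀ L R : Set N, IsCountableLinearOrder (toL2 N) L R → IsCompleteOrder (toL2 N) L R →
      IsCompactSpace (toL2 N) L (intervalIndices L) (interval L R))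
    (P : N → Prop) (hP : Sigma1 (fun v : ℕ → N => P (v 0))) : {x | P x} ∈ sets := by
  obtain ⟨G, hG, hPG⟩ := hP.exists_projection
  -- Only the least witness of each value is kept, which makes the enumeration by first components
  -- injective.
  let L : Set N := {p | ∃ y, y < p + 1 ∧ ∃ w, w < p + 1 ∧ (p = pair y w ∧ pair y w ∈ G ∧
    ∀ w', w' < w → ¬ pair y w' ∈ G)}
  have hL : InModel L := InModel.setOf
  have range : {x | P x} = {y | ∃ p ∈ L, pairFst p = y} := by
    ext y
    constructor
    · intro hy
      obtain ⟨w, hw⟩ := (hPG y).1 hy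
      obtain ⟨w, hw, hmin⟩ := exists_least (P := fun w => pair y w ∈ G) hw
      exact ⟨pair y w, ⟨y, lt_add_one_iff.2 (left_le_pair _ _), w,
        lt_add_one_iff.2 (right_le_pair _ _), rfl, hw, hmin⟩, pairFst_pair y w⟩
    · rintro ⟨_, ⟨y', _, w, _, rfl, hG, _⟩, rfl⟩
      rw [pairFst_pair]
      exact (hPG y').2 ⟨w, hG⟩
  have inj : ∀ p ∈ L, ∀ q ∈ L, pairFst p = pairFst q → p = q := by
    rintro _ ⟨y, _, w, _, rfl, hw, hmin⟩ _ ⟨y', _, w', _, rfl, hw', hmin'⟩ e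
    rw [pairFst_pair, pairFst_pair] at e
    subst e
    rcases lt_trichotomy w w' with h | rfl | h
    · exact absurd hw (hmin' w h)
    · rfl
    · exact absurd hw' (hmin w' h)
  rw [range]
  by_contra hrange
  have unbounded : ∀ b, ∃ p ∈ L, b ≤ p := by
    intro b
    by_contra! hb
    refine hrange ?_
    have : InModel {y | ∃ p, p < b ∧ (p ∈ L ∧ pairFst p = y)} := inferInstance
    rw [show {y | ∃ p ∈ L, pairFst p = y} = {y | ∃ p, p < b ∧ (p ∈ L ∧ pairFst p = y)} from
      Set.ext fun y => exists_congr fun p => ⟨fun h => ⟨hb p h.1, h⟩, fun h => h.2⟩]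
    exact this.mem
  have hTr : {p | IsTrueStage L p} ∉ sets := fun h =>
    hrange (range_mem_of_trueStages_mem unbounded inj h)
  obtain ⟨b, hb⟩ := exists_bound_of_isCompactSpace stageOrder_isCountableLinearOrder
    (H L _ stageOrder_isCountableLinearOrder (isCompleteOrder_stageOrder unbounded inj hTr))
    (fun m hm => stageOrder_exists_pred unbounded inj hm)
    (fun m hm => stageOrder_exists_succ inj hTr hm)
  obtain ⟨p, hp, hbp⟩ := unbounded b
  exact absurd (hb p hp) (not_lt.2 hbp)

/-! ## Restrictions of binary sequences and paths through trees -/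

/-- The binary sequence of length `i` with the entries of `s`. -/
noncomputable def restrict (s i : N) : N := (exists_isBitSeq (P := fun j => Bit s j) i).choose

theorem restrict_isBitSeq (s i : N) : IsBitSeq (restrict s i) i :=
  (exists_isBitSeq (P := fun j => Bit s j) i).choose_spec.1

theorem bit_restrict {s i j : N} (h : j < i) : Bit (restrict s i) j ↔ Bit s j :=
  (exists_isBitSeq (P := fun j => Bit s j) i).choose_spec.2 j h

theorem restrict_eq_iff {s i t : N} :
    restrict s i = t ↔ IsBitSeq t i ∧ ∀ j, j < i → (Bit t j ↔ Bit s j) := by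
  constructor
  · rintro rfl
    exact ⟨restrict_isBitSeq s i, fun j => bit_restrict⟩
  · rintro ⟨h, h'⟩
    exact (restrict_isBitSeq s i).ext h fun j hj => (bit_restrict hj).trans (h' j hj).symm

instance delta1Fun_restrict {f g : (ℕ → N) → N} [Delta1Fun f] [Delta1Fun g] :
    Delta1Fun (fun v => restrict (f v) (g v)) := by
  refine Delta1Fun.of_graph₂ ?_ f g
  simp only [restrict_eq_iff]
  infer_instance

theorem IsBinaryTree.restrict_mem {T : Set N} (hT : IsBinaryTree T) {s l i : N} (hs : s ∈ T)
    (hl : IsBitSeq s l) (hi : i ≤ l) : restrict s i ∈ T :=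
  hT.2 s hs _ i (restrict_isBitSeq s i).1
    ((restrict_isBitSeq s i).subset hl hi fun _ => bit_restrict)

theorem IsBinaryTree.exists_length {T : Set N} (hT : IsBinaryTree T) {s : N} (hs : s ∈ T) :
    ∃ l, IsBitSeq s l := (isBinarySeq_iff s).1 (hT.1 s hs)

theorem exists_isPath {T X : Set N} [InModel X]
    (h : ∀ n, ∃ s ∈ T, IsBitSeq s n ∧ ∀ i, i < n → (Bit s i ↔ i ∈ X)) :
    ∃ f ∈ sets, IsPath T f := by
  have hf : InModel {p | ∃ i, i < p + 1 ∧ ((p = pair i 1 ∧ i ∈ X) ∨ (p = pair i 0 ∧ ¬ i ∈ X))} :=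
    inferInstance
  set f := {p | ∃ i, i < p + 1 ∧ ((p = pair i 1 ∧ i ∈ X) ∨ (p = pair i 0 ∧ ¬ i ∈ X))} with hfdef
  have mem_f : ∀ i j : N, pair i j ∈ f ↔ (j = 1 ∧ i ∈ X) ∨ (j = 0 ∧ ¬ i ∈ X) := by
    intro i j
    constructor
    · rintro ⟨i', _, ⟨e, h⟩ | ⟨e, h⟩⟩ <;> obtain ⟨rfl, rfl⟩ := pair_inj.1 e
      exacts [.inl ⟨rfl, h⟩, .inr ⟨rfl, h⟩]
    · rintro (⟨rfl, h⟩ | ⟨rfl, h⟩)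
      exacts [⟨i, lt_add_one_iff.2 (left_le_pair _ _), .inl ⟨rfl, h⟩⟩,
        ⟨i, lt_add_one_iff.2 (left_le_pair _ _), .inr ⟨rfl, h⟩⟩]
  refine ⟨f, hf.mem, ⟨?_, fun i _ => ?_⟩, fun n => ?_⟩
  · rintro p ⟨i, _, ⟨rfl, _⟩ | ⟨rfl, _⟩⟩
    exacts [⟨i, trivial, 1, trivial, rfl⟩, ⟨i, trivial, 0, trivial, rfl⟩]
  · by_cases hi : i ∈ X
    · exact ⟨1, (mem_f i 1).2 (.inl ⟨rfl, hi⟩), fun j hj => by have := (mem_f i j).1 hj; tauto⟩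
    · exact ⟨0, (mem_f i 0).2 (.inr ⟨rfl, hi⟩), fun j hj => by have := (mem_f i j).1 hj; tauto⟩
  · obtain ⟨s, hs, hsn, hX⟩ := h n
    refine ⟨s, hs, hsn.1, fun p hp => ?_⟩
    obtain ⟨i, hi, ⟨rfl, h'⟩ | ⟨rfl, h'⟩⟩ := (hsn.finMem_iff p).1 hp
    · exact (mem_f _ _).2 (.inl ⟨rfl, (hX i hi).1 h'⟩)
    · exact (mem_f _ _).2 (.inr ⟨rfl, fun h => h' ((hX i hi).2 h)⟩)

/-- `s` turns right exactly at its initial segments in `D`. -/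
def Follows (D : Set N) (s l : N) : Prop := ∀ i, i < l → (Bit s i ↔ restrict s i ∈ D)

instance Delta1.follows {D : Set N} [InModel D] {f g : (ℕ → N) → N} [Delta1Fun f] [Delta1Fun g] :
    Delta1 (fun v => Follows D (f v) (g v)) := by
  refine Delta1.subst₂ (P := fun s l => Follows D s l) ?_ f g
  simp only [Follows]
  infer_instance

/-- The descent directed by `D` is deterministic: equal initial segments prescribe equal next bits.
-/
theorem Follows.bit_iff {D : Set N} [InModel D] {s t k l : N} (hs : Follows D s k)
    (ht : Follows D t l) {i : N} (hk : i < k) (hl : i < l) : Bit s i ↔ Bit t i := by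
  have key : ∀ n : N, n ≤ i → restrict s n = restrict t n := by
    refine sigma1_induction (fun _ => ?_) fun n ih hn => ?_
    · exact (restrict_isBitSeq s 0).ext (restrict_isBitSeq t 0)
        fun j hj => absurd hj (not_lt.2 zero_le)
    · have hni := add_one_le_iff.1 hn
      refine (restrict_isBitSeq s _).ext (restrict_isBitSeq t _) fun j hj => ?_
      rw [bit_restrict hj, bit_restrict hj]
      rcases (lt_add_one_iff.1 hj).lt_or_eq with hj | rfl
      · rw [← bit_restrict (s := s) hj, ← bit_restrict (s := t) hj, ih hni.le]
      · rw [hs j (hni.trans hk), ht j (hni.trans hl), ih hni.le]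
  rw [hs i hk, ht i hl, key i le_rfl]

theorem exists_isBitSeq_snoc (s l : N) (p : Prop) :
    ∃ t, IsBitSeq t (l + 1) ∧ (∀ j, j < l → (Bit t j ↔ Bit s j)) ∧ (Bit t l ↔ p) := by
  obtain ⟨t, ht, ht'⟩ := exists_isBitSeq (P := fun j => (j < l ∧ Bit s j) ∨ (j = l ∧ p)) (l + 1)
  refine ⟨t, ht, fun j hj => (ht' j (hj.trans (lt_add_one_self l))).trans ?_,
    (ht' l (lt_add_one_self l)).trans ?_⟩
  · simp [hj, hj.ne]
  · simp

/-- In a tree without paths, every descent ends. -/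
theorem exists_end_of_follows {T : Set N} [hT' : InModel T] (hT : IsBinaryTree T)
    (hne : T.Nonempty) (hpath : ∀ f ∈ sets, ¬ IsPath T f) (D : Set N) [InModel D] :
    ∃ u l, u ∈ T ∧ IsBitSeq u l ∧ Follows D u l ∧
      ∀ t, IsBitSeq t (l + 1) → (∀ j, j < l → (Bit t j ↔ Bit u j)) → (Bit t l ↔ u ∈ D) → t ∉ T := by
  by_contra! H
  have key : ∀ n : N, ∃ s, s ∈ T ∧ IsBitSeq s n ∧ Follows D s n := by
    refine sigma1_induction ?_ fun n ⟨s, hs, hn, hf⟩ => ?_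
    · obtain ⟨s, hs⟩ := hne
      obtain ⟨l, hl⟩ := hT.exists_length hs
      exact ⟨restrict s 0, hT.restrict_mem hs hl zero_le, restrict_isBitSeq s 0,
        fun i hi => absurd hi (not_lt.2 zero_le)⟩
    · obtain ⟨t, ht, ht', htn, htT⟩ := H s n hs hn hf
      refine ⟨t, htT, ht, fun i hi => ?_⟩
      rcases (lt_add_one_iff.1 hi).lt_or_eq with hin | rfl
      · rw [ht' i hin, hf i hin]
        refine iff_of_eq (congrArg (· ∈ D) ?_)
        exact (restrict_isBitSeq s i).ext (restrict_isBitSeq t i) fun j hj => by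
          rw [bit_restrict hj, bit_restrict hj, ht' j (hj.trans hin)]
      · rw [htn]
        refine iff_of_eq (congrArg (· ∈ D) (restrict_eq_iff.2 ⟨hn, fun j hj => ?_⟩).symm)
        exact (ht' j hj).symm
  -- Nodes following `D` exist in every length and agree with each other, so that one of them has
  -- bit `1` at a given place and that one has bit `0` there are complementary `Σ⁰₁` statements. An
  -- endless descent is therefore a path in the model.
  have hX : Delta1 (fun v : ℕ → N => ∃ s, s ∈ T ∧ IsBitSeq s (v 0 + 1) ∧ Follows D s (v 0 + 1) ∧
      Bit s (v 0)) := by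
    refine ⟨inferInstance, ?_⟩
    have h1 : Sigma1 (fun v : ℕ → N => ∃ s, s ∈ T ∧ IsBitSeq s (v 0 + 1) ∧
      Follows D s (v 0 + 1) ∧ ¬ Bit s (v 0)) := inferInstance
    refine h1.congr fun v => ⟨?_, fun h => ?_⟩
    · rintro ⟨s, _, _, hf, hb⟩ ⟨s', _, _, hf', hb'⟩
      exact hb ((hf.bit_iff hf' (lt_add_one_self _) (lt_add_one_self _)).2 hb')
    · obtain ⟨s, hs, hn, hf⟩ := key (v 0 + 1)
      exact ⟨s, hs, hn, hf, fun hb => h ⟨s, hs, hn, hf, hb⟩⟩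
  have hX' : InModel {i | ∃ s, s ∈ T ∧ IsBitSeq s (i + 1) ∧ Follows D s (i + 1) ∧ Bit s i} :=
    InModel.setOf
  obtain ⟨f, hf, hf'⟩ := exists_isPath (T := T)
    (X := {i | ∃ s, s ∈ T ∧ IsBitSeq s (i + 1) ∧ Follows D s (i + 1) ∧ Bit s i}) (fun n => by
      obtain ⟨s, hs, hn, hsf⟩ := key n
      refine ⟨s, hs, hn, fun i hi => ⟨fun hb => ?_, ?_⟩⟩
      · obtain ⟨t, ht, htn, htf⟩ := key (i + 1)
        exact ⟨t, ht, htn, htf, (htf.bit_iff hsf (lt_add_one_self _) hi).2 hb⟩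
      · rintro ⟨t, _, _, htf, hb⟩
        exact (htf.bit_iff hsf (lt_add_one_self _) hi).1 hb)
  exact hpath f hf hf'

/-! ## The in-order of a binary tree -/

/-- The `i`-th entry of the sequence `s` exists and is `b`. -/
def Entry (b s i : N) : Prop := FinMem (pair i b) s

instance Delta1.entry {f g k : (ℕ → N) → N} [Delta1Fun f] [Delta1Fun g] [Delta1Fun k] :
    Delta1 (fun v => Entry (f v) (g v) (k v)) :=
  inferInstanceAs (Delta1 (fun v => FinMem (pair (k v) (f v)) (g v)))

/-- `b` and `b'` are the two bits, in one of the two orders. -/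
def IsFlip (b b' : N) : Prop := (b = 0 ∧ b' = 1) ∨ (b = 1 ∧ b' = 0)

theorem IsFlip.symm {b b' : N} (h : IsFlip b b') : IsFlip b' b :=
  Or.symm (h.imp And.symm And.symm)

theorem isFlip_zero_one : IsFlip (0 : N) 1 := .inl ⟨rfl, rfl⟩

theorem IsBitSeq.entry_zero_iff {s l i : N} (h : IsBitSeq s l) :
    Entry 0 s i ↔ i < l ∧ ¬ Bit s i := by
  refine (h.finMem_iff _).trans ⟨?_, fun ⟨hi, hb⟩ => ⟨i, hi, .inr ⟨rfl, hb⟩⟩⟩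
  rintro ⟨j, hj, ⟨e, _⟩ | ⟨e, hb⟩⟩
  · exact absurd (pair_inj.1 e).2 zero_ne_one
  · rw [(pair_inj.1 e).1]
    exact ⟨hj, hb⟩

theorem IsBitSeq.entry_one_iff {s l i : N} (h : IsBitSeq s l) :
    Entry 1 s i ↔ i < l ∧ Bit s i := ⟨fun hb => ⟨h.lt_of_bit hb, hb⟩, fun hb => hb.2⟩

theorem IsBitSeq.entry_iff {s l i b b' : N} (h : IsBitSeq s l) (hb : IsFlip b b') :
    Entry b s i ↔ i < l ∧ (Bit s i ↔ b = 1) := by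
  rcases hb with ⟨rfl, _⟩ | ⟨rfl, _⟩
  · rw [h.entry_zero_iff]
    simp
  · rw [h.entry_one_iff]
    simp

theorem IsFlip.eq_one_iff {b b' : N} (h : IsFlip b b') : b' = 1 ↔ ¬ b = 1 := by
  rcases h with ⟨rfl, rfl⟩ | ⟨rfl, rfl⟩ <;> simp

theorem IsBitSeq.not_entry_and {s l i b b' : N} (h : IsBitSeq s l) (hb : IsFlip b b') :
    Entry b s i → ¬ Entry b' s i := by
  rw [h.entry_iff hb, h.entry_iff hb.symm, hb.eq_one_iff]
  tauto

theorem IsBitSeq.entry_or {s l i b b' : N} (h : IsBitSeq s l) (hb : IsFlip b b') (hi : i < l) :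
    Entry b s i ∨ Entry b' s i := by
  rw [h.entry_iff hb, h.entry_iff hb.symm, hb.eq_one_iff]
  tauto

theorem IsBitSeq.lt_of_entry {s l i b b' : N} (h : IsBitSeq s l) (hb : IsFlip b b')
    (hi : Entry b s i) : i < l := ((h.entry_iff hb).1 hi).1

/-- The sequences `s` and `t` agree at the place `i`. -/
def Agree (b b' s t i : N) : Prop := (Entry b s i ↔ Entry b t i) ∧ (Entry b' s i ↔ Entry b' t i)

theorem Agree.symm {b b' s t i : N} (h : Agree b b' s t i) : Agree b b' t s i :=
  ⟨h.1.symm, h.2.symm⟩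

theorem Agree.trans {b b' s t r i : N} (h : Agree b b' s t i) (h' : Agree b b' t r i) :
    Agree b b' s r i := ⟨h.1.trans h'.1, h.2.trans h'.2⟩

/-- `s` and `t` first differ at the place `i`, where `s` is smaller with respect to the order
`b`, undefined, `b'`. -/
def BeforeAt (b b' s t i : N) : Prop := (∀ j, j < i → Agree b b' s t j) ∧
  ((Entry b s i ∧ ¬ Entry b t i) ∨ (¬ Entry b' s i ∧ Entry b' t i))

/-- `s` is before `t` in the in-order in which `b` goes before `b'`. -/
def Before (b b' s t : N) : Prop := ∃ i, i < s + t ∧ BeforeAt b b' s t i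

instance Delta1.before {b b' : N} {f g : (ℕ → N) → N} [Delta1Fun f] [Delta1Fun g] :
    Delta1 (fun v => Before b b' (f v) (g v)) := by
  refine Delta1.subst₂ (P := fun s t => Before b b' s t) ?_ f g
  simp only [Before, BeforeAt, Agree]
  infer_instance

theorem BeforeAt.before {b b' s t i : N} (h : BeforeAt b b' s t i) : Before b b' s t := by
  refine ⟨i, ?_, h⟩
  rcases h.2 with ⟨h, _⟩ | ⟨_, h⟩
  · exact ((left_le_pair _ _).trans_lt h.lt).trans_le (le_add_of_nonneg_right zero_le)
  · exact ((left_le_pair _ _).trans_lt h.lt).trans_le (le_add_of_nonneg_left zero_le)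

/-- Exchanging left and right reverses the order, so greatest and least elements, and successors and
predecessors, need only one argument each. -/
theorem before_flip {b b' s t : N} : Before b' b s t ↔ Before b b' t s := by
  simp only [Before, BeforeAt, Agree, add_comm t s]
  refine exists_congr fun i => and_congr_right fun _ => and_congr ?_ (by tauto)
  exact forall_congr' fun j => imp_congr_right fun _ => by tauto

theorem Before.trans {b b' s t r k l m : N} (hb : IsFlip b b') (hs : IsBitSeq s k)
    (ht : IsBitSeq t l) (hr : IsBitSeq r m) (h : Before b b' s t) (h' : Before b b' t r) :
    Before b b' s r := by
  obtain ⟨i, -, hi, hi'⟩ := h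
  obtain ⟨j, -, hj, hj'⟩ := h'
  have h1 := hs.not_entry_and (i := i) hb
  have h2 := ht.not_entry_and (i := i) hb
  have h3 := hr.not_entry_and (i := i) hb
  rcases lt_trichotomy i j with hij | rfl | hij
  · refine BeforeAt.before (i := i) ⟨fun x hx => (hi x hx).trans (hj x (hx.trans hij)), ?_⟩
    rw [← (hj i hij).1, ← (hj i hij).2]
    exact hi'
  · refine BeforeAt.before (i := i) ⟨fun x hx => (hi x hx).trans (hj x hx), ?_⟩
    tauto
  · refine BeforeAt.before (i := j) ⟨fun x hx => (hi x (hx.trans hij)).trans (hj x hx), ?_⟩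
    rw [(hi j hij).1, (hi j hij).2]
    exact hj'

theorem Before.irrefl {b b' s : N} : ¬ Before b b' s s := by
  rintro ⟨i, _, _, h | h⟩
  · exact h.2 h.1
  · exact h.1 h.2

theorem IsBitSeq.ext_of_agree {b b' s t k l : N} (hb : IsFlip b b') (hs : IsBitSeq s k)
    (ht : IsBitSeq t l) (h : ∀ i, Agree b b' s t i) : s = t := by
  have hlt : ∀ {s t k l : N}, IsBitSeq s k → IsBitSeq t l → (∀ i, Agree b b' s t i) → k ≤ l := by
    intro s t k l hs ht h
    by_contra! hl
    rcases hs.entry_or hb hl with h' | h'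
    · exact lt_irrefl _ (ht.lt_of_entry hb ((h l).1.1 h'))
    · exact lt_irrefl _ (ht.lt_of_entry hb.symm ((h l).2.1 h'))
  obtain rfl := le_antisymm (hlt hs ht h) (hlt ht hs fun i => (h i).symm)
  refine hs.ext ht fun i hi => ?_
  have h1 := (h i).1
  rw [hs.entry_iff hb, ht.entry_iff hb] at h1
  tauto

theorem before_trichotomy {b b' s t k l : N} (hb : IsFlip b b') (hs : IsBitSeq s k)
    (ht : IsBitSeq t l) : Before b b' s t ∨ s = t ∨ Before b b' t s := by
  by_cases h : ∀ i, Agree b b' s t i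
  · exact .inr (.inl (hs.ext_of_agree hb ht h))
  · push Not at h
    obtain ⟨i, hi⟩ := h
    have : Delta1 (fun v : ℕ → N => Agree b b' s t (v 0)) := by
      simp only [Agree]
      infer_instance
    obtain ⟨i, hi, hmin⟩ := exists_least (P := fun i => ¬ Agree b b' s t i) hi
    have hmin' : ∀ j, j < i → Agree b b' s t j := fun j hj => not_not.1 (hmin j hj)
    have h1 := hs.not_entry_and (i := i) hb
    have h2 := ht.not_entry_and (i := i) hb
    have h3 : ((Entry b s i ∧ ¬ Entry b t i) ∨ (¬ Entry b' s i ∧ Entry b' t i)) ∨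
        ((Entry b t i ∧ ¬ Entry b s i) ∨ (¬ Entry b' t i ∧ Entry b' s i)) := by
      simp only [Agree] at hi
      tauto
    rcases h3 with h3 | h3
    · exact .inl (BeforeAt.before ⟨hmin', h3⟩)
    · exact .inr (.inr (BeforeAt.before ⟨fun j hj => (hmin' j hj).symm, h3⟩))

theorem Agree.bit_iff {b b' s t k l j : N} (hb : IsFlip b b') (hs : IsBitSeq s k)
    (ht : IsBitSeq t l) (h : Agree b b' s t j) (hj : j < k) : j < l ∧ (Bit s j ↔ Bit t j) := by
  have hjl : j < l := (hs.entry_or hb hj).elim (fun h' => ht.lt_of_entry hb (h.1.1 h'))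
    (fun h' => ht.lt_of_entry hb.symm (h.2.1 h'))
  refine ⟨hjl, ?_⟩
  have h1 := h.1
  rw [hs.entry_iff hb, ht.entry_iff hb] at h1
  tauto

theorem agree_of_bit_iff {b b' s t k l j : N} (hb : IsFlip b b') (hs : IsBitSeq s k)
    (ht : IsBitSeq t l) (hk : j < k) (hl : j < l) (h : Bit s j ↔ Bit t j) : Agree b b' s t j := by
  simp only [Agree, hs.entry_iff hb, ht.entry_iff hb, hs.entry_iff hb.symm, ht.entry_iff hb.symm,
    hk, hl, h, and_self]

theorem eq_restrict_of_agree {b b' u y l m i : N} (hb : IsFlip b b') (hu : IsBitSeq u l)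
    (hy : IsBitSeq y m) (hil : i ≤ l) (h : ∀ j, j < i → Agree b b' u y j) (hmi : m ≤ i) :
    y = restrict u i := by
  have hmi' : m = i := by
    by_contra hne
    have hlt := lt_of_le_of_ne hmi hne
    exact lt_irrefl _ ((h m hlt).bit_iff hb hu hy (hlt.trans_le hil)).1
  subst hmi'
  exact (restrict_eq_iff.2 ⟨hy, fun j hj =>
    ((h j hj).bit_iff hb hu hy (hj.trans_le hil)).2.symm⟩).symm

/-- The child of the sequence `u` of length `l` in the direction `b` does not belong to `T`. -/
def ChildOutside (T : Set N) (b u l : N) : Prop :=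
  ∃ c, c ∉ T ∧ IsBitSeq c (l + 1) ∧ (∀ j, j < l → (Bit c j ↔ Bit u j)) ∧ Entry b c l

theorem exists_child_of_not_childOutside {T : Set N} {b b' u l : N} (hb : IsFlip b b')
    (h : ¬ ChildOutside T b u l) :
    ∃ c ∈ T, IsBitSeq c (l + 1) ∧ (∀ j, j < l → (Bit c j ↔ Bit u j)) ∧ Entry b c l := by
  obtain ⟨c, hc, hcu, hcl⟩ := exists_isBitSeq_snoc u l (b = 1)
  have hE : Entry b c l := (hc.entry_iff hb).2 ⟨lt_add_one_self l, hcl⟩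
  by_contra hT
  exact h ⟨c, fun h' => hT ⟨c, h', hc, hcu, hE⟩, hc, hcu, hE⟩

theorem ChildOutside.not_entry {T : Set N} (hT : IsBinaryTree T) {b b' u l y m : N}
    (hb : IsFlip b b') (h : ChildOutside T b u l) (hy : y ∈ T) (hym : IsBitSeq y m)
    (hyu : ∀ j, j < l → (Bit y j ↔ Bit u j)) : ¬ Entry b y l := by
  intro hE
  obtain ⟨c, hc, hcl, hcu, hcE⟩ := h
  have hlm := hym.lt_of_entry hb hE
  refine hc ((restrict_eq_iff.2 ⟨hcl, fun j hj => ?_⟩ : restrict y (l + 1) = c) ▸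
    hT.restrict_mem hy hym (add_one_le_iff.2 hlm))
  rcases (lt_add_one_iff.1 hj).lt_or_eq with hj | rfl
  · rw [hcu j hj, hyu j hj]
  · have h1 := (hcl.entry_iff hb).1 hcE
    have h2 := (hym.entry_iff hb).1 hE
    tauto

/-- An extension of `u` comes after `u` only through its child in the direction `b'`, and that child
is missing. -/
theorem BeforeAt.lt_of_childOutside {T : Set N} (hT : IsBinaryTree T) {b b' u l y m i : N}
    (hb : IsFlip b b') (hu : IsBitSeq u l) (h : ChildOutside T b' u l) (hy : y ∈ T)
    (hym : IsBitSeq y m) (hi : BeforeAt b b' u y i) : i < l := by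
  by_contra! hli
  have hE : Entry b' y i := by
    rcases hi.2 with h' | h'
    · exact absurd (hu.lt_of_entry hb h'.1) (not_lt.2 hli)
    · exact h'.2
  rcases hli.lt_or_eq with hli' | rfl
  · have him := hym.lt_of_entry hb.symm hE
    exact lt_irrefl _ ((hi.1 l hli').symm.bit_iff hb hym hu (hli'.trans him)).1
  · exact h.not_entry hT hb.symm hy hym
      (fun j hj => ((hi.1 j hj).bit_iff hb hu hym hj).2.symm) hE

/-! ### Completeness and neighbours in the in-order of a tree without paths -/

section Tree

variable {T : Set N} (hT : IsBinaryTree T)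

-- If `y` comes after `u`, they differ at a place `i` where `u` turns towards `b`, so the node
-- `restrict u i` belongs to `B`. But `y` is that node or comes after it, which is impossible for an
-- element of `A`.
include hT in
theorem not_before_of_follows {b b' u l y : N} {A B : Set N} (hb : IsFlip b b') (hAB : T = A ∪ B)
    (hlt : ∀ x ∈ A, ∀ z ∈ B, Before b b' x z) (hu : u ∈ A) (hul : IsBitSeq u l)
    (hf : ∀ i, i < l → (Entry b' u i ↔ restrict u i ∈ A)) (hc : ChildOutside T b' u l)
    (hy : y ∈ A) : ¬ Before b b' u y := by
  rintro ⟨i, -, hi⟩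
  have hAT : ∀ {x}, x ∈ A → x ∈ T := fun hx => hAB ▸ .inl hx
  obtain ⟨m, hym⟩ := hT.exists_length (hAT hy)
  have hil := hi.lt_of_childOutside hT hb hul hc (hAT hy) hym
  have hEu : Entry b u i := by
    rcases hi.2 with h | h
    · exact h.1
    · exact (hul.entry_or hb hil).resolve_right h.1
  have hEy : ¬ Entry b y i := by
    rcases hi.2 with h | h
    · exact h.2
    · exact fun h' => hym.not_entry_and hb h' h.2
  have htB : restrict u i ∈ B := by
    rcases (hAB ▸ hT.restrict_mem (hAT hu) hul hil.le : restrict u i ∈ A ∪ B) with h | h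
    · exact absurd ((hf i hil).2 h) (hul.not_entry_and hb hEu)
    · exact h
  rcases le_or_gt m i with hmi | hmi
  · rw [← eq_restrict_of_agree hb hul hym hil.le hi.1 hmi] at htB
    exact Before.irrefl (hlt y hy y htB)
  · have hEy' := (hym.entry_or hb hmi).resolve_left hEy
    have h1 : BeforeAt b b' (restrict u i) y i := by
      refine ⟨fun j hj => ?_, .inr ⟨fun h => lt_irrefl _
        ((restrict_isBitSeq u i).lt_of_entry hb.symm h), hEy'⟩⟩
      exact (agree_of_bit_iff hb (restrict_isBitSeq u i) hul hj (hj.trans hil)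
        (bit_restrict hj)).trans (hi.1 j hj)
    exact Before.irrefl (h1.before.trans hb (restrict_isBitSeq u i) hym (restrict_isBitSeq u i)
      (hlt y hy _ htB))

/-- The in-order on the nodes of a binary tree. -/
def treeOrder (T : Set N) : Set N := {w | ∃ s, s < w + 1 ∧ ∃ t, t < w + 1 ∧
  (w = pair s t ∧ s ∈ T ∧ t ∈ T ∧ Before 0 1 s t)}

instance InModel.treeOrder (T : Set N) [InModel T] : InModel (treeOrder T) := InModel.setOf

theorem pair_mem_treeOrder {s t : N} :
    pair s t ∈ treeOrder T ↔ s ∈ T ∧ t ∈ T ∧ Before 0 1 s t := by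
  constructor
  · rintro ⟨s', _, t', _, e, h⟩
    obtain ⟨rfl, rfl⟩ := pair_inj.1 e
    exact h
  · exact fun h => ⟨s, lt_add_one_iff.2 (left_le_pair _ _), t,
      lt_add_one_iff.2 (right_le_pair _ _), rfl, h⟩

include hT in
theorem treeOrder_isCountableLinearOrder [hT' : InModel T] :
    IsCountableLinearOrder (toL2 N) T (treeOrder T) where
  carrier_mem := hT'.mem
  rel_mem := (InModel.treeOrder T).mem
  rel_subset := fun _ ⟨s, _, t, _, e, hs, ht, _⟩ => ⟨s, hs, t, ht, e⟩
  irrefl := fun x _ h => Before.irrefl (pair_mem_treeOrder.1 h).2.2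
  trans := fun x hx y hy z hz hxy hyz => by
    obtain ⟨k, hk⟩ := hT.exists_length hx
    obtain ⟨l, hl⟩ := hT.exists_length hy
    obtain ⟨m, hm⟩ := hT.exists_length hz
    exact pair_mem_treeOrder.2 ⟨hx, hz, (pair_mem_treeOrder.1 hxy).2.2.trans isFlip_zero_one
      hk hl hm (pair_mem_treeOrder.1 hyz).2.2⟩
  trichotomy := fun x hx y hy => by
    obtain ⟨k, hk⟩ := hT.exists_length hx
    obtain ⟨l, hl⟩ := hT.exists_length hy
    rcases before_trichotomy isFlip_zero_one hk hl with h | h | h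
    exacts [.inl (pair_mem_treeOrder.2 ⟨hx, hy, h⟩), .inr (.inl h),
      .inr (.inr (pair_mem_treeOrder.2 ⟨hy, hx, h⟩))]

variable [hT' : InModel T] (hne : T.Nonempty) (hpath : ∀ f ∈ sets, ¬ IsPath T f)

-- The descent turns right at nodes of `A` and left at nodes of `B`, towards the cut. It stops at a
-- node `u` whose child in that direction is missing, and `u` is the greatest element of `A` or the
-- least of `B`, according to its side.
include hT hne hpath in
theorem isCompleteOrder_treeOrder : IsCompleteOrder (toL2 N) T (treeOrder T) := by
  intro A hA B hB hAB hlt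
  have hlin := treeOrder_isCountableLinearOrder hT
  have hA' : InModel A := ⟨hA⟩
  have hAT : ∀ {x}, x ∈ A → x ∈ T := fun hx => hAB ▸ Or.inl hx
  have hBT : ∀ {x}, x ∈ B → x ∈ T := fun hx => hAB ▸ Or.inr hx
  have hAB' : ∀ x ∈ T, (x ∈ B ↔ x ∉ A) := by
    intro x hx
    refine ⟨fun h h' => hlin.irrefl' (hlt x h' x h), fun h => ?_⟩
    exact (hAB ▸ hx : x ∈ A ∪ B).resolve_left h
  obtain ⟨u, l, hu, hul, hf, hend⟩ := exists_end_of_follows hT hne hpath A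
  have child : ∀ b b', IsFlip b b' → (b = 1 ↔ u ∈ A) → ChildOutside T b u l := by
    intro b b' hb hbu
    by_contra h
    obtain ⟨c, hc, hcl, hcu, hE⟩ := exists_child_of_not_childOutside hb h
    exact hend c hcl hcu (((hcl.entry_iff hb).1 hE).2.trans hbu) hc
  by_cases huA : u ∈ A
  · refine .inl ⟨u, huA, fun y hy => ?_⟩
    rcases hlin.trichotomy y (hAT hy) u hu with h | h | h
    · exact .inr h
    · exact .inl h
    · exact absurd (pair_mem_treeOrder.1 h).2.2 (not_before_of_follows hT isFlip_zero_one hAB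
        (fun x hx z hz => (pair_mem_treeOrder.1 (hlt x hx z hz)).2.2) huA hul
        (fun i hi => by rw [hul.entry_one_iff, ← hf i hi]; exact and_iff_right hi)
        (child 1 0 isFlip_zero_one.symm (iff_of_true rfl huA)) hy)
  · have huB := (hAB' u hu).2 huA
    refine .inr ⟨u, huB, fun y hy => ?_⟩
    rcases hlin.trichotomy u hu y (hBT hy) with h | h | h
    · exact .inr h
    · exact .inl h.symm
    · refine absurd (before_flip.2 (pair_mem_treeOrder.1 h).2.2)
        (not_before_of_follows hT isFlip_zero_one.symm (hAB.trans (Set.union_comm A B))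
        (fun x hx z hz => before_flip.2 (pair_mem_treeOrder.1 (hlt z hz x hx)).2.2) huB hul
        (fun i hi => ?_) (child 0 1 isFlip_zero_one (iff_of_false zero_ne_one huA)) hy)
      rw [hul.entry_zero_iff, hf i hi, hAB' _ (hT.restrict_mem hu hul hi.le)]
      exact and_iff_right hi

/-! ### Neighbours in the in-order -/

/-- Evidence that no node of `T` comes after `m`. -/
def IsLast (T : Set N) (b' m : N) : Prop :=
  ∃ l, IsBitSeq m l ∧ (∀ i, i < l → Entry b' m i) ∧ ChildOutside T b' m l

/-- Evidence that the initial segment `t` of `u` comes immediately after `u`. -/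
def IsNextAbove (T : Set N) (b b' u t : N) : Prop :=
  ∃ l k, IsBitSeq u l ∧ k < l ∧ restrict u k = t ∧ Entry b u k ∧
    (∀ j, j < l → k < j → Entry b' u j) ∧ ChildOutside T b' u l

theorem IsLast.not_before {b b' m y : N} (hT : IsBinaryTree T) (hb : IsFlip b b')
    (h : IsLast T b' m) (hy : y ∈ T) : ¬ Before b b' m y := by
  rintro ⟨i, -, hi⟩
  obtain ⟨l, hl, hE, hc⟩ := h
  obtain ⟨k, hk⟩ := hT.exists_length hy
  have hil := hi.lt_of_childOutside hT hb hl hc hy hk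
  rcases hi.2 with h | h
  · exact hl.not_entry_and hb h.1 (hE i hil)
  · exact h.1 (hE i hil)

theorem IsNextAbove.before {b b' u t : N} (hb : IsFlip b b') (h : IsNextAbove T b b' u t) :
    Before b b' u t := by
  obtain ⟨l, k, hl, hkl, rfl, hE, _⟩ := h
  exact BeforeAt.before (i := k) ⟨fun j hj => agree_of_bit_iff hb hl (restrict_isBitSeq u k)
    (hj.trans hkl) hj (bit_restrict hj).symm,
    .inl ⟨hE, fun h => lt_irrefl _ ((restrict_isBitSeq u k).lt_of_entry hb h)⟩⟩

/-- Let `y` first differ from `u` at `i`. For `i < k` it compares with `t` as with `u`; for `i = k`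
it is `t` or continues from `t` towards `b'`; and for `i > k` the node `u` takes `b'` at `i`,
leaving no room for `y` after it. -/
theorem IsNextAbove.not_between {b b' u t y : N} (hT : IsBinaryTree T) (hb : IsFlip b b')
    (h : IsNextAbove T b b' u t) (hy : y ∈ T) (huy : Before b b' u y) : ¬ Before b b' y t := by
  intro hyt
  obtain ⟨i, -, hi⟩ := huy
  obtain ⟨l, k, hl, hkl, rfl, hE, hE', hc⟩ := h
  obtain ⟨m, hm⟩ := hT.exists_length hy
  have hil := hi.lt_of_childOutside hT hb hl hc hy hm
  have ht := restrict_isBitSeq u k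
  have not : ¬ Before b b' (restrict u k) y := fun h' => Before.irrefl (h'.trans hb ht hm ht hyt)
  have agree : ∀ j, j < k → Agree b b' (restrict u k) u j := fun j hj =>
    agree_of_bit_iff hb ht hl hj (hj.trans hkl) (bit_restrict hj)
  rcases lt_trichotomy i k with hik | rfl | hik
  · refine not (BeforeAt.before (i := i)
      ⟨fun j hj => (agree j (hj.trans hik)).trans (hi.1 j hj), ?_⟩)
    rw [(agree i hik).1, (agree i hik).2]
    exact hi.2
  · by_cases hEy : Entry b' y i
    · exact not (BeforeAt.before (i := i) ⟨fun j hj => (agree j hj).trans (hi.1 j hj),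
        .inr ⟨fun h => lt_irrefl _ (ht.lt_of_entry hb.symm h), hEy⟩⟩)
    · have hmi : m ≤ i := by
        by_contra! him
        rcases hm.entry_or hb him with h' | h'
        · rcases hi.2 with h | h
          · exact h.2 h'
          · exact hEy h.2
        · exact hEy h'
      rw [eq_restrict_of_agree hb hl hm hil.le hi.1 hmi] at hyt
      exact Before.irrefl hyt
  · rcases hi.2 with h | h
    · exact hl.not_entry_and hb h.1 (hE' i hil hik)
    · exact h.1 (hE' i hil hik)

/-- Evidence that the node `t` comes immediately after `m`. -/
def IsNext (T : Set N) (b b' m t : N) : Prop := IsNextAbove T b b' m t ∨ IsNextAbove T b' b t m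

theorem IsNext.before {b b' m t : N} (hb : IsFlip b b') (h : IsNext T b b' m t) :
    Before b b' m t := by
  rcases h with h | h
  · exact h.before hb
  · exact before_flip.1 (h.before hb.symm)

theorem IsNext.not_between {b b' m t y : N} (hT : IsBinaryTree T) (hb : IsFlip b b')
    (h : IsNext T b b' m t) (hy : y ∈ T) (hmy : Before b b' m y) : ¬ Before b b' y t := by
  rcases h with h | h
  · exact h.not_between hT hb hy hmy
  · exact fun hyt => h.not_between hT hb.symm hy (before_flip.2 hyt) (before_flip.2 hmy)

-- Without a child towards `b'`, the next node is where `m` last turned towards `b`, and `m` is last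
-- if it never did. With such a child, one steps to it and descends towards `b` as long as possible;
-- this ends because there is no path.
include hT hne hpath in
theorem exists_isNext {b b' m : N} (hb : IsFlip b b') (hm : m ∈ T) :
    IsLast T b' m ∨ ∃ t ∈ T, IsNext T b b' m t := by
  obtain ⟨l, hl⟩ := hT.exists_length hm
  by_cases hc : ChildOutside T b' m l
  · by_cases hE : ∃ k, Entry b m k
    · obtain ⟨k, hk⟩ := hE
      obtain ⟨k, hk, hmax⟩ := exists_greatest (P := fun k => Entry b m k) (b := l) hk
        (fun x => hl.lt_of_entry hb)
      have hkl := hl.lt_of_entry hb hk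
      refine .inr ⟨restrict m k, hT.restrict_mem hm hl hkl.le,
        .inl ⟨l, k, hl, hkl, rfl, hk, fun j hj hkj => ?_, hc⟩⟩
      exact (hl.entry_or hb hj).resolve_left fun h => absurd (hmax j h) (not_le.2 hkj)
    · exact .inl ⟨l, hl, fun i hi => (hl.entry_or hb hi).resolve_left fun h => hE ⟨i, h⟩, hc⟩
  · obtain ⟨c, hcT, hcl, hcm, hcE⟩ := exists_child_of_not_childOutside hb.symm hc
    -- The instruction depends only on the length: copy `m` up to `l`, turn to `b'` once, then turn
    -- to `b` forever.
    let D : Set N := {s | ∃ k, k < s + 1 ∧ (IsBitSeq s k ∧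
      ((k < l ∧ Bit m k) ∨ (k = l ∧ b' = 1) ∨ (l < k ∧ b = 1)))}
    have hD : InModel D := InModel.setOf
    have mem_D : ∀ s k, IsBitSeq s k →
        (s ∈ D ↔ ((k < l ∧ Bit m k) ∨ (k = l ∧ b' = 1) ∨ (l < k ∧ b = 1))) := by
      intro s k hk
      refine ⟨?_, fun h => ⟨k, lt_add_one_iff.2 hk.le, hk, h⟩⟩
      rintro ⟨k', _, hk', h⟩
      rwa [hk.length_unique hk']
    obtain ⟨u, n, hu, hun, hf, hend⟩ := exists_end_of_follows hT hne hpath D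
    have bit_u : ∀ i, i < n →
        (Bit u i ↔ ((i < l ∧ Bit m i) ∨ (i = l ∧ b' = 1) ∨ (l < i ∧ b = 1))) :=
      fun i hi => (hf i hi).trans (mem_D _ i (restrict_isBitSeq u i))
    have bit_c : ∀ i, i < l + 1 →
        (Bit c i ↔ ((i < l ∧ Bit m i) ∨ (i = l ∧ b' = 1) ∨ (l < i ∧ b = 1))) := by
      intro i hi
      rcases (lt_add_one_iff.1 hi).lt_or_eq with hi | rfl
      · simp [hi, hi.ne, hi.not_gt, hcm i hi]
      · simp [((hcl.entry_iff hb.symm).1 hcE).2]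
    have hln : l < n := by
      by_contra! hnl
      have hnl' : n < l + 1 := lt_add_one_iff.2 hnl
      refine hend (restrict c (n + 1)) (restrict_isBitSeq c _) (fun j hj => ?_) ?_
        (hT.restrict_mem hcT hcl (add_one_le_iff.2 hnl'))
      · rw [bit_restrict (hj.trans (lt_add_one_self n)), bit_c j (hj.trans hnl'), bit_u j hj]
      · rw [bit_restrict (lt_add_one_self n), bit_c n hnl', mem_D u n hun]
    refine .inr ⟨u, hu, .inr ⟨n, l, hun, hln, ?_, ?_, fun j hj hlj => ?_, ?_⟩⟩
    · refine restrict_eq_iff.2 ⟨hl, fun j hj => ?_⟩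
      rw [bit_u j (hj.trans hln)]
      simp [hj, hj.ne, hj.not_gt]
    · rw [hun.entry_iff hb.symm, bit_u l hln]
      simp [hln]
    · rw [hun.entry_iff hb, bit_u j hj]
      simp [hj, hlj, hlj.ne', hlj.not_gt]
    · by_contra h
      obtain ⟨d, hdT, hdn, hdu, hdE⟩ := exists_child_of_not_childOutside hb h
      refine hend d hdn hdu ?_ hdT
      rw [((hdn.entry_iff hb).1 hdE).2, mem_D u n hun]
      simp [hln, hln.ne', hln.not_gt]

end Tree

/-! ## Weak König's lemma from compactness for honest covers -/

theorem isOpenIn_openSeq {I : Set N} {U : N → Set N} {g : Set N} [InModel g]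
    (hg : IsFunction allPairs (finSubsets I) g) (m : N) :
    IsOpenIn (toL2 N) I U (openSeq U g m) := by
  have hs : InModel {w | ∃ n, n < w + 1 ∧ ∃ e, e < w + 1 ∧
    (w = pair n e ∧ pair (pair m n) e ∈ g)} := inferInstance
  have mem_s : ∀ n e, pair n e ∈ {w | ∃ n, n < w + 1 ∧ ∃ e, e < w + 1 ∧
      (w = pair n e ∧ pair (pair m n) e ∈ g)} ↔ pair (pair m n) e ∈ g := by
    intro n e
    constructor
    · rintro ⟨n', _, e', _, h, h'⟩
      obtain ⟨rfl, rfl⟩ := pair_inj.1 h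
      exact h'
    · exact fun h => ⟨n, lt_add_one_iff.2 (left_le_pair _ _), e,
        lt_add_one_iff.2 (right_le_pair _ _), rfl, h⟩
  refine ⟨_, hs.mem, ⟨?_, fun n _ => ?_⟩, ?_⟩
  · rintro _ ⟨n, _, e, _, rfl, h⟩
    obtain ⟨_, _, e', he', h'⟩ := hg.1 _ h
    obtain ⟨-, rfl⟩ := pair_inj.1 h'
    exact ⟨n, trivial, e, he', rfl⟩
  · obtain ⟨e, he, he'⟩ := hg.2 (pair m n) ⟨m, n, rfl⟩
    exact ⟨e, (mem_s n e).2 he, fun e' h => he' e' ((mem_s n e').1 h)⟩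
  · ext x
    simp only [openSeq, openSet, mem_s, Set.mem_ofPred_eq]

/-- An order in which all points are effectively isolated is bounded as a set if it is compact
with respect to honest covers. -/
theorem exists_bound_of_isHonestlyCompactSpace {L R : Set N}
    (h : IsCountableLinearOrder (toL2 N) L R)
    (hc : IsHonestlyCompactSpace (toL2 N) L (intervalIndices L) (interval L R))
    {E : N → Prop} (hE : Sigma1 (fun v : ℕ → N => E (v 0)))
    (sound : ∀ m i, E (pair m i) →
      i ∈ intervalIndices L ∧ interval L R i = {x | x ∈ L ∧ x = m})
    (total : ∀ m ∈ L, ∃ i, E (pair m i)) : ∃ n, ∀ x ∈ L, x < n := by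
  have hL : InModel L := ⟨h.carrier_mem⟩
  obtain ⟨G, hG, hEG⟩ := hE.exists_projection
  obtain ⟨f, hf, hf1, hf2⟩ := exists_singleton_cover L
  -- The second argument is read as `⟨i, w⟩`, and the index `i` is issued if `w` witnesses the
  -- evidence for it. This searches for the neighbours of all `m` uniformly, which is what honesty
  -- demands.
  obtain ⟨g, hg, hg1, hg2⟩ := exists_finSubsets_function
    (Q := fun c i => ∃ m, m < c + 1 ∧ ∃ w, w < c + 1 ∧
      (c = pair m (pair i w) ∧ pair (pair m i) w ∈ G)) (C := intervalIndices L) (by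
      rintro c i ⟨m, _, w, _, rfl, hw⟩
      exact ⟨lt_add_one_iff.2 ((left_le_pair _ _).trans (right_le_pair _ _)),
        (sound m i ((hEG _).2 ⟨w, hw⟩)).1⟩)
  have hg' : InModel g := ⟨hg⟩
  have hfg : ∀ m, enumSet f m = openSeq (interval L R) g m := by
    intro m
    rw [hf2]
    ext x
    constructor
    · rintro ⟨hx, rfl⟩
      obtain ⟨i, hi⟩ := total x hx
      obtain ⟨w, hw⟩ := (hEG _).1 hi
      obtain ⟨e, he, hie⟩ := (hg2 x (pair i w) i).2 ⟨x, lt_add_one_iff.2 (left_le_pair _ _), w,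
        lt_add_one_iff.2 ((right_le_pair _ _).trans (right_le_pair _ _)), rfl, hw⟩
      refine ⟨pair i w, e, i, he, hie, ?_⟩
      rw [(sound x i hi).2]
      exact ⟨hx, rfl⟩
    · rintro ⟨n, e, i, he, hie, hx⟩
      obtain ⟨m', _, w, _, hp, hw⟩ := (hg2 m n i).1 ⟨e, he, hie⟩
      obtain ⟨rfl, rfl⟩ := pair_inj.1 hp
      rwa [(sound m i ((hEG _).2 ⟨w, hw⟩)).2] at hx
  obtain ⟨n, hn⟩ := hc f ⟨hf, hf1, fun m => hfg m ▸ isOpenIn_openSeq hg1 m,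
    fun x hx => ⟨x, by rw [hf2]; exact ⟨hx, rfl⟩⟩⟩ ⟨g, hg, hg1, hfg⟩
  refine ⟨n, fun x hx => ?_⟩
  obtain ⟨m, hm, hxm⟩ := hn x hx
  rw [hf2] at hxm
  exact hxm.2 ▸ hm

/-- Evidence that the extended point `a` comes immediately after the node `m`, where `e` stands
for the end of the order. -/
def IsNeighbour (T : Set N) (b b' e m a : N) : Prop :=
  (a = e ∧ IsLast T b' m) ∨ ∃ t, t ∈ T ∧ a = finitePoint t ∧ IsNext T b b' m t

instance Sigma1.childOutside (T : Set N) [InModel T] (b : N) (i j : ℕ) :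
    Sigma1 (fun v : ℕ → N => ChildOutside T b (v i) (v j)) := by
  simp only [ChildOutside]
  infer_instance

instance Sigma1.isLast (T : Set N) [InModel T] (b' : N) (i : ℕ) :
    Sigma1 (fun v : ℕ → N => IsLast T b' (v i)) := by
  simp only [IsLast]
  infer_instance

instance Sigma1.isNextAbove (T : Set N) [InModel T] (b b' : N) (i j : ℕ) :
    Sigma1 (fun v : ℕ → N => IsNextAbove T b b' (v i) (v j)) := by
  simp only [IsNextAbove]
  infer_instance

instance Sigma1.isNext (T : Set N) [InModel T] (b b' : N) (i j : ℕ) :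
    Sigma1 (fun v : ℕ → N => IsNext T b b' (v i) (v j)) := by
  simp only [IsNext]
  infer_instance

instance Sigma1.isNeighbour (T : Set N) [InModel T] (b b' e : N) (i j : ℕ) :
    Sigma1 (fun v : ℕ → N => IsNeighbour T b b' e (v i) (v j)) := by
  simp only [IsNeighbour, finitePoint]
  infer_instance

section Tree

variable {T : Set N} [InModel T] (hT : IsBinaryTree T)

include hT in
theorem IsNeighbour.abovePoint {m a : N} (hm : m ∈ T) (h : IsNeighbour T 0 1 1 m a) :
    AbovePoint (treeOrder T) a m ∧
      ∀ q, pair m q ∈ treeOrder T → ¬ AbovePoint (treeOrder T) a q := by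
  rcases h with ⟨rfl, h⟩ | ⟨t, ht, rfl, h⟩
  · refine ⟨.inl rfl, fun q hq => ?_⟩
    obtain ⟨_, hqT, hmq⟩ := pair_mem_treeOrder.1 hq
    exact absurd hmq (h.not_before hT isFlip_zero_one hqT)
  · refine ⟨.inr ⟨t, rfl, pair_mem_treeOrder.2 ⟨hm, ht, h.before isFlip_zero_one⟩⟩, ?_⟩
    rintro q hq (h' | ⟨t', e, h'⟩)
    · exact finitePoint_ne_one t h'
    · obtain rfl := finitePoint_inj.1 e
      obtain ⟨_, hqT, hmq⟩ := pair_mem_treeOrder.1 hq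
      exact h.not_between hT isFlip_zero_one hqT hmq (pair_mem_treeOrder.1 h').2.2

include hT in
theorem IsNeighbour.belowPoint {m a : N} (hm : m ∈ T) (h : IsNeighbour T 1 0 0 m a) :
    BelowPoint (treeOrder T) a m ∧
      ∀ q, pair q m ∈ treeOrder T → ¬ BelowPoint (treeOrder T) a q := by
  rcases h with ⟨rfl, h⟩ | ⟨t, ht, rfl, h⟩
  · refine ⟨.inl rfl, fun q hq => ?_⟩
    obtain ⟨hqT, _, hmq⟩ := pair_mem_treeOrder.1 hq
    exact absurd (before_flip.2 hmq) (h.not_before hT isFlip_zero_one.symm hqT)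
  · refine ⟨.inr ⟨t, rfl, pair_mem_treeOrder.2
      ⟨ht, hm, before_flip.1 (h.before isFlip_zero_one.symm)⟩⟩, ?_⟩
    rintro q hq (h' | ⟨t', e, h'⟩)
    · exact finitePoint_ne_zero t h'
    · obtain rfl := finitePoint_inj.1 e
      obtain ⟨hqT, _, hmq⟩ := pair_mem_treeOrder.1 hq
      exact h.not_between hT isFlip_zero_one.symm hqT (before_flip.2 hmq)
        (before_flip.2 (pair_mem_treeOrder.1 h').2.2)

end Tree

/-- In a pathless infinite tree, pairs of neighbours with their `Σ⁰₁` evidence isolate all nodes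
uniformly. Honest compactness then bounds the codes of the nodes, against infinity of the tree. -/
theorem weakKoenigLemma_of_honestlyCompact
    (H : ∀ L R : Set N, IsCountableLinearOrder (toL2 N) L R → IsCompleteOrder (toL2 N) L R →
      IsHonestlyCompactSpace (toL2 N) L (intervalIndices L) (interval L R)) :
    ∀ T : Set N, T ∈ sets → IsBinaryTree T → IsInfinite T → ∃ f ∈ sets, IsPath T f := by
  intro T hTs hT hinf
  by_contra! hpath
  have hT' : InModel T := ⟨hTs⟩
  have hne : T.Nonempty := (hinf 0).imp fun _ h => h.1
  have hlin := treeOrder_isCountableLinearOrder hT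
  obtain ⟨n, hn⟩ := exists_bound_of_isHonestlyCompactSpace hlin
    (H T _ hlin (isCompleteOrder_treeOrder hT hne hpath))
    (E := fun c => ∃ m, ∃ a, ∃ b, c = pair m (pair a b) ∧ m ∈ T ∧ IsNeighbour T 1 0 0 m a ∧
      IsNeighbour T 0 1 1 m b) inferInstance
    (by
      rintro m i ⟨m', a, b, e, hm, ha, hb⟩
      obtain ⟨rfl, rfl⟩ := pair_inj.1 e
      have ha := ha.belowPoint hT hm
      have hb := hb.abovePoint hT hm
      exact ⟨pair_mem_intervalIndices hlin ha.1 hb.1,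
        interval_eq_singleton hlin hm ha.1 ha.2 hb.1 hb.2⟩)
    (by
      intro m hm
      have key : ∀ {b b'} (e : N), IsFlip b b' → ∃ a, IsNeighbour T b b' e m a := by
        intro b b' e hb
        rcases exists_isNext hT hne hpath hb hm with h | ⟨t, ht, h⟩
        · exact ⟨e, .inl ⟨rfl, h⟩⟩
        · exact ⟨finitePoint t, .inr ⟨t, ht, rfl, h⟩⟩
      obtain ⟨a, ha⟩ := key 0 isFlip_zero_one.symm
      obtain ⟨b, hb⟩ := key 1 isFlip_zero_one
      exact ⟨pair a b, m, a, b, rfl, hm, ha, hb⟩)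
  obtain ⟨x, hx, hnx⟩ := hinf n
  exact lt_asymm hnx (hn x hx)

/-! ## Models of `RCA₀` and their ordered semirings -/

section Transfer

variable {M : L2Structure.{u}} (h : DiscretelyOrderedSemiring M.Num)

/-- The commutative semiring of the numbers of a structure. -/
abbrev DiscretelyOrderedSemiring.commSemiring : CommSemiring M.Num where
  add_assoc := h.add_assoc
  zero_add x := (h.add_comm 0 x).trans (h.add_zero x)
  add_zero := h.add_zero
  add_comm := h.add_comm
  mul_assoc := h.mul_assoc
  one_mul x := (h.mul_comm 1 x).trans (h.mul_one x)
  mul_one := h.mul_one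
  mul_comm := h.mul_comm
  zero_mul x := (h.mul_comm 0 x).trans (h.mul_zero x)
  mul_zero := h.mul_zero
  left_distrib := h.mul_add
  right_distrib x y z := by
    rw [h.mul_comm, h.mul_add, h.mul_comm z x, h.mul_comm z y]
  nsmul := nsmulRec
  npow := npowRec

/-- The linear order of the numbers of a structure. -/
noncomputable abbrev DiscretelyOrderedSemiring.linearOrder : LinearOrder M.Num where
  lt := M.lt.lt
  le x y := x < y ∨ x = y
  le_refl x := .inr rfl
  le_trans x y z := by
    rintro (hxy | rfl) (hyz | rfl)
    exacts [.inl (h.lt_trans x y z hxy hyz), .inl hxy, .inl hyz, .inr rfl]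
  le_antisymm x y := by
    rintro (hxy | rfl) (hyx | e)
    exacts [absurd (h.lt_trans x y x hxy hyx) (h.lt_irrefl x), e.symm, rfl, rfl]
  lt_iff_le_not_ge x y := by
    constructor
    · refine fun hxy => ⟨.inl hxy, ?_⟩
      rintro (hyx | rfl)
      exacts [h.lt_irrefl x (h.lt_trans x y x hxy hyx), h.lt_irrefl y hxy]
    · rintro ⟨hxy | rfl, hn⟩
      exacts [hxy, absurd (.inr rfl) hn]
  le_total x y := by
    rcases h.lt_trichotomy x y with h | h | h
    exacts [.inl (.inl h), .inl (.inr h), .inr (.inl h)]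
  toDecidableLE := Classical.decRel _

/-- The numbers of a model of `RCA₀`, with the sets of the model. -/
noncomputable abbrev RCA0.rcaModel (hM : RCA0 M) : RCAModel M.Num :=
  { hM.1.commSemiring, hM.1.linearOrder with
    add_le_add_left := fun x y hxy z => by
      rcases hxy with hxy | rfl
      exacts [.inl (hM.1.add_lt_add x y z hxy), .inr rfl]
    le_of_add_le_add_left := fun x y z hxy => by
      rcases hM.1.lt_trichotomy y z with h | h | h
      · exact .inl h
      · exact .inr h
      · have h1 := hM.1.add_lt_add z y x h
        rw [hM.1.add_comm z, hM.1.add_comm y] at h1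
        rcases hxy with h2 | h2
        · exact absurd (hM.1.lt_trans _ _ _ h1 h2) (hM.1.lt_irrefl _)
        · exact absurd (h2 ▸ h1) (hM.1.lt_irrefl _)
    zero_le_one := .inl hM.1.zero_lt_one
    exists_pair_ne := ⟨0, 1, fun e => hM.1.lt_irrefl 0 (e.symm ▸ hM.1.zero_lt_one)⟩
    mul_lt_mul_of_pos_left := fun x hx y z hyz => by
      have := hM.1.mul_lt_mul y z x hx hyz
      rwa [hM.1.mul_comm y, hM.1.mul_comm z] at this
    mul_lt_mul_of_pos_right := fun x hx y z hyz => hM.1.mul_lt_mul y z x hx hyz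
    exists_add_of_le := fun {x y} hxy => by
      rcases hxy with hxy | rfl
      · exact (hM.1.exists_add x y hxy).imp fun _ => Eq.symm
      · exact ⟨0, (hM.1.add_zero x).symm⟩
    le_add_self := fun x y => by
      rcases hM.1.zero_or_pos y with rfl | hy
      · exact .inr ((hM.1.add_comm 0 x).trans (hM.1.add_zero x)).symm
      · have := hM.1.add_lt_add 0 y x hy
        rw [hM.1.add_comm 0, hM.1.add_zero] at this
        exact .inl this
    le_self_add := fun x y => by
      rcases hM.1.zero_or_pos y with rfl | hy
      · exact .inr (hM.1.add_zero x).symm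
      · have := hM.1.add_lt_add 0 y x hy
        rw [hM.1.add_comm 0, hM.1.add_zero, hM.1.add_comm] at this
        exact .inl this
    sets := M.Sets
    sets_nonempty := M.sets_nonempty
    add_one_le_of_lt := fun x y hxy => by
      obtain ⟨z, rfl⟩ := hM.1.exists_add x y hxy
      rcases hM.1.zero_or_pos z with rfl | hz
      · rw [hM.1.add_zero] at hxy
        exact absurd hxy (hM.1.lt_irrefl x)
      · rcases hM.1.discrete z hz with rfl | hz
        · exact .inr rfl
        · have := hM.1.add_lt_add 1 z x hz
          rw [hM.1.add_comm 1, hM.1.add_comm z] at this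
          exact .inl this
    sigma_induction := hM.2.1
    delta_comprehension := hM.2.2 }

theorem RCA0.wkl0_iff (hM : RCA0 M) : WKL0 M ↔ CompleteOrdersHonestlyCompact M := by
  let := hM.rcaModel
  exact ⟨fun h L R hL hc => isHonestlyCompactSpace_of_wkl (N := M.Num) h.2 hL hc,
    fun h => ⟨hM, weakKoenigLemma_of_honestlyCompact (N := M.Num) h⟩⟩

theorem RCA0.aca0_iff (hM : RCA0 M) : ACA0 M ↔ CompleteOrdersCompact M := by
  let := hM.rcaModel
  exact ⟨fun h L R hL hc => isCompactSpace_of_sigma1_comprehension (N := M.Num)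
      (fun P => sigma1_comprehension_of_arith h.2 P) hL hc,
    fun h => ⟨hM, arithComprehension_of_sigma1 (N := M.Num)
      fun P => sigma1_comprehension_of_compact h P⟩⟩

end Transfer

end SecondOrderArithmetic

theorem mainTheorem1 :
    EquivalentOver.{u} RCA0 WKL0 CompleteOrdersHonestlyCompact ∧
      EquivalentOver.{u} RCA0 ACA0 CompleteOrdersCompact := by
  exact ⟨fun _ hM => hM.wkl0_iff, fun _ hM => hM.aca0_iff⟩
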